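/- Let $\mathbb{H}_2$ be the tree on $7$ vertices that consists of a path $p_1p_2p_3p_4p_5$ on five vertices together with one pendant vertex attached to $p_2$ and one pendant vertex attached to $p_4$. A finite simple graph $G$ contains a graph $H$ as an \emph{induced minor} if $G$ can be transformed into a graph isomorphic to $H$ by a finite sequence of vertex deletions and edge contractions (loops and multiple edges that a contraction creates are removed). The problem $\mathbb{H}_2$-\textsc{Induced Minor} asks whether a given finite simple graph $G$ contains $\mathbb{H}_2$ as an induced minor. \textbf{Theorem.} $\mathbb{H}_2$-\textsc{Induced Minor} is solvable in polynomial time; in fact, it is solvable in time $O(n^9)$, where $n$ is the number of vertices of $G$. Here time is the number of steps of a deterministic word RAM with words of $O(\log n)$ bits, whose input is $n$ and the adjacency matrix of $G$. -/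

import Mathlib

/-! ### Induced minors -/

/-- The graph obtained from `G` by contracting `v` into `u`: the vertex `v` disappears and `u`
becomes adjacent to all former neighbours of `u` and of `v` (no loops, no multiple edges).
It is used when `u` and `v` are adjacent. -/
def contractEdge {V : Type} (G : SimpleGraph V) (u v : V) : SimpleGraph {x : V // x ≠ v} where
  Adj x y := x ≠ y ∧
    (G.Adj x y ∨ ((x : V) = u ∧ G.Adj v y) ∨ ((y : V) = u ∧ G.Adj x v))
  symm := ⟨by
    rintro x y ⟨hne, h⟩
    refine ⟨hne.symm, ?_⟩
    rcases h with h | ⟨h₁, h₂⟩ | ⟨h₁, h₂⟩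
    · exact Or.inl h.symm
    · exact Or.inr (Or.inr ⟨h₁, h₂.symm⟩)
    · exact Or.inr (Or.inl ⟨h₁, h₂.symm⟩)⟩
  loopless := ⟨fun _ h => h.1 rfl⟩

/-- `HasInducedMinor G H`: the graph `G` can be transformed into (an isomorphic copy of) `H` by a
finite sequence of vertex deletions and edge contractions. -/
inductive HasInducedMinor {W : Type} (H : SimpleGraph W) : {V : Type} → SimpleGraph V → Prop
  | iso {V : Type} {G : SimpleGraph V} (e : G ≃g H) : HasInducedMinor H G
  | delete {V : Type} {G : SimpleGraph V} (v : V)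
      (h : HasInducedMinor H (G.induce {x | x ≠ v})) : HasInducedMinor H G
  | contract {V : Type} {G : SimpleGraph V} (u v : V) (huv : G.Adj u v)
      (h : HasInducedMinor H (contractEdge G u v)) : HasInducedMinor H G

/-- The tree on seven vertices formed by the path `0 - 1 - 3 - 5 - 6` with the pendant vertex `2`
attached to its second vertex `1` and the pendant vertex `4` attached to its fourth vertex `5`. -/
def graphH2 : SimpleGraph (Fin 7) :=
  SimpleGraph.fromEdgeSet {s(0, 1), s(1, 3), s(3, 5), s(5, 6), s(1, 2), s(5, 4)}

/-! ### The word RAM -/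

namespace WordRAM

/-- Programs of the random access machine. Registers are named by natural numbers; a program
mentions finitely many of them. `load x y` performs `x := mem[y]` and `store x y` performs
`mem[x] := y`; subtraction is truncated at zero. -/
inductive Program : Type
  | skip
  | const (x k : ℕ)
  | add (x y z : ℕ)
  | sub (x y z : ℕ)
  | mul (x y z : ℕ)
  | load (x y : ℕ)
  | store (x y : ℕ)
  | seq (p q : Program)
  | ifLess (x y : ℕ) (p q : Program)
  | whileLess (x y : ℕ) (p : Program)

/-- Contents of the registers and of the memory. -/
structure State where
  reg : ℕ → ℕ
  mem : ℕ → ℕ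

/-- Assign a value to a register. -/
def State.setReg (s : State) (x a : ℕ) : State :=
  { s with reg := Function.update s.reg x a }

/-- Assign a value to a memory cell. -/
def State.setMem (s : State) (i a : ℕ) : State :=
  { s with mem := Function.update s.mem i a }

/-- `Run W p s t s'`: on a machine whose words hold the numbers smaller than `W`, the program `p`
started in state `s` halts after `t` steps in state `s'`. Every elementary instruction and every
evaluation of a test costs one step. There is no rule for an instruction whose result does not
fit into a word: such a computation is stuck and never halts. -/
inductive Run (W : ℕ) : Program → State → ℕ → State → Prop
  | skip (s : State) : Run W .skip s 1 s
  | const (s : State) (x k : ℕ) (h : k < W) : Run W (.const x k) s 1 (s.setReg x k)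
  | add (s : State) (x y z : ℕ) (h : s.reg y + s.reg z < W) :
      Run W (.add x y z) s 1 (s.setReg x (s.reg y + s.reg z))
  | sub (s : State) (x y z : ℕ) (h : s.reg y - s.reg z < W) :
      Run W (.sub x y z) s 1 (s.setReg x (s.reg y - s.reg z))
  | mul (s : State) (x y z : ℕ) (h : s.reg y * s.reg z < W) :
      Run W (.mul x y z) s 1 (s.setReg x (s.reg y * s.reg z))
  | load (s : State) (x y : ℕ) (h : s.mem (s.reg y) < W) :
      Run W (.load x y) s 1 (s.setReg x (s.mem (s.reg y)))
  | store (s : State) (x y : ℕ) (h : s.reg y < W) :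
      Run W (.store x y) s 1 (s.setMem (s.reg x) (s.reg y))
  | seq {p q : Program} {s s' s'' : State} {t t' : ℕ}
      (hp : Run W p s t s') (hq : Run W q s' t' s'') : Run W (.seq p q) s (t + t') s''
  | ifTrue {p q : Program} {s s' : State} {t : ℕ} (x y : ℕ) (h : s.reg x < s.reg y)
      (hp : Run W p s t s') : Run W (.ifLess x y p q) s (t + 1) s'
  | ifFalse {p q : Program} {s s' : State} {t : ℕ} (x y : ℕ) (h : ¬ s.reg x < s.reg y)
      (hq : Run W q s t s') : Run W (.ifLess x y p q) s (t + 1) s'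
  | whileTrue {p : Program} {s s' s'' : State} {t t' : ℕ} (x y : ℕ) (h : s.reg x < s.reg y)
      (hp : Run W p s t s') (hw : Run W (.whileLess x y p) s' t' s'') :
      Run W (.whileLess x y p) s (t + t' + 1) s''
  | whileFalse {p : Program} {s : State} (x y : ℕ) (h : ¬ s.reg x < s.reg y) :
      Run W (.whileLess x y p) s 1 s

/-- The machine is deterministic: running time and final state are determined by the program and
the initial state. -/
theorem Run.deterministic {W : ℕ} {p : Program} {s s₁ s₂ : State} {t₁ t₂ : ℕ}
    (h₁ : Run W p s t₁ s₁) (h₂ : Run W p s t₂ s₂) : t₁ = t₂ ∧ s₁ = s₂ := by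
  induction h₁ generalizing t₂ s₂ with
  | skip | const | add | sub | mul | load | store => cases h₂; exact ⟨rfl, rfl⟩
  | seq _ _ ih ih' =>
    cases h₂ with
    | seq hp hq =>
      obtain ⟨rfl, rfl⟩ := ih hp
      obtain ⟨rfl, rfl⟩ := ih' hq
      exact ⟨rfl, rfl⟩
  | ifTrue x y h _ ih =>
    cases h₂ with
    | ifTrue _ _ _ hp => obtain ⟨rfl, rfl⟩ := ih hp; exact ⟨rfl, rfl⟩
    | ifFalse _ _ h' _ => exact absurd h h'
  | ifFalse x y h _ ih =>
    cases h₂ with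
    | ifTrue _ _ h' _ => exact absurd h' h
    | ifFalse _ _ _ hq => obtain ⟨rfl, rfl⟩ := ih hq; exact ⟨rfl, rfl⟩
  | whileTrue x y h _ _ ih ih' =>
    cases h₂ with
    | whileTrue _ _ _ hp hw =>
      obtain ⟨rfl, rfl⟩ := ih hp
      obtain ⟨rfl, rfl⟩ := ih' hw
      exact ⟨rfl, rfl⟩
    | whileFalse _ _ h' => exact absurd h h'
  | whileFalse x y h =>
    cases h₂ with
    | whileTrue _ _ h' _ _ => exact absurd h' h
    | whileFalse => exact ⟨rfl, rfl⟩

open Classical in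
/-- The initial state on the input graph `G` with vertex set `{0, …, n - 1}`: register `0` holds
`n`, the memory holds the adjacency matrix of `G` row by row (entry `(i, j)` in cell `i * n + j`),
everything else is zero. -/
noncomputable def initialState {n : ℕ} (G : SimpleGraph (Fin n)) : State where
  reg := fun x => if x = 0 then n else 0
  mem := fun a => if ∃ i j : Fin n, a = (i : ℕ) * n + (j : ℕ) ∧ G.Adj i j then 1 else 0

/-- The decision problem `P` on finite graphs is solvable in time `T`, as a function of the number
`n` of vertices: one program, on a machine with words of `O(log n)` bits (numbers smaller than
`(n + 2) ^ k` for a constant `k`), halts on every `n`-vertex graph `G` after at most `T n` steps,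
with answer `1` in register `0` if `P G` holds and answer `0` otherwise. -/
def SolvableInTime (P : ∀ n : ℕ, SimpleGraph (Fin n) → Prop) (T : ℕ → ℕ) : Prop :=
  ∃ (p : Program) (k : ℕ), ∀ (n : ℕ) (G : SimpleGraph (Fin n)),
    ∃ (t : ℕ) (s : State), Run ((n + 2) ^ k) p (initialState G) t s ∧ t ≤ T n ∧
      (P n G → s.reg 0 = 1) ∧ (¬ P n G → s.reg 0 = 0)

end WordRAM

/-! An induced minor is a family of disjoint connected branch sets with prescribed adjacencies. For
`graphH2`, the four leaves and the middle vertex can be shrunk to single vertices, so only the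
branch sets `A` and `B` of the two vertices of degree three are arbitrary connected sets
(`hasInducedMinor_graphH2_iff`). Two polynomial tests find such a model.

Suppose first that some model has an end `{x, y, z}` with consecutive vertices equal or adjacent.
Guess `x, y, z` and the four leaves. The other branch set may then be taken to be a whole component
of the graph left after deleting what it must avoid, so it remains to look for the middle vertex and
a neighbour of it in a suitable component. This is `SmallTest`.

If no such model exists (`NoSmallModel`), every model contains one with the same middle vertex `c`
and with `A` and `B` inside the neighbourhood of `c`: `NoSmallModel.exists_subset_neighborSet`, by
induction on the size of `A`. An inclusion-minimal `A` has two non-cut vertices, each of which is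
the only contact of `c` or of a leaf. If `c` has such a unique contact `u`, either a small model
appears or `u` can become the middle vertex, and induction then yields a claw at `u`. Otherwise the
two vertices are the contacts of the two leaves, which forces `A` into the neighbourhood of `c`.

Take a hub model with `|A| + |B|` least. Each leaf then has a single contact
(`IsLeastHub.exists_ends`); let `v`, `v'` be those of `a₁`, `a₂` and `w`, `w'` those of `b₁`, `b₂`.
No connected set of neighbours of `c` that are nonadjacent to the leaves and not common neighbours
of `v` and `w` joins `A` to `B` from outside (`IsLeastHub.not_link`). Hence after guessing `c`, the
leaves, `v` and `w`, the components of `v` and `w` among the permitted vertices can replace `A` and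
`B` up to `v'` and `w'`. This is `HubTest`; together the tests give
`hasInducedMinor_graphH2_iff_tests`.

Each test guesses seven vertices and spends `O(n ^ 2)` steps per guess: components by incremental
relabelling (`halts_components`), two unary tables with one quantifier per entry, and a query with
two quantifiers (`exists_blockCost_le`). This gives the exponent nine. Queries are first-order
formulas compiled to machine code, so correctness and running time are proved once, by induction on
formulas. -/

/-! ### Connected vertex sets -/

/-- A nonempty vertex set is connected when no proper nonempty part of it is closed under
adjacency inside the set. -/
def ConnSet {V : Type} (G : SimpleGraph V) (A : Set V) : Prop :=
  A.Nonempty ∧ ∀ S ⊆ A, S.Nonempty → (∀ x ∈ S, ∀ y ∈ A, G.Adj x y → y ∈ S) → A ⊆ S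

theorem connSet_singleton {V : Type} (G : SimpleGraph V) (x : V) : ConnSet G {x} := by
  refine ⟨⟨x, rfl⟩, ?_⟩
  rintro S hS ⟨y, hy⟩ - z rfl
  rw [← Set.mem_singleton_iff.1 (hS hy)]
  exact hy

theorem ConnSet.union {V : Type} {G : SimpleGraph V} {A B : Set V} (hA : ConnSet G A)
    (hB : ConnSet G B) {x y : V} (hx : x ∈ A) (hy : y ∈ B) (h : G.Adj x y) :
    ConnSet G (A ∪ B) := by
  refine ⟨⟨x, Or.inl hx⟩, fun S hS hne hcl => ?_⟩
  have key : ∀ C, ConnSet G C → C ⊆ A ∪ B → (∃ z ∈ S, z ∈ C) → C ⊆ S := by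
    rintro C hC hCs ⟨z, hz, hz'⟩
    have := hC.2 (S ∩ C) Set.inter_subset_right ⟨z, hz, hz'⟩
      fun p hp q hq hpq => ⟨hcl p hp.1 q (hCs hq) hpq, hq⟩
    exact fun p hp => (this hp).1
  obtain ⟨z, hz⟩ := hne
  rcases hS hz with hzA | hzB
  · have h1 := key A hA Set.subset_union_left ⟨z, hz, hzA⟩
    have h2 := key B hB Set.subset_union_right ⟨y, hcl x (h1 hx) y (Or.inr hy) h, hy⟩
    exact Set.union_subset h1 h2
  · have h1 := key B hB Set.subset_union_right ⟨z, hz, hzB⟩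
    have h2 := key A hA Set.subset_union_left ⟨x, hcl y (h1 hy) x (Or.inl hx) h.symm, hx⟩
    exact Set.union_subset h2 h1

theorem ConnSet.insert_of_adj {V : Type} {G : SimpleGraph V} {A : Set V} (hA : ConnSet G A) {x y : V}
    (hx : x ∈ A) (h : G.Adj y x) : ConnSet G (insert y A) := by
  rw [Set.insert_eq]
  exact (connSet_singleton G y).union hA rfl hx h

theorem connSet_pair {V : Type} {G : SimpleGraph V} {x y : V} (h : x = y ∨ G.Adj x y) :
    ConnSet G {x, y} := by
  rcases h with rfl | h
  · simpa using connSet_singleton G x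
  · exact (connSet_singleton G y).insert_of_adj rfl h

theorem ConnSet.exists_adj_notMem {V : Type} {G : SimpleGraph V} {A S : Set V}
    (hA : ConnSet G A) (hS : S ⊆ A) (hne : S.Nonempty) (h : S ≠ A) :
    ∃ x ∈ S, ∃ y ∈ A, y ∉ S ∧ G.Adj x y := by
  by_contra! hcon
  refine h (hS.antisymm (hA.2 S hS hne fun x hx y hy hxy => ?_))
  by_contra hy'
  exact hcon x hx y hy hy' hxy

theorem ConnSet.exists_adj_diff {V : Type} {G : SimpleGraph V} {A : Set V} (hA : ConnSet G A)
    {u : V} (hu : u ∈ A) (h : A ≠ {u}) : ∃ y ∈ A \ {u}, G.Adj u y := by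
  obtain ⟨x, rfl, y, hy, hyx, hxy⟩ :=
    hA.exists_adj_notMem (Set.singleton_subset_iff.2 hu) ⟨u, rfl⟩ h.symm
  exact ⟨y, ⟨hy, hyx⟩, hxy⟩

theorem exists_maximal_set {V : Type} [Finite V] (P : Set V → Prop) {C : Set V} (hC : P C) :
    ∃ D, C ⊆ D ∧ P D ∧ ∀ E, P E → D ⊆ E → E = D := by
  obtain ⟨D, hCD, hD⟩ := (Set.toFinite {D | P D}).exists_le_maximal (a := C) hC
  exact ⟨D, hCD, hD.1, fun E hE hDE => (hD.2 hE hDE).antisymm hDE⟩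

/-- A connected set with more than one vertex has a vertex other than `x` whose removal leaves it
connected. -/
theorem ConnSet.exists_noncut {V : Type} [Finite V] {G : SimpleGraph V} {A : Set V}
    (hA : ConnSet G A) {x : V} (hx : x ∈ A) (h : A ≠ {x}) :
    ∃ u ∈ A, u ≠ x ∧ ConnSet G (A \ {u}) := by
  -- A maximal connected proper subset containing `x` misses exactly one vertex, since adding any
  -- adjacent vertex must already give all of `A`.
  obtain ⟨D, hxD, ⟨hD, hDA, hne⟩, hmax⟩ := exists_maximal_set
    (fun D => ConnSet G D ∧ D ⊆ A ∧ D ≠ A) (C := {x})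
    ⟨connSet_singleton G x, Set.singleton_subset_iff.2 hx, h.symm⟩
  obtain ⟨p, hp, y, hy, hyD, hpy⟩ := hA.exists_adj_notMem hDA hD.1 hne
  have hins : insert y D = A := by
    by_contra hcon
    have := hmax (insert y D) ⟨hD.insert_of_adj hp hpy.symm, Set.insert_subset hy hDA, hcon⟩
      (Set.subset_insert _ _)
    exact hyD (this ▸ Set.mem_insert y D)
  refine ⟨y, hy, ?_, ?_⟩
  · rintro rfl
    exact hyD (hxD rfl)
  · rwa [← hins, Set.insert_sdiff_self_of_notMem hyD]

theorem ConnSet.exists_two_noncut {V : Type} [Finite V] {G : SimpleGraph V} {A : Set V}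
    (hA : ConnSet G A) (h : ∀ x, A ≠ {x}) :
    ∃ u ∈ A, ∃ w ∈ A, u ≠ w ∧ ConnSet G (A \ {u}) ∧ ConnSet G (A \ {w}) := by
  obtain ⟨x, hx⟩ := hA.1
  obtain ⟨u, hu, -, hu'⟩ := hA.exists_noncut hx (h x)
  obtain ⟨w, hw, hne, hw'⟩ := hA.exists_noncut hu (h u)
  exact ⟨u, hu, w, hw, hne.symm, hu', hw'⟩

theorem ConnSet.exists_component {V : Type} [Finite V] {G : SimpleGraph V} {A : Set V}
    (hA : ConnSet G A) {x u : V} (hx : x ∈ A) (hu : u ∈ A) (h : u ≠ x) :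
    ∃ D ⊆ A \ {x}, u ∈ D ∧ ConnSet G D ∧ ∃ y ∈ D, G.Adj x y := by
  obtain ⟨D, huD, ⟨hD, hDA⟩, hmax⟩ := exists_maximal_set
    (fun D => ConnSet G D ∧ D ⊆ A \ {x}) (C := {u})
    ⟨connSet_singleton G u, Set.singleton_subset_iff.2 ⟨hu, h⟩⟩
  refine ⟨D, hDA, huD rfl, hD, ?_⟩
  -- By maximality, the only vertex of `A` through which an edge can leave `D` is `x`.
  obtain ⟨p, hp, y, hy, hyD, hpy⟩ := hA.exists_adj_notMem (hDA.trans Set.sdiff_subset) hD.1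
    (fun he => (hDA (he ▸ hx)).2 rfl)
  by_cases hyx : y = x
  · exact ⟨p, hp, hyx ▸ hpy.symm⟩
  · have := hmax (insert y D) ⟨hD.insert_of_adj hp hpy.symm, Set.insert_subset ⟨hy, hyx⟩ hDA⟩
      (Set.subset_insert _ _)
    exact absurd (this ▸ Set.mem_insert y D) hyD

/-! ### Induced minors and branch sets -/

/-- A family of branch sets realizing `H` as an induced minor of `G`. -/
structure IsBranchFamily {V W : Type} (G : SimpleGraph V) (H : SimpleGraph W)
    (f : W → Set V) : Prop where
  conn : ∀ w, ConnSet G (f w)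
  disj : ∀ w w' x, x ∈ f w → x ∈ f w' → w = w'
  adj : ∀ w w', w ≠ w' → (H.Adj w w' ↔ ∃ x ∈ f w, ∃ y ∈ f w', G.Adj x y)

/-- Undoing a contraction puts `v` back beside `u`. The edge `uv` makes every closed part contain
both or neither, so closed parts descend to the contracted graph. -/
theorem ConnSet.preimage_contract {V : Type} {G : SimpleGraph V} {u v : V} (huv : G.Adj u v)
    {C : Set {x : V // x ≠ v}} (hC : ConnSet (contractEdge G u v) C) :
    ConnSet G {x | (∃ h, (⟨x, h⟩ : {x : V // x ≠ v}) ∈ C) ∨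
      x = v ∧ (⟨u, huv.ne⟩ : {x : V // x ≠ v}) ∈ C} := by
  refine ⟨?_, fun S hS hne hcl => ?_⟩
  · obtain ⟨⟨x, hx⟩, hxC⟩ := hC.1
    exact ⟨x, Or.inl ⟨hx, hxC⟩⟩
  have huS : (⟨u, huv.ne⟩ : {x : V // x ≠ v}) ∈ C → (u ∈ S ↔ v ∈ S) := fun hu =>
    ⟨fun h => hcl u h v (Or.inr ⟨rfl, hu⟩) huv,
      fun h => hcl v h u (Or.inl ⟨huv.ne, hu⟩) huv.symm⟩
  have key := hC.2 {p | p ∈ C ∧ (p : V) ∈ S} (fun p hp => hp.1) ?_ ?_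
  · rintro x (⟨h, hx⟩ | ⟨rfl, hu⟩)
    · exact (key hx).2
    · exact (huS hu).1 (key hu).2
  · obtain ⟨x, hx⟩ := hne
    rcases hS hx with ⟨h, hxC⟩ | ⟨rfl, hu⟩
    · exact ⟨⟨x, h⟩, hxC, hx⟩
    · exact ⟨⟨u, huv.ne⟩, hu, (huS hu).2 hx⟩
  · rintro ⟨p, hp⟩ ⟨hpC, hpS⟩ ⟨q, hq⟩ hqC ⟨-, h | ⟨h1, h2⟩ | ⟨h1, h2⟩⟩
    · exact ⟨hqC, hcl p hpS q (Or.inl ⟨hq, hqC⟩) h⟩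
    · obtain rfl : p = u := h1
      exact ⟨hqC, hcl v ((huS hpC).1 hpS) q (Or.inl ⟨hq, hqC⟩) h2⟩
    · obtain rfl : q = u := h1
      exact ⟨hqC, (huS hqC).2 (hcl p hpS v (Or.inr ⟨rfl, hqC⟩) h2)⟩

theorem HasInducedMinor.exists_branchFamily {V W : Type} {H : SimpleGraph W}
    {G : SimpleGraph V} (h : HasInducedMinor H G) : ∃ f, IsBranchFamily G H f := by
  induction h with
  | @iso V G e =>
    refine ⟨fun w => {e.symm w}, fun w => connSet_singleton _ _, ?_, fun w w' _ => ?_⟩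
    · rintro w w' x rfl h
      exact e.symm.injective h
    · simp [e.symm.map_adj_iff]
  | @delete V G v _ ih =>
    obtain ⟨f, hf⟩ := ih
    refine ⟨fun w => Subtype.val '' f w, fun w => ⟨(hf.conn w).1.image _, ?_⟩, ?_, ?_⟩
    · rintro S hS hne hcl - ⟨p, hp, rfl⟩
      refine ((hf.conn w).2 {p | p ∈ f w ∧ (p : V) ∈ S} (fun _ h => h.1) ?_ ?_ hp).2
      · obtain ⟨x, hx⟩ := hne
        obtain ⟨p, hp, rfl⟩ := hS hx
        exact ⟨p, hp, hx⟩
      · rintro p ⟨hp, hpS⟩ q hq hpq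
        exact ⟨hq, hcl p hpS q ⟨q, hq, rfl⟩ hpq⟩
    · rintro w w' - ⟨p, hp, rfl⟩ ⟨q, hq, hqp⟩
      rw [Subtype.ext hqp] at hq
      exact hf.disj w w' p hp hq
    · intro w w' hne
      rw [hf.adj w w' hne]
      constructor
      · rintro ⟨x, hx, y, hy, hxy⟩
        exact ⟨x, ⟨x, hx, rfl⟩, y, ⟨y, hy, rfl⟩, hxy⟩
      · rintro ⟨-, ⟨x, hx, rfl⟩, -, ⟨y, hy, rfl⟩, hxy⟩
        exact ⟨x, hx, y, hy, hxy⟩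
  | @contract V G u v huv _ ih =>
    obtain ⟨f, hf⟩ := ih
    refine ⟨fun w => {x | (∃ h, (⟨x, h⟩ : {x : V // x ≠ v}) ∈ f w) ∨
      x = v ∧ (⟨u, huv.ne⟩ : {x : V // x ≠ v}) ∈ f w},
      fun w => (hf.conn w).preimage_contract huv, ?_, ?_⟩
    · rintro w w' x (⟨h, hx⟩ | ⟨rfl, hx⟩) (⟨h', hx'⟩ | ⟨h', hx'⟩)
      · exact hf.disj w w' _ hx hx'
      · exact absurd h' h
      · exact absurd rfl h'
      · exact hf.disj w w' _ hx hx'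
    · intro w w' hne
      rw [hf.adj w w' hne]
      constructor
      · rintro ⟨⟨x, hxv⟩, hx, ⟨y, hyv⟩, hy, -, h | ⟨h1, h2⟩ | ⟨h1, h2⟩⟩
        · exact ⟨x, Or.inl ⟨hxv, hx⟩, y, Or.inl ⟨hyv, hy⟩, h⟩
        · obtain rfl : x = u := h1
          exact ⟨v, Or.inr ⟨rfl, hx⟩, y, Or.inl ⟨hyv, hy⟩, h2⟩
        · obtain rfl : y = u := h1
          exact ⟨x, Or.inl ⟨hxv, hx⟩, v, Or.inr ⟨rfl, hy⟩, h2⟩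
      · have hd : ∀ p q, p ∈ f w → q ∈ f w' → p ≠ q := by
          rintro p q hp hq rfl
          exact hne (hf.disj w w' p hp hq)
        rintro ⟨x, ⟨h, hx⟩ | ⟨rfl, hx⟩, y, ⟨h', hy⟩ | ⟨rfl, hy⟩, hxy⟩
        · exact ⟨_, hx, _, hy, hd _ _ hx hy, Or.inl hxy⟩
        · exact ⟨_, hx, _, hy, hd _ _ hx hy, Or.inr (Or.inr ⟨rfl, hxy⟩)⟩
        · exact ⟨_, hx, _, hy, hd _ _ hx hy, Or.inr (Or.inl ⟨rfl, hxy⟩)⟩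
        · exact absurd hxy (G.loopless.irrefl _)

/-- Induction on the number of vertices: an uncovered vertex is deleted, an edge inside a branch set
is contracted, and when neither exists the branch sets are singletons partitioning the graph, which
is then a copy of `H`. -/
theorem IsBranchFamily.hasInducedMinor {W : Type} {H : SimpleGraph W} :
    ∀ {V : Type} [Finite V] {G : SimpleGraph V} {f : W → Set V}, IsBranchFamily G H f →
      HasInducedMinor H G := by
  suffices ∀ (k : ℕ) {V : Type} [Finite V] {G : SimpleGraph V} {f : W → Set V}, Nat.card V = k →
      IsBranchFamily G H f → HasInducedMinor H G by
    intro V _ G f hf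
    exact this _ rfl hf
  intro k
  induction k with
  | zero =>
    intro V _ G f hV hf
    have : IsEmpty V := (Nat.card_eq_zero.1 hV).resolve_right (fun h => h.not_finite ‹_›)
    have : IsEmpty W := ⟨fun w => this.elim (hf.conn w).1.some⟩
    exact .iso ⟨Equiv.equivOfIsEmpty V W, fun {a} => isEmptyElim a⟩
  | succ k ih =>
    intro V _ G f hV hf
    have hcard : ∀ v : V, Nat.card {x : V // x ≠ v} = k := by
      intro v
      have := Set.ncard_sdiff_singleton_add_one (Set.mem_univ v)
      rw [Set.ncard_univ, hV] at this
      have h2 : Nat.card {x : V // x ≠ v} = (Set.univ \ {v} : Set V).ncard := by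
        rw [← Nat.card_coe_set_eq]
        exact Nat.card_congr (Equiv.subtypeEquivRight (by simp))
      omega
    by_cases hcov : ∃ v, ∀ w, v ∉ f w
    · obtain ⟨v, hv⟩ := hcov
      refine .delete v (ih (f := fun w => Subtype.val ⁻¹' f w) (hcard v) ⟨fun w => ⟨?_, ?_⟩, ?_, ?_⟩)
      · obtain ⟨x, hx⟩ := (hf.conn w).1
        exact ⟨⟨x, fun h => hv w (h ▸ hx)⟩, hx⟩
      · intro S hS hne hcl p hp
        have := (hf.conn w).2 (Subtype.val '' S) ?_ (hne.image _) ?_ hp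
        · obtain ⟨q, hq, hqp⟩ := this
          rwa [← Subtype.ext hqp]
        · rintro - ⟨q, hq, rfl⟩
          exact hS hq
        · rintro - ⟨q, hq, rfl⟩ y hy hqy
          exact ⟨⟨y, fun h => hv w (h ▸ hy)⟩, hcl q hq _ hy hqy, rfl⟩
      · exact fun w w' x hx hx' => hf.disj w w' x hx hx'
      · intro w w' hne
        rw [hf.adj w w' hne]
        constructor
        · rintro ⟨x, hx, y, hy, hxy⟩
          exact ⟨⟨x, fun h => hv w (h ▸ hx)⟩, hx, ⟨y, fun h => hv w' (h ▸ hy)⟩, hy, hxy⟩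
        · rintro ⟨x, hx, y, hy, hxy⟩
          exact ⟨x, hx, y, hy, hxy⟩
    push Not at hcov
    by_cases hed : ∃ w, ∃ u ∈ f w, ∃ v ∈ f w, G.Adj u v
    · obtain ⟨w₀, u, hu, v, hv, huv⟩ := hed
      have hvu : ∀ w, v ∈ f w → u ∈ f w := fun w h => hf.disj w₀ w v hv h ▸ hu
      have huv' : ∀ w, u ∈ f w → v ∈ f w := fun w h => hf.disj w₀ w u hu h ▸ hv
      refine .contract u v huv
        (ih (f := fun w => Subtype.val ⁻¹' f w) (hcard v) ⟨fun w => ⟨?_, ?_⟩, ?_, ?_⟩)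
      · obtain ⟨x, hx⟩ := (hf.conn w).1
        by_cases hxv : x = v
        · exact ⟨⟨u, huv.ne⟩, hvu w (hxv ▸ hx)⟩
        · exact ⟨⟨x, hxv⟩, hx⟩
      · intro S hS hne hcl p hp
        have hcl' : ∀ p ∈ S, ∀ q : {x : V // x ≠ v}, (q : V) ∈ f w →
            (G.Adj p q ∨ ((p : V) = u ∧ G.Adj v q) ∨ ((q : V) = u ∧ G.Adj p v)) → q ∈ S := by
          intro p hp q hq h
          by_cases hpq : p = q
          · exact hpq ▸ hp
          · exact hcl p hp q hq ⟨hpq, h⟩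
        have := (hf.conn w).2
          {x | (∃ h, (⟨x, h⟩ : {x : V // x ≠ v}) ∈ S) ∨
            x = v ∧ (⟨u, huv.ne⟩ : {x : V // x ≠ v}) ∈ S} ?_ ?_ ?_ hp
        · rcases this with ⟨h, hS⟩ | ⟨h, -⟩
          · exact hS
          · exact absurd h p.2
        · rintro x (⟨h, hx⟩ | ⟨rfl, hx⟩)
          · exact hS hx
          · exact huv' w (hS hx)
        · obtain ⟨q, hq⟩ := hne
          exact ⟨q, Or.inl ⟨q.2, hq⟩⟩
        · rintro x (⟨h, hx⟩ | ⟨rfl, hx⟩) y hy hxy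
          · by_cases hyv : y = v
            · exact Or.inr ⟨hyv, hcl' _ hx _ (hvu w (hyv ▸ hy)) (Or.inr (Or.inr ⟨rfl, hyv ▸ hxy⟩))⟩
            · exact Or.inl ⟨hyv, hcl' _ hx _ hy (Or.inl hxy)⟩
          · exact Or.inl ⟨hxy.ne.symm, hcl' _ hx _ hy (Or.inr (Or.inl ⟨rfl, hxy⟩))⟩
      · exact fun w w' x hx hx' => hf.disj w w' x hx hx'
      · intro w w' hne
        rw [hf.adj w w' hne]
        constructor
        · rintro ⟨x, hx, y, hy, hxy⟩
          by_cases hxv : x = v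
          · subst hxv
            have hy' : y ≠ x := hxy.ne.symm
            refine ⟨⟨u, huv.ne⟩, hvu w hx, ⟨y, hy'⟩, hy, ?_, Or.inr (Or.inl ⟨rfl, hxy⟩)⟩
            intro h
            exact hne (hf.disj w w' u (hvu w hx) (by rw [show u = y from congrArg Subtype.val h]; exact hy))
          · by_cases hyv : y = v
            · subst hyv
              refine ⟨⟨x, hxv⟩, hx, ⟨u, huv.ne⟩, hvu w' hy, ?_, Or.inr (Or.inr ⟨rfl, hxy⟩)⟩
              intro h
              exact hne (hf.disj w w' u (by rw [← show x = u from congrArg Subtype.val h]; exact hx) (hvu w' hy))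
            · refine ⟨⟨x, hxv⟩, hx, ⟨y, hyv⟩, hy, ?_, Or.inl hxy⟩
              intro h
              exact hxy.ne (congrArg Subtype.val h)
        · rintro ⟨x, hx, y, hy, -, h | ⟨h1, h2⟩ | ⟨h1, h2⟩⟩
          · exact ⟨x, hx, y, hy, h⟩
          · exact ⟨v, huv' w (h1 ▸ hx), y, hy, h2⟩
          · exact ⟨x, hx, v, huv' w' (h1 ▸ hy), h2⟩
    · push Not at hed
      choose g hg using hcov
      have hsub : ∀ w x y, x ∈ f w → y ∈ f w → x = y := fun w x y hx hy =>
        ((hf.conn w).2 {x} (Set.singleton_subset_iff.2 hx) ⟨x, rfl⟩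
          (fun p hp q hq hpq => absurd hpq (hed w p (hp ▸ hx) q hq)) hy).symm
      have hbij : Function.Bijective g := by
        refine ⟨fun x y hxy => hsub (g x) x y (hg x) (hxy ▸ hg y), fun w => ?_⟩
        obtain ⟨x, hx⟩ := (hf.conn w).1
        exact ⟨x, hf.disj _ _ x (hg x) hx⟩
      refine .iso ⟨Equiv.ofBijective g hbij, fun {a b} => ?_⟩
      change H.Adj (g a) (g b) ↔ G.Adj a b
      by_cases hab : g a = g b
      · rw [hab, hbij.1 hab]
        simp
      · rw [hf.adj _ _ hab]
        constructor
        · rintro ⟨x, hx, y, hy, hxy⟩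
          rwa [hsub _ a x (hg a) hx, hsub _ b y (hg b) hy]
        · exact fun h => ⟨a, hg a, b, hg b, h⟩

theorem hasInducedMinor_iff_exists_branchFamily {V W : Type} [Finite V] {H : SimpleGraph W}
    {G : SimpleGraph V} : HasInducedMinor H G ↔ ∃ f, IsBranchFamily G H f :=
  ⟨HasInducedMinor.exists_branchFamily, fun ⟨_, hf⟩ => hf.hasInducedMinor⟩

/-! ### Models of the tree `graphH2` -/

/-- A connected set `A` with three pairwise distinct and nonadjacent attached vertices `c`, `a₁`,
`a₂`: half of a model of `graphH2`, where `c` is the middle vertex and `a₁`, `a₂` are leaves. -/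
structure IsEnd {V : Type} (G : SimpleGraph V) (A : Set V) (c a₁ a₂ : V) : Prop where
  conn : ConnSet G A
  touch : ∃ x ∈ A, G.Adj c x
  touch₁ : ∃ x ∈ A, G.Adj a₁ x
  touch₂ : ∃ x ∈ A, G.Adj a₂ x
  notMem : c ∉ A
  notMem₁ : a₁ ∉ A
  notMem₂ : a₂ ∉ A
  ne₁ : c ≠ a₁
  ne₂ : c ≠ a₂
  ne₁₂ : a₁ ≠ a₂
  nadj₁ : ¬ G.Adj c a₁
  nadj₂ : ¬ G.Adj c a₂
  nadj₁₂ : ¬ G.Adj a₁ a₂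

theorem IsEnd.swap {V : Type} {G : SimpleGraph V} {A : Set V} {c a₁ a₂ : V}
    (h : IsEnd G A c a₁ a₂) : IsEnd G A c a₂ a₁ :=
  ⟨h.conn, h.touch, h.touch₂, h.touch₁, h.notMem, h.notMem₂, h.notMem₁, h.ne₂, h.ne₁, h.ne₁₂.symm,
    h.nadj₂, h.nadj₁, fun h' => h.nadj₁₂ h'.symm⟩

/-- Two vertex sets are disjoint and no edge joins them. -/
def Far {V : Type} (G : SimpleGraph V) (X Y : Set V) : Prop :=
  ∀ x ∈ X, ∀ y ∈ Y, x ≠ y ∧ ¬ G.Adj x y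

theorem Far.symm {V : Type} {G : SimpleGraph V} {X Y : Set V} (h : Far G X Y) : Far G Y X :=
  fun y hy x hx => ⟨(h x hx y hy).1.symm, fun hyx => (h x hx y hy).2 hyx.symm⟩

theorem Far.mono {V : Type} {G : SimpleGraph V} {X Y X' Y' : Set V} (h : Far G X Y)
    (hX : X' ⊆ X) (hY : Y' ⊆ Y) : Far G X' Y' :=
  fun x hx y hy => h x (hX hx) y (hY hy)

/-- A model of `graphH2`: the branch sets `A` and `B` of the two vertices of degree three, the
middle vertex `c` and the leaves `a₁`, `a₂` at `A` and `b₁`, `b₂` at `B`. -/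
structure IsModel {V : Type} (G : SimpleGraph V) (A B : Set V) (c a₁ a₂ b₁ b₂ : V) : Prop where
  left : IsEnd G A c a₁ a₂
  right : IsEnd G B c b₁ b₂
  far : Far G (insert a₁ (insert a₂ A)) (insert b₁ (insert b₂ B))

theorem IsModel.swap {V : Type} {G : SimpleGraph V} {A B : Set V} {c a₁ a₂ b₁ b₂ : V}
    (h : IsModel G A B c a₁ a₂ b₁ b₂) : IsModel G B A c b₁ b₂ a₁ a₂ :=
  ⟨h.right, h.left, h.far.symm⟩

theorem IsModel.swap_left {V : Type} {G : SimpleGraph V} {A B : Set V} {c a₁ a₂ b₁ b₂ : V}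
    (h : IsModel G A B c a₁ a₂ b₁ b₂) : IsModel G A B c a₂ a₁ b₁ b₂ :=
  ⟨h.left.swap, h.right, by rw [Set.insert_comm]; exact h.far⟩

theorem IsModel.isBranchFamily {V : Type} {G : SimpleGraph V} {A B : Set V} {c a₁ a₂ b₁ b₂ : V}
    (h : IsModel G A B c a₁ a₂ b₁ b₂) :
    IsBranchFamily G graphH2 ![{a₁}, A, {a₂}, {c}, {b₂}, B, {b₁}] := by
  obtain ⟨hA, hB, hF⟩ := h
  -- Disjointness and adjacency are symmetric, so ordered pairs suffice; this halves the case check.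
  have hdadj : ∀ i j : Fin 7, i < j →
      (∀ x, x ∈ ![{a₁}, A, {a₂}, {c}, {b₂}, B, {b₁}] i →
        x ∉ ![{a₁}, A, {a₂}, {c}, {b₂}, B, {b₁}] j) ∧
      (graphH2.Adj i j ↔ ∃ x ∈ ![{a₁}, A, {a₂}, {c}, {b₂}, B, {b₁}] i,
        ∃ y ∈ ![{a₁}, A, {a₂}, {c}, {b₂}, B, {b₁}] j, G.Adj x y) := by
    have hAB : ∀ x ∈ A, ∀ y ∈ B, x ≠ y ∧ ¬ G.Adj x y := fun x hx y hy =>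
      hF x (by simp [hx]) y (by simp [hy])
    have hAb₁ : ∀ x ∈ A, x ≠ b₁ ∧ ¬ G.Adj x b₁ := fun x hx => hF x (by simp [hx]) b₁ (by simp)
    have hAb₂ : ∀ x ∈ A, x ≠ b₂ ∧ ¬ G.Adj x b₂ := fun x hx => hF x (by simp [hx]) b₂ (by simp)
    have ha₁B : ∀ y ∈ B, a₁ ≠ y ∧ ¬ G.Adj a₁ y := fun y hy => hF a₁ (by simp) y (by simp [hy])
    have ha₂B : ∀ y ∈ B, a₂ ≠ y ∧ ¬ G.Adj a₂ y := fun y hy => hF a₂ (by simp) y (by simp [hy])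
    have h11 := hF a₁ (by simp) b₁ (by simp)
    have h12 := hF a₁ (by simp) b₂ (by simp)
    have h21 := hF a₂ (by simp) b₁ (by simp)
    have h22 := hF a₂ (by simp) b₂ (by simp)
    have := hA.touch; have := hA.touch₁; have := hA.touch₂
    have := hB.touch; have := hB.touch₁; have := hB.touch₂
    have := hA.notMem; have := hA.notMem₁; have := hA.notMem₂
    have := hB.notMem; have := hB.notMem₁; have := hB.notMem₂
    have := hA.ne₁; have := hA.ne₂; have := hA.ne₁₂
    have := hB.ne₁; have := hB.ne₂; have := hB.ne₁₂
    have := hA.nadj₁; have := hA.nadj₂; have := hA.nadj₁₂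
    have := hB.nadj₁; have := hB.nadj₂; have := hB.nadj₁₂
    have hs : ∀ x y, G.Adj x y ↔ G.Adj y x := fun x y => G.adj_comm x y
    clear hF hA hB
    intro i j hij
    fin_cases i <;> fin_cases j <;> first
      | exact absurd hij (by decide)
      | (simp [graphH2]; grind)
  refine ⟨fun w => ?_, fun w w' x hx hx' => ?_, fun w w' hne => ?_⟩
  · fin_cases w <;> first | exact connSet_singleton G _ | exact hA.conn | exact hB.conn
  · rcases lt_trichotomy w w' with h | h | h
    · exact absurd hx' ((hdadj _ _ h).1 x hx)
    · exact h
    · exact absurd hx ((hdadj _ _ h).1 x hx')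
  · rcases lt_or_gt_of_ne hne with h | h
    · exact (hdadj _ _ h).2
    · rw [SimpleGraph.adj_comm, (hdadj _ _ h).2]
      constructor <;> exact fun ⟨x, hx, y, hy, hxy⟩ => ⟨y, hy, x, hx, hxy.symm⟩

/-- A leaf branch set may be cut down to one contact vertex. The middle branch set is handled by
letting the right end absorb as much of it as possible without touching the left end; the next
vertex along it then touches both ends and serves as `c`. -/
theorem IsBranchFamily.exists_isModel {V : Type} [Finite V] {G : SimpleGraph V}
    {f : Fin 7 → Set V} (hf : IsBranchFamily G graphH2 f) :
    ∃ A B c a₁ a₂ b₁ b₂, IsModel G A B c a₁ a₂ b₁ b₂ := by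
  have hadj : ∀ i j, graphH2.Adj i j → ∃ x ∈ f i, ∃ y ∈ f j, G.Adj x y := fun i j h =>
    (hf.adj i j h.ne).1 h
  have hfar : ∀ i j, i ≠ j → ¬ graphH2.Adj i j → Far G (f i) (f j) := fun i j hij h x hx y hy =>
    ⟨fun he => hij (hf.disj i j x hx (he ▸ hy)),
      fun hxy => h ((hf.adj i j hij).2 ⟨x, hx, y, hy, hxy⟩)⟩
  obtain ⟨a₁, ha₁, x₁, hx₁, h₁⟩ := hadj 0 1 (by simp [graphH2])
  obtain ⟨a₂, ha₂, x₂, hx₂, h₂⟩ := hadj 2 1 (by simp [graphH2])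
  obtain ⟨b₁, hb₁, y₁, hy₁, k₁⟩ := hadj 6 5 (by simp [graphH2])
  obtain ⟨b₂, hb₂, y₂, hy₂, k₂⟩ := hadj 4 5 (by simp [graphH2])
  obtain ⟨p, hp, p', hp', hpp⟩ := hadj 3 1 (by simp [graphH2])
  obtain ⟨q, hq, q', hq', hqq⟩ := hadj 3 5 (by simp [graphH2])
  have f01 := hf.disj 0 1
  have f21 := hf.disj 2 1
  have f31 := hf.disj 3 1
  have f65 := hf.disj 6 5
  have f45 := hf.disj 4 5
  have f35 := hf.disj 3 5
  have g15 := hfar 1 5 (by decide) (by simp [graphH2])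
  have g16 := hfar 1 6 (by decide) (by simp [graphH2])
  have g14 := hfar 1 4 (by decide) (by simp [graphH2])
  have g05 := hfar 0 5 (by decide) (by simp [graphH2])
  have g06 := hfar 0 6 (by decide) (by simp [graphH2])
  have g04 := hfar 0 4 (by decide) (by simp [graphH2])
  have g25 := hfar 2 5 (by decide) (by simp [graphH2])
  have g26 := hfar 2 6 (by decide) (by simp [graphH2])
  have g24 := hfar 2 4 (by decide) (by simp [graphH2])
  have g02 := hfar 0 2 (by decide) (by simp [graphH2])
  have g64 := hfar 6 4 (by decide) (by simp [graphH2])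
  have g30 := hfar 3 0 (by decide) (by simp [graphH2])
  have g32 := hfar 3 2 (by decide) (by simp [graphH2])
  have g36 := hfar 3 6 (by decide) (by simp [graphH2])
  have g34 := hfar 3 4 (by decide) (by simp [graphH2])
  obtain ⟨D, -, ⟨hD3, hDc, hDA⟩, hmax⟩ := exists_maximal_set
    (fun D => D ⊆ f 3 ∧ ConnSet G (f 5 ∪ D) ∧ ∀ x ∈ D, ∀ y ∈ f 1, ¬ G.Adj x y) (C := ∅)
    ⟨Set.empty_subset _, by simpa using hf.conn 5, by simp⟩
  have hpD : p ∉ D := fun h => hDA p h p' hp' hpp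
  obtain ⟨u, hu, c, hc, hcu, huc⟩ := ((hf.conn 5).union (hf.conn 3) hq' hq hqq.symm).exists_adj_notMem
    (Set.union_subset_union_right _ hD3) hDc.1 (by
      intro he
      have : p ∈ f 5 ∪ D := he ▸ Or.inr hp
      exact this.elim (fun h => absurd (f35 p hp h) (by decide)) hpD)
  have hc3 : c ∈ f 3 := hc.resolve_left fun h => hcu (Or.inl h)
  -- Otherwise `c` could be added to `D`, against maximality.
  have hcA : ∃ x ∈ f 1, G.Adj c x := by
    by_contra! hcon
    have := hmax (insert c D) ⟨Set.insert_subset hc3 hD3, ?_, ?_⟩ (Set.subset_insert _ _)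
    · exact hcu (Or.inr (this ▸ Set.mem_insert c D))
    · rw [Set.union_insert]
      exact hDc.insert_of_adj hu huc.symm
    · rintro x (rfl | hx)
      · exact hcon
      · exact hDA x hx
  have d3 : ∀ x ∈ f 5 ∪ D, x ∈ f 5 ∨ x ∈ f 3 := fun x hx => hx.imp_right (@hD3 x)
  refine ⟨f 1, f 5 ∪ D, c, a₁, a₂, b₁, b₂,
    ⟨hf.conn 1, hcA, ⟨x₁, hx₁, h₁⟩, ⟨x₂, hx₂, h₂⟩, fun h => absurd (f31 c hc3 h) (by decide),
      fun h => absurd (f01 _ ha₁ h) (by decide), fun h => absurd (f21 _ ha₂ h) (by decide),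
      (g30 _ hc3 _ ha₁).1, (g32 _ hc3 _ ha₂).1, (g02 _ ha₁ _ ha₂).1,
      (g30 _ hc3 _ ha₁).2, (g32 _ hc3 _ ha₂).2, (g02 _ ha₁ _ ha₂).2⟩,
    ⟨hDc, ⟨u, hu, huc.symm⟩, ⟨y₁, Or.inl hy₁, k₁⟩, ⟨y₂, Or.inl hy₂, k₂⟩, hcu,
      fun h => (d3 _ h).elim (fun h => absurd (f65 _ hb₁ h) (by decide))
        (fun h => (g36 _ h _ hb₁).1 rfl),
      fun h => (d3 _ h).elim (fun h => absurd (f45 _ hb₂ h) (by decide))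
        (fun h => (g34 _ h _ hb₂).1 rfl),
      (g36 _ hc3 _ hb₁).1, (g34 _ hc3 _ hb₂).1, (g64 _ hb₁ _ hb₂).1,
      (g36 _ hc3 _ hb₁).2, (g34 _ hc3 _ hb₂).2, (g64 _ hb₁ _ hb₂).2⟩, ?_⟩
  rintro x (rfl | rfl | hx) y (rfl | rfl | hy | hy)
  · exact g06 _ ha₁ _ hb₁
  · exact g04 _ ha₁ _ hb₂
  · exact g05 _ ha₁ _ hy
  · exact g30.symm _ ha₁ _ (hD3 hy)
  · exact g26 _ ha₂ _ hb₁
  · exact g24 _ ha₂ _ hb₂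
  · exact g25 _ ha₂ _ hy
  · exact g32.symm _ ha₂ _ (hD3 hy)
  · exact g16 _ hx _ hb₁
  · exact g14 _ hx _ hb₂
  · exact g15 _ hx _ hy
  · exact ⟨fun he => absurd (f31 y (hD3 hy) (he ▸ hx)) (by decide), fun h => hDA y hy x hx h.symm⟩

theorem hasInducedMinor_graphH2_iff {V : Type} [Finite V] {G : SimpleGraph V} :
    HasInducedMinor graphH2 G ↔ ∃ A B c a₁ a₂ b₁ b₂, IsModel G A B c a₁ a₂ b₁ b₂ := by
  rw [hasInducedMinor_iff_exists_branchFamily]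
  constructor
  · rintro ⟨f, hf⟩
    exact hf.exists_isModel
  · rintro ⟨A, B, c, a₁, a₂, b₁, b₂, h⟩
    exact ⟨_, h.isBranchFamily⟩

/-! ### Reducing models -/

/-- No model of `graphH2` has a branch set with at most three vertices at one of its ends. -/
def NoSmallModel {V : Type} (G : SimpleGraph V) : Prop :=
  ∀ x y z B c a₁ a₂ b₁ b₂, (x = y ∨ G.Adj x y) → (y = z ∨ G.Adj y z) →
    ¬ IsModel G {x, y, z} B c a₁ a₂ b₁ b₂

theorem NoSmallModel.singleton {V : Type} {G : SimpleGraph V} (hG : NoSmallModel G) {A B : Set V}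
    {c a₁ a₂ b₁ b₂ : V} (h : IsModel G A B c a₁ a₂ b₁ b₂) (x : V) : A ≠ {x} := by
  rintro rfl
  exact hG x x x B c a₁ a₂ b₁ b₂ (Or.inl rfl) (Or.inl rfl) (by simpa using h)

theorem NoSmallModel.pair {V : Type} {G : SimpleGraph V} (hG : NoSmallModel G) {B : Set V}
    {x y c a₁ a₂ b₁ b₂ : V} (hxy : x = y ∨ G.Adj x y) :
    ¬ IsModel G {x, y} B c a₁ a₂ b₁ b₂ := by
  intro h
  exact hG x y y B c a₁ a₂ b₁ b₂ hxy (Or.inl rfl) (by simpa using h)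

theorem IsModel.replace_left {V : Type} {G : SimpleGraph V} {A B A' : Set V}
    {c a₁ a₂ b₁ b₂ a₁' a₂' : V} (h : IsModel G A B c a₁ a₂ b₁ b₂) (hA : IsEnd G A' c a₁' a₂')
    (hsub : insert a₁' (insert a₂' A') ⊆ insert a₁ (insert a₂ A)) :
    IsModel G A' B c a₁' a₂' b₁ b₂ :=
  ⟨hA, h.right, h.far.mono hsub subset_rfl⟩

theorem IsModel.left_far {V : Type} {G : SimpleGraph V} {A B : Set V} {c a₁ a₂ b₁ b₂ : V}
    (h : IsModel G A B c a₁ a₂ b₁ b₂) : Far G A (insert b₁ (insert b₂ B)) :=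
  h.far.mono (fun _ hx => Or.inr (Or.inr hx)) subset_rfl

theorem IsModel.disjoint {V : Type} {G : SimpleGraph V} {A B : Set V} {c a₁ a₂ b₁ b₂ : V}
    (h : IsModel G A B c a₁ a₂ b₁ b₂) : Far G A B :=
  h.left_far.mono subset_rfl fun _ hx => Or.inr (Or.inr hx)

/-- Moving the middle vertex into `B` when `c` is attached to `A` at a single vertex. -/
theorem IsModel.shift {V : Type} {G : SimpleGraph V} {A B : Set V} {c a₁ a₂ b₁ b₂ u : V}
    (h : IsModel G A B c a₁ a₂ b₁ b₂) (hu : u ∈ A) (hne : A ≠ {u}) (hconn : ConnSet G (A \ {u}))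
    (hsole : ∀ x ∈ A, G.Adj c x → x = u) (h₁ : ¬ G.Adj a₁ u) (h₂ : ¬ G.Adj a₂ u) :
    IsModel G (A \ {u}) (insert c B) u a₁ a₂ b₁ b₂ := by
  obtain ⟨hA, hB, hF⟩ := h
  have hcu : G.Adj c u := by
    obtain ⟨x, hx, hcx⟩ := hA.touch
    exact hsole x hx hcx ▸ hcx
  have huF := fun y hy => hF u (Or.inr (Or.inr hu)) y hy
  obtain ⟨p, hp, hcp⟩ := hB.touch
  obtain ⟨x₁, hx₁, hax₁⟩ := hA.touch₁
  obtain ⟨x₂, hx₂, hax₂⟩ := hA.touch₂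
  obtain ⟨y₁, hy₁, hby₁⟩ := hB.touch₁
  obtain ⟨y₂, hy₂, hby₂⟩ := hB.touch₂
  refine ⟨⟨hconn, hA.conn.exists_adj_diff hu hne, ⟨x₁, ⟨hx₁, ?_⟩, hax₁⟩, ⟨x₂, ⟨hx₂, ?_⟩, hax₂⟩,
    fun h => h.2 rfl, fun h => hA.notMem₁ h.1, fun h => hA.notMem₂ h.1, ?_, ?_, hA.ne₁₂,
    fun h => h₁ h.symm, fun h => h₂ h.symm, hA.nadj₁₂⟩,
    ⟨hB.conn.insert_of_adj hp hcp, ⟨c, Or.inl rfl, hcu.symm⟩, ⟨y₁, Or.inr hy₁, hby₁⟩,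
    ⟨y₂, Or.inr hy₂, hby₂⟩, ?_, ?_, ?_, (huF b₁ (Or.inl rfl)).1, (huF b₂ (Or.inr (Or.inl rfl))).1,
    hB.ne₁₂, (huF b₁ (Or.inl rfl)).2, (huF b₂ (Or.inr (Or.inl rfl))).2, hB.nadj₁₂⟩, ?_⟩
  · rintro rfl; exact h₁ hax₁
  · rintro rfl; exact h₂ hax₂
  · rintro rfl; exact hA.notMem₁ hu
  · rintro rfl; exact hA.notMem₂ hu
  · rintro (rfl | h)
    · exact hA.notMem hu
    · exact (huF u (Or.inr (Or.inr h))).1 rfl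
  · rintro (h | h)
    · exact hB.ne₁ h.symm
    · exact hB.notMem₁ h
  · rintro (h | h)
    · exact hB.ne₂ h.symm
    · exact hB.notMem₂ h
  -- The only new member of the right half is `c`, and its only neighbour in `A` has just been
  -- removed.
  · have hc : ∀ x ∈ insert a₁ (insert a₂ (A \ {u})), x ≠ c ∧ ¬ G.Adj x c := by
      rintro x (rfl | rfl | hx)
      · exact ⟨hA.ne₁.symm, fun h => hA.nadj₁ h.symm⟩
      · exact ⟨hA.ne₂.symm, fun h => hA.nadj₂ h.symm⟩
      · exact ⟨fun h => hA.notMem (h ▸ hx.1), fun h => hx.2 (hsole x hx.1 h.symm)⟩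
    have hsub : insert a₁ (insert a₂ (A \ {u})) ⊆ insert a₁ (insert a₂ A) :=
      Set.insert_subset_insert (Set.insert_subset_insert Set.sdiff_subset)
    rintro x hx y (rfl | rfl | rfl | hy)
    · exact hF x (hsub hx) _ (Or.inl rfl)
    · exact hF x (hsub hx) _ (Or.inr (Or.inl rfl))
    · exact hc x hx
    · exact hF x (hsub hx) y (Or.inr (Or.inr hy))

/-- If `A` were a clique inside the neighbourhood of `c`, one contact of each leaf would already
form a branch set with at most two vertices. -/
theorem NoSmallModel.exists_nonadj {V : Type} {G : SimpleGraph V} (hG : NoSmallModel G)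
    {A B : Set V} {c a₁ a₂ b₁ b₂ : V} (h : IsModel G A B c a₁ a₂ b₁ b₂)
    (hc : A ⊆ G.neighborSet c) : ∃ x ∈ A, ∃ y ∈ A, x ≠ y ∧ ¬ G.Adj x y := by
  by_contra! hcon
  obtain ⟨x, hx, hax⟩ := h.left.touch₁
  obtain ⟨y, hy, hay⟩ := h.left.touch₂
  have hxy : x = y ∨ G.Adj x y := or_iff_not_imp_left.2 (hcon x hx y hy)
  have hsub : ({x, y} : Set V) ⊆ A := by
    rintro z (rfl | rfl) <;> assumption
  have hA := h.left
  refine hG.pair hxy (h.replace_left (A' := {x, y}) (a₁' := a₁) (a₂' := a₂)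
    ⟨connSet_pair hxy, ⟨x, Or.inl rfl, hc hx⟩, ⟨x, Or.inl rfl, hax⟩, ⟨y, Or.inr rfl, hay⟩,
      fun h => hA.notMem (hsub h), fun h => hA.notMem₁ (hsub h), fun h => hA.notMem₂ (hsub h),
      hA.ne₁, hA.ne₂, hA.ne₁₂, hA.nadj₁, hA.nadj₂, hA.nadj₁₂⟩ ?_)
  exact Set.insert_subset_insert (Set.insert_subset_insert hsub)

/-- A vertex `u` of `A` adjacent to `c` cannot have two nonadjacent neighbours in the rest of the
left half that are not adjacent to `c`. -/
theorem NoSmallModel.no_claw {V : Type} {G : SimpleGraph V} (hG : NoSmallModel G)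
    {A B : Set V} {c a₁ a₂ b₁ b₂ u x y : V} (h : IsModel G A B c a₁ a₂ b₁ b₂) (hu : u ∈ A)
    (hcu : G.Adj c u) (hx : x ∈ insert a₁ (insert a₂ A)) (hy : y ∈ insert a₁ (insert a₂ A))
    (hux : G.Adj u x) (huy : G.Adj u y) (hcx : ¬ G.Adj c x) (hcy : ¬ G.Adj c y)
    (hxy : x ≠ y) : G.Adj x y := by
  by_contra hcon
  have hc : c ∉ insert a₁ (insert a₂ A) := by
    rintro (h' | h' | h')
    · exact h.left.ne₁ h'
    · exact h.left.ne₂ h'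
    · exact h.left.notMem h'
  refine hG.singleton (h.replace_left (A' := {u}) (a₁' := x) (a₂' := y)
    ⟨connSet_singleton G u, ⟨u, rfl, hcu⟩, ⟨u, rfl, hux.symm⟩, ⟨u, rfl, huy.symm⟩, hcu.ne,
      hux.ne.symm, huy.ne.symm, fun h => hc (h ▸ hx), fun h => hc (h ▸ hy), hxy, hcx, hcy, hcon⟩ ?_)
    u rfl
  exact Set.insert_subset hx (Set.insert_subset hy (Set.singleton_subset_iff.2 (Or.inr (Or.inr hu))))

/-! ### Structure of left-minimal models -/

/-- A model whose left branch set cannot be made smaller with `c` and the right half unchanged. -/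
def LeftMinimal {V : Type} (G : SimpleGraph V) (A B : Set V) (c b₁ b₂ : V) : Prop :=
  ∀ A' a₁' a₂', A' ⊆ A → A' ≠ A → ¬ IsModel G A' B c a₁' a₂' b₁ b₂

/-- A vertex `x` adjacent to neither could replace `a₂` as a leaf: the component of `A \ {x}`
containing the common contact `u` is a smaller branch set that touches `c`, `a₁` and `x`. -/
theorem LeftMinimal.adj_or_adj {V : Type} [Finite V] {G : SimpleGraph V} {A B : Set V}
    {c a₁ a₂ b₁ b₂ : V} (hmin : LeftMinimal G A B c b₁ b₂) (h : IsModel G A B c a₁ a₂ b₁ b₂)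
    {u x : V} (hu : u ∈ A) (hcu : G.Adj c u) (hau : G.Adj a₁ u) (hx : x ∈ A) :
    G.Adj c x ∨ G.Adj a₁ x := by
  by_contra! hcon
  have hux : u ≠ x := by
    rintro rfl
    exact hcon.1 hcu
  obtain ⟨D, hDA, huD, hD, y, hy, hxy⟩ := h.left.conn.exists_component hx hu hux
  have hDA' := hDA.trans Set.sdiff_subset
  have hA := h.left
  refine hmin D a₁ x hDA' (fun he => (hDA (he ▸ hx)).2 rfl) (h.replace_left
    ⟨hD, ⟨u, huD, hcu⟩, ⟨u, huD, hau⟩, ⟨y, hy, hxy⟩, fun h => hA.notMem (hDA' h),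
      fun h => hA.notMem₁ (hDA' h), fun h => (hDA h).2 rfl, hA.ne₁,
      fun h => hA.notMem (h ▸ hx), fun h => hA.notMem₁ (h ▸ hx), hA.nadj₁, hcon.1, hcon.2⟩ ?_)
  exact Set.insert_subset_insert (Set.insert_subset (Or.inr hx) (hDA'.trans (Set.subset_insert _ _)))

/-- If `a₁` shared the unique contact `u` of `c`, then `a₁` would be adjacent to all of `A`. This
makes `A \ {u}` a clique, and three vertices of `A` are then enough for a branch set. -/
theorem LeftMinimal.not_sole {V : Type} [Finite V] {G : SimpleGraph V} (hG : NoSmallModel G)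
    {A B : Set V} {c a₁ a₂ b₁ b₂ : V} (hmin : LeftMinimal G A B c b₁ b₂)
    (h : IsModel G A B c a₁ a₂ b₁ b₂) {u : V} (hu : u ∈ A)
    (hsole : ∀ x ∈ A, G.Adj c x → x = u) : ¬ G.Adj a₁ u := by
  intro hau
  have hA := h.left
  have hcu : G.Adj c u := by
    obtain ⟨x, hx, hcx⟩ := hA.touch
    exact hsole x hx hcx ▸ hcx
  have hall : ∀ x ∈ A, G.Adj a₁ x := by
    intro x hx
    rcases hmin.adj_or_adj h hu hcu hau hx with h' | h'
    · rwa [hsole x hx h']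
    · exact h'
  -- For nonadjacent `x`, `y`, the leaf `a₁` moves into the branch set `{u, a₁}` and `x`, `y` become
  -- the leaves; neither is adjacent to `c`, whose only contact is `u`.
  have hclique : ∀ x ∈ A \ {u}, ∀ y ∈ A \ {u}, x ≠ y → G.Adj x y := by
    intro x hx y hy hxy
    by_contra hcon
    refine hG.pair (Or.inr hau.symm) (h.replace_left (A' := {u, a₁}) (a₁' := x) (a₂' := y)
      ⟨connSet_pair (Or.inr hau.symm), ⟨u, Or.inl rfl, hcu⟩, ⟨a₁, Or.inr rfl, (hall x hx.1).symm⟩,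
        ⟨a₁, Or.inr rfl, (hall y hy.1).symm⟩, ?_, ?_, ?_, ?_, ?_, hxy, ?_, ?_, hcon⟩ ?_)
    · rintro (h' | h')
      · exact hcu.ne h'
      · exact hA.ne₁ h'
    · rintro (h' | h')
      · exact hx.2 h'
      · exact hA.notMem₁ (h' ▸ hx.1)
    · rintro (h' | h')
      · exact hy.2 h'
      · exact hA.notMem₁ (h' ▸ hy.1)
    · rintro rfl; exact hA.notMem hx.1
    · rintro rfl; exact hA.notMem hy.1
    · exact fun h' => hx.2 (hsole x hx.1 h')
    · exact fun h' => hy.2 (hsole y hy.1 h')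
    · rintro z (rfl | rfl | rfl | rfl)
      · exact Or.inr (Or.inr hx.1)
      · exact Or.inr (Or.inr hy.1)
      · exact Or.inr (Or.inr hu)
      · exact Or.inl rfl
  have hu₂ : ¬ G.Adj a₂ u := fun h₂ => hA.nadj₁₂ (hG.no_claw h hu hcu (Or.inl rfl)
    (Or.inr (Or.inl rfl)) hau.symm h₂.symm hA.nadj₁ hA.nadj₂ hA.ne₁₂)
  obtain ⟨q, hq, huq⟩ := hA.conn.exists_adj_diff hu (hG.singleton h u)
  obtain ⟨w, hw, haw⟩ := hA.touch₂
  have hwu : w ≠ u := fun he => hu₂ (he ▸ haw)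
  have hqw : q = w ∨ G.Adj q w := or_iff_not_imp_left.2 (hclique q hq w ⟨hw, hwu⟩)
  have hsub : ({u, q, w} : Set V) ⊆ A := by
    rintro z (rfl | rfl | rfl)
    · exact hu
    · exact hq.1
    · exact hw
  -- This is where branch sets with three vertices are needed: `u` serves `c` and `a₁`, `w` serves
  -- `a₂`, and `q` connects them.
  refine hG u q w B c a₁ a₂ b₁ b₂ (Or.inr huq) hqw (h.replace_left
    ⟨(connSet_pair hqw).insert_of_adj (Or.inl rfl) huq, ⟨u, Or.inl rfl, hcu⟩, ⟨u, Or.inl rfl, hau⟩,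
      ⟨w, Or.inr (Or.inr rfl), haw⟩, fun h => hA.notMem (hsub h), fun h => hA.notMem₁ (hsub h),
      fun h => hA.notMem₂ (hsub h), hA.ne₁, hA.ne₂, hA.ne₁₂, hA.nadj₁, hA.nadj₂, hA.nadj₁₂⟩
    (Set.insert_subset_insert (Set.insert_subset_insert hsub)))

/-- Removing a vertex `u` from the left branch set leaves `c` or a leaf unattached. -/
theorem LeftMinimal.sole {V : Type} {G : SimpleGraph V} {A B : Set V}
    {c a₁ a₂ b₁ b₂ : V} (hmin : LeftMinimal G A B c b₁ b₂) (h : IsModel G A B c a₁ a₂ b₁ b₂)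
    {u : V} (hu : u ∈ A) (hconn : ConnSet G (A \ {u})) :
    (∀ x ∈ A, G.Adj c x → x = u) ∨ (∀ x ∈ A, G.Adj a₁ x → x = u) ∨
      (∀ x ∈ A, G.Adj a₂ x → x = u) := by
  by_contra! hcon
  obtain ⟨⟨x, hx, hcx, hxu⟩, ⟨x₁, hx₁, hax₁, hxu₁⟩, ⟨x₂, hx₂, hax₂, hxu₂⟩⟩ := hcon
  have hA := h.left
  refine hmin (A \ {u}) a₁ a₂ Set.sdiff_subset (fun he => ((Set.ext_iff.1 he u).2 hu).2 rfl)
    (h.replace_left ⟨hconn, ⟨x, ⟨hx, hxu⟩, hcx⟩, ⟨x₁, ⟨hx₁, hxu₁⟩, hax₁⟩, ⟨x₂, ⟨hx₂, hxu₂⟩, hax₂⟩,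
      fun h => hA.notMem h.1, fun h => hA.notMem₁ h.1, fun h => hA.notMem₂ h.1, hA.ne₁, hA.ne₂,
      hA.ne₁₂, hA.nadj₁, hA.nadj₂, hA.nadj₁₂⟩
    (Set.insert_subset_insert (Set.insert_subset_insert Set.sdiff_subset)))

/-- Each vertex of `A` is adjacent to `c` or to `a₁` once `u` is adjacent to both, and `a₁` sees
only `u`. -/
theorem LeftMinimal.subset_of_sole {V : Type} [Finite V] {G : SimpleGraph V}
    (hG : NoSmallModel G) {A B : Set V} {c a₁ a₂ b₁ b₂ : V} (hmin : LeftMinimal G A B c b₁ b₂)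
    (h : IsModel G A B c a₁ a₂ b₁ b₂) {u w : V} (hu : u ∈ A) (huw : u ≠ w)
    (hconn : ConnSet G (A \ {u})) (h₁ : ∀ x ∈ A, G.Adj a₁ x → x = u)
    (h₂ : ∀ x ∈ A, G.Adj a₂ x → x = w) : A ⊆ G.neighborSet c := by
  have hA := h.left
  have hau : G.Adj a₁ u := by
    obtain ⟨x, hx, hax⟩ := hA.touch₁
    exact h₁ x hx hax ▸ hax
  have hu₂ : ¬ G.Adj a₂ u := fun h' => huw (h₂ u hu h')
  -- If `c` missed `u`, then `u` itself could serve as a leaf in place of `a₁`, with the smaller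
  -- branch set `A \ {u}`.
  have hcu : G.Adj c u := by
    by_contra hcu
    obtain ⟨x, hx, hcx⟩ := hA.touch
    obtain ⟨y, hy, hay⟩ := hA.touch₂
    refine hmin (A \ {u}) u a₂ Set.sdiff_subset (fun he => ((Set.ext_iff.1 he u).2 hu).2 rfl)
      (h.replace_left ⟨hconn, ⟨x, ⟨hx, fun he => hcu (he ▸ hcx)⟩, hcx⟩,
        hA.conn.exists_adj_diff hu (hG.singleton h u), ⟨y, ⟨hy, fun he => hu₂ (he ▸ hay)⟩, hay⟩,
        fun h => hA.notMem h.1, fun h => h.2 rfl, fun h => hA.notMem₂ h.1,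
        fun h => hA.notMem (h ▸ hu), hA.ne₂, fun h => hA.notMem₂ (h ▸ hu), hcu, hA.nadj₂,
        fun h => hu₂ h.symm⟩ ?_)
    rintro z (rfl | rfl | hz)
    · exact Or.inr (Or.inr hu)
    · exact Or.inr (Or.inl rfl)
    · exact Or.inr (Or.inr hz.1)
  intro x hx
  rcases hmin.adj_or_adj h hu hcu hau hx with h' | h'
  · exact h'
  · rw [h₁ x hx h']
    exact hcu

/-- The induction on `|A|` must let `c` and `B` vary, because moving the middle vertex to `u`
shrinks `A` but enlarges `B` by `c`. -/
theorem NoSmallModel.exists_subset_neighborSet {V : Type} [Finite V] {G : SimpleGraph V}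
    (hG : NoSmallModel G) {A B : Set V} {c a₁ a₂ b₁ b₂ : V}
    (h : IsModel G A B c a₁ a₂ b₁ b₂) :
    ∃ A' ⊆ A, ∃ a₁' a₂', IsModel G A' B c a₁' a₂' b₁ b₂ ∧ A' ⊆ G.neighborSet c := by
  induction hk : A.ncard using Nat.strong_induction_on generalizing A B c a₁ a₂ b₁ b₂ with
  | _ k ih =>
  subst hk
  by_contra hcon
  have hlt : ∀ A', A' ⊆ A → A' ≠ A → A'.ncard < A.ncard := fun A' hs hne =>
    Set.ncard_lt_ncard (hs.ssubset_of_ne hne) (Set.toFinite A)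
  have hmin : LeftMinimal G A B c b₁ b₂ := by
    intro A' a₁' a₂' hs hne h'
    obtain ⟨A'', hs', x, y, hm, hn⟩ := ih _ (hlt A' hs hne) h' rfl
    exact hcon ⟨A'', hs'.trans hs, x, y, hm, hn⟩
  -- After shifting the middle vertex to `u`, induction gives a branch set inside the neighbourhood
  -- of `u`. Two nonadjacent vertices of it form a claw at `u`, and neither is adjacent to `c`.
  have hc : ∀ u ∈ A, ConnSet G (A \ {u}) → ¬ ∀ x ∈ A, G.Adj c x → x = u := by
    intro u hu hconn hsole
    have hshift := h.shift hu (hG.singleton h u) hconn hsole (hmin.not_sole hG h hu hsole)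
      (hmin.not_sole hG h.swap_left hu hsole)
    obtain ⟨A', hs, x₁, x₂, hm, hn⟩ := ih _ (hlt (A \ {u}) Set.sdiff_subset
      (fun he => ((Set.ext_iff.1 he u).2 hu).2 rfl)) hshift rfl
    obtain ⟨x, hx, y, hy, hxy, hnadj⟩ := hG.exists_nonadj hm hn
    have hcu : G.Adj c u := by
      obtain ⟨x, hx, hcx⟩ := h.left.touch
      exact hsole x hx hcx ▸ hcx
    exact hnadj (hG.no_claw h hu hcu (Or.inr (Or.inr (hs hx).1)) (Or.inr (Or.inr (hs hy).1))
      (hn hx) (hn hy) (fun h => (hs hx).2 (hsole x (hs hx).1 h))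
      (fun h => (hs hy).2 (hsole y (hs hy).1 h)) hxy)
  -- Each of the two non-cut vertices is now the only contact of some leaf, and of different leaves
  -- because the vertices differ.
  obtain ⟨u, hu, w, hw, huw, hu', hw'⟩ := h.left.conn.exists_two_noncut (hG.singleton h)
  obtain ⟨x₁, hx₁, hax₁⟩ := h.left.touch₁
  obtain ⟨x₂, hx₂, hax₂⟩ := h.left.touch₂
  rcases (hmin.sole h hu hu').resolve_left (hc u hu hu') with h₁ | h₁ <;>
    rcases (hmin.sole h hw hw').resolve_left (hc w hw hw') with h₂ | h₂
  · exact huw ((h₁ x₁ hx₁ hax₁).symm.trans (h₂ x₁ hx₁ hax₁))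
  · exact hcon ⟨A, subset_rfl, a₁, a₂, h, hmin.subset_of_sole hG h hu huw hu' h₁ h₂⟩
  · exact hcon ⟨A, subset_rfl, a₁, a₂, h,
      hmin.subset_of_sole hG h.swap_left hu huw hu' h₁ h₂⟩
  · exact huw ((h₁ x₂ hx₂ hax₂).symm.trans (h₂ x₂ hx₂ hax₂))

/-! ### Models with both branch sets in the neighbourhood of the middle vertex -/

/-- A model both of whose branch sets consist of neighbours of the middle vertex. -/
structure IsHubModel {V : Type} (G : SimpleGraph V) (A B : Set V) (c a₁ a₂ b₁ b₂ : V) : Prop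
    extends IsModel G A B c a₁ a₂ b₁ b₂ where
  left_subset : A ⊆ G.neighborSet c
  right_subset : B ⊆ G.neighborSet c

theorem IsHubModel.swap {V : Type} {G : SimpleGraph V} {A B : Set V} {c a₁ a₂ b₁ b₂ : V}
    (h : IsHubModel G A B c a₁ a₂ b₁ b₂) : IsHubModel G B A c b₁ b₂ a₁ a₂ :=
  ⟨h.toIsModel.swap, h.right_subset, h.left_subset⟩

/-- Shrinking one end leaves the other end and `c` unchanged, so the two ends can be treated in
turn. -/
theorem NoSmallModel.exists_isHubModel {V : Type} [Finite V] {G : SimpleGraph V}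
    (hG : NoSmallModel G) {A B : Set V} {c a₁ a₂ b₁ b₂ : V}
    (h : IsModel G A B c a₁ a₂ b₁ b₂) :
    ∃ A' ⊆ A, ∃ B' ⊆ B, ∃ a₁' a₂' b₁' b₂', IsHubModel G A' B' c a₁' a₂' b₁' b₂' := by
  obtain ⟨A', hA', a₁', a₂', h', hc⟩ := hG.exists_subset_neighborSet h
  obtain ⟨B', hB', b₁', b₂', h'', hc'⟩ := hG.exists_subset_neighborSet h'.swap
  exact ⟨A', hA', B', hB', a₁', a₂', b₁', b₂', h''.swap, hc, hc'⟩

/-- A hub model with the least possible number of vertices in its branch sets. -/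
def IsLeastHub {V : Type} (G : SimpleGraph V) (A B : Set V) : Prop :=
  ∀ A' B' c a₁ a₂ b₁ b₂, IsHubModel G A' B' c a₁ a₂ b₁ b₂ →
    A.ncard + B.ncard ≤ A'.ncard + B'.ncard

theorem IsLeastHub.swap {V : Type} {G : SimpleGraph V} {A B : Set V} (h : IsLeastHub G A B) :
    IsLeastHub G B A := by
  intro A' B' c a₁ a₂ b₁ b₂ h'
  have := h _ _ _ _ _ _ _ h'
  omega

theorem IsLeastHub.eq_of_subset {V : Type} [Finite V] {G : SimpleGraph V} {A B : Set V}
    (hl : IsLeastHub G A B) {A' B' : Set V} {c a₁ a₂ b₁ b₂ : V}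
    (h : IsHubModel G A' B' c a₁ a₂ b₁ b₂) (hA : A' ⊆ A) (hB : B' ⊆ B) : A' = A ∧ B' = B := by
  have h1 := hl _ _ _ _ _ _ _ h
  have h2 := Set.ncard_le_ncard hA (Set.toFinite A)
  have h3 := Set.ncard_le_ncard hB (Set.toFinite B)
  exact ⟨Set.eq_of_subset_of_ncard_le hA (by omega) (Set.toFinite A),
    Set.eq_of_subset_of_ncard_le hB (by omega) (Set.toFinite B)⟩

theorem NoSmallModel.exists_isLeastHub {V : Type} [Finite V] {G : SimpleGraph V}
    (hG : NoSmallModel G) {A B : Set V} {c a₁ a₂ b₁ b₂ : V}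
    (h : IsModel G A B c a₁ a₂ b₁ b₂) :
    ∃ A B c a₁ a₂ b₁ b₂, IsHubModel G A B c a₁ a₂ b₁ b₂ ∧ IsLeastHub G A B := by
  classical
  have hex : ∃ k, ∃ A B c a₁ a₂ b₁ b₂, IsHubModel G A B c a₁ a₂ b₁ b₂ ∧
      A.ncard + B.ncard = k := by
    obtain ⟨A', -, B', -, a₁', a₂', b₁', b₂', h'⟩ := hG.exists_isHubModel h
    exact ⟨_, A', B', c, a₁', a₂', b₁', b₂', h', rfl⟩
  obtain ⟨A, B, c, a₁, a₂, b₁, b₂, h', hk⟩ := Nat.find_spec hex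
  refine ⟨A, B, c, a₁, a₂, b₁, b₂, h', fun A' B' c' x₁ x₂ y₁ y₂ hm => ?_⟩
  rw [hk]
  exact Nat.find_min' hex ⟨A', B', c', x₁, x₂, y₁, y₂, hm, rfl⟩

/-- The shape of the left branch set in a least hub model. -/
theorem IsLeastHub.exists_ends {V : Type} [Finite V] {G : SimpleGraph V} (hG : NoSmallModel G)
    {A B : Set V} {c a₁ a₂ b₁ b₂ : V} (hl : IsLeastHub G A B)
    (h : IsHubModel G A B c a₁ a₂ b₁ b₂) :
    ∃ a₁' a₂' v v', IsHubModel G A B c a₁' a₂' b₁ b₂ ∧ v ∈ A ∧ v' ∈ A ∧ v ≠ v' ∧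
      G.Adj a₁' v ∧ G.Adj a₂' v' ∧ ConnSet G (A \ {v'}) ∧
      (∀ x ∈ A, G.Adj a₁' x → x = v) ∧ (∀ x ∈ A, G.Adj a₂' x → x = v') := by
  -- A model with smaller left set need not be a hub model, but it contains one, which would beat
  -- the least one.
  have hmin : LeftMinimal G A B c b₁ b₂ := by
    intro A' a₁' a₂' hs hne h'
    obtain ⟨A'', hA'', B'', hB'', _, _, _, _, h''⟩ := hG.exists_isHubModel h'
    have := (hl.eq_of_subset h'' (hA''.trans hs) hB'').1
    exact hne (hs.antisymm (this ▸ hA''))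
  obtain ⟨u, hu, w, hw, huw, hu', hw'⟩ := h.left.conn.exists_two_noncut (hG.singleton h.toIsModel)
  obtain ⟨x₁, hx₁, hax₁⟩ := h.left.touch₁
  obtain ⟨x₂, hx₂, hax₂⟩ := h.left.touch₂
  -- In a hub model `c` is adjacent to both `u` and `w`, so it has no unique contact.
  have hc : ∀ z, ¬ ∀ x ∈ A, G.Adj c x → x = z := fun z hz =>
    huw ((hz u hu (h.left_subset hu)).trans (hz w hw (h.left_subset hw)).symm)
  rcases (hmin.sole h.toIsModel hu hu').resolve_left (hc u) with h₁ | h₁ <;>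
    rcases (hmin.sole h.toIsModel hw hw').resolve_left (hc w) with h₂ | h₂
  · exact absurd ((h₁ x₁ hx₁ hax₁).symm.trans (h₂ x₁ hx₁ hax₁)) huw
  · exact ⟨a₁, a₂, u, w, h, hu, hw, huw, h₁ x₁ hx₁ hax₁ ▸ hax₁, h₂ x₂ hx₂ hax₂ ▸ hax₂, hw', h₁, h₂⟩
  · exact ⟨a₂, a₁, u, w, ⟨h.toIsModel.swap_left, h.left_subset, h.right_subset⟩, hu, hw, huw,
      h₁ x₂ hx₂ hax₂ ▸ hax₂, h₂ x₁ hx₁ hax₁ ▸ hax₁, hw', h₁, h₂⟩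
  · exact absurd ((h₁ x₂ hx₂ hax₂).symm.trans (h₂ x₂ hx₂ hax₂)) huw

/-! ### Connected components of a vertex set -/

/-- Two vertices are linked in `U` if they are equal or joined by a path inside `U`. -/
def Linked {V : Type} (G : SimpleGraph V) (U : V → Prop) : V → V → Prop :=
  Relation.EqvGen fun x y => G.Adj x y ∧ U x ∧ U y

theorem Linked.induction {V : Type} {G : SimpleGraph V} {U : V → Prop} {P : V → Prop}
    (hP : ∀ x y, P x → G.Adj x y → U x → U y → P y) {x y : V} (h : Linked G U x y) :
    P x ↔ P y := by
  induction h with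
  | rel x y h => exact ⟨fun hx => hP x y hx h.1 h.2.1 h.2.2, fun hy => hP y x hy h.1.symm h.2.2 h.2.1⟩
  | refl x => rfl
  | symm x y _ ih => exact ih.symm
  | trans x y z _ _ ih ih' => exact ih.trans ih'

theorem Linked.mem {V : Type} {G : SimpleGraph V} {U : V → Prop} {x y : V}
    (h : Linked G U x y) (hx : U x) : U y :=
  (h.induction (P := U) fun _ _ _ _ _ hy => hy).1 hx

/-- No membership of `v` in `U` is needed: outside `U` a vertex is linked only to itself. -/
theorem Linked.connSet {V : Type} (G : SimpleGraph V) (U : V → Prop) (v : V) :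
    ConnSet G {p | Linked G U v p} := by
  refine ⟨⟨v, .refl v⟩, fun S hS ⟨s, hs⟩ hcl p hp => ?_⟩
  have hsp : Linked G U s p := ((hS hs).symm _ _).trans _ _ _ hp
  refine (hsp.induction (P := fun x => x ∈ S) fun x y hx hxy hUx hUy => ?_).1 hs
  exact hcl x hx y ((hS hx).trans _ _ _ (.rel _ _ ⟨hxy, hUx, hUy⟩)) hxy

theorem ConnSet.linked {V : Type} {G : SimpleGraph V} {C : Set V} (hC : ConnSet G C)
    {U : V → Prop} (hU : ∀ x ∈ C, U x) {v p : V} (hv : v ∈ C) (hp : p ∈ C) :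
    Linked G U v p := by
  refine (hC.2 {p | p ∈ C ∧ Linked G U v p} (fun _ h => h.1) ⟨v, hv, .refl v⟩ ?_ hp).2
  rintro x ⟨hx, hvx⟩ y hy hxy
  exact ⟨hy, hvx.trans _ _ _ (.rel _ _ ⟨hxy, hU x hx, hU y hy⟩)⟩

/-! ### The two tests -/

/-- The vertex `p` is outside `{x, y, z, a₁, a₂}` and has no neighbour in this set. -/
def IsFree {V : Type} (G : SimpleGraph V) (x y z a₁ a₂ p : V) : Prop :=
  (p ≠ x ∧ p ≠ y ∧ p ≠ z ∧ p ≠ a₁ ∧ p ≠ a₂) ∧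
    ¬ G.Adj p x ∧ ¬ G.Adj p y ∧ ¬ G.Adj p z ∧ ¬ G.Adj p a₁ ∧ ¬ G.Adj p a₂

/-- The vertices available for the right branch set. -/
def SmallRest {V : Type} (G : SimpleGraph V) (x y z a₁ a₂ b₁ b₂ p : V) : Prop :=
  IsFree G x y z a₁ a₂ p ∧ p ≠ b₁ ∧ p ≠ b₂

/-- There is a model with left branch set `{x, y, z}` and leaves `a₁`, `a₂`, `b₁`, `b₂`. -/
def SmallTest {V : Type} (G : SimpleGraph V) (x y z a₁ a₂ b₁ b₂ : V) : Prop :=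
  ((x = y ∨ G.Adj x y) ∧ (y = z ∨ G.Adj y z)) ∧
  ((G.Adj a₁ x ∨ G.Adj a₁ y ∨ G.Adj a₁ z) ∧ (G.Adj a₂ x ∨ G.Adj a₂ y ∨ G.Adj a₂ z)) ∧
  ((a₁ ≠ x ∧ a₁ ≠ y ∧ a₁ ≠ z) ∧ (a₂ ≠ x ∧ a₂ ≠ y ∧ a₂ ≠ z)) ∧
  ((a₁ ≠ a₂ ∧ ¬ G.Adj a₁ a₂) ∧ (b₁ ≠ b₂ ∧ ¬ G.Adj b₁ b₂)) ∧
  (IsFree G x y z a₁ a₂ b₁ ∧ IsFree G x y z a₁ a₂ b₂) ∧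
  ∃ c u, (G.Adj c x ∨ G.Adj c y ∨ G.Adj c z) ∧
    (¬ G.Adj c a₁ ∧ ¬ G.Adj c a₂ ∧ ¬ G.Adj c b₁ ∧ ¬ G.Adj c b₂) ∧
    G.Adj c u ∧ SmallRest G x y z a₁ a₂ b₁ b₂ u ∧
    (∃ p, Linked G (SmallRest G x y z a₁ a₂ b₁ b₂) u p ∧ G.Adj p b₁) ∧
    (∃ p, Linked G (SmallRest G x y z a₁ a₂ b₁ b₂) u p ∧ G.Adj p b₂)

/-- The component of `u` in `SmallRest` is the right branch set. Distinctness of `c` from the other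
vertices comes for free: `c` is adjacent to the free vertex `u` and touches `{x, y, z}`. -/
theorem SmallTest.exists_isModel {V : Type} {G : SimpleGraph V} {x y z a₁ a₂ b₁ b₂ : V}
    (h : SmallTest G x y z a₁ a₂ b₁ b₂) : ∃ A B c, IsModel G A B c a₁ a₂ b₁ b₂ := by
  obtain ⟨⟨hxy, hyz⟩, ⟨ht₁, ht₂⟩, ⟨hn₁, hn₂⟩, ⟨⟨hne, hna⟩, hnb, hnb'⟩, ⟨hf₁, hf₂⟩, c, u, hc,
    ⟨hca₁, hca₂, hcb₁, hcb₂⟩, hcu, hu, ⟨p₁, hp₁, hpb₁⟩, p₂, hp₂, hpb₂⟩ := h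
  have hA : ConnSet G {x, y, z} := by
    rcases hxy with rfl | hxy
    · simpa using connSet_pair hyz
    · exact (connSet_pair hyz).insert_of_adj (Or.inl rfl) hxy
  have hcA : c ≠ x ∧ c ≠ y ∧ c ≠ z ∧ c ≠ a₁ ∧ c ≠ a₂ := by
    refine ⟨?_, ?_, ?_, ?_, ?_⟩ <;> rintro rfl
    · exact hu.1.2.1 hcu.symm
    · exact hu.1.2.2.1 hcu.symm
    · exact hu.1.2.2.2.1 hcu.symm
    · exact hu.1.2.2.2.2.1 hcu.symm
    · exact hu.1.2.2.2.2.2 hcu.symm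
  have hmem : ∀ p q r s : V, (G.Adj p q ∨ G.Adj p r ∨ G.Adj p s) →
      ∃ t ∈ ({q, r, s} : Set V), G.Adj p t := by
    rintro p q r s (h | h | h)
    exacts [⟨q, by simp, h⟩, ⟨r, by simp, h⟩, ⟨s, by simp, h⟩]
  have hfc : ∀ b, IsFree G x y z a₁ a₂ b → c ≠ b := by
    rintro b hb rfl
    obtain ⟨-, h1, h2, h3, -⟩ := hb
    exact hc.elim h1 fun h => h.elim h2 h3
  have hU : ∀ p, Linked G (SmallRest G x y z a₁ a₂ b₁ b₂) u p →
      SmallRest G x y z a₁ a₂ b₁ b₂ p := fun p hp => hp.mem hu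
  refine ⟨{x, y, z}, {p | Linked G (SmallRest G x y z a₁ a₂ b₁ b₂) u p}, c,
    ⟨hA, hmem _ _ _ _ hc, hmem _ _ _ _ ht₁, hmem _ _ _ _ ht₂, ?_, ?_, ?_, hcA.2.2.2.1,
      hcA.2.2.2.2, hne, hca₁, hca₂, hna⟩,
    ⟨Linked.connSet G _ u, ⟨u, .refl u, hcu⟩, ⟨p₁, hp₁, hpb₁.symm⟩, ⟨p₂, hp₂, hpb₂.symm⟩, ?_, ?_,
      ?_, hfc _ hf₁, hfc _ hf₂, hnb, hcb₁, hcb₂, hnb'⟩, ?_⟩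
  · simp [hcA]
  · simp [hn₁]
  · simp [hn₂]
  · intro h
    obtain ⟨⟨-, h1, h2, h3, -⟩, -⟩ := hU c h
    exact hc.elim h1 fun h => h.elim h2 h3
  · exact fun h => (hU _ h).2.1 rfl
  · exact fun h => (hU _ h).2.2 rfl
  · have hfree : ∀ b, IsFree G x y z a₁ a₂ b → ∀ q ∈ insert a₁ (insert a₂ ({x, y, z} : Set V)),
        q ≠ b ∧ ¬ G.Adj q b := by
      rintro b ⟨⟨h1, h2, h3, h4, h5⟩, k1, k2, k3, k4, k5⟩ q (rfl | rfl | rfl | rfl | rfl)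
      exacts [⟨h4.symm, fun h => k4 h.symm⟩, ⟨h5.symm, fun h => k5 h.symm⟩,
        ⟨h1.symm, fun h => k1 h.symm⟩, ⟨h2.symm, fun h => k2 h.symm⟩,
        ⟨h3.symm, fun h => k3 h.symm⟩]
    rintro q hq r (rfl | rfl | hr)
    · exact hfree _ hf₁ q hq
    · exact hfree _ hf₂ q hq
    · exact hfree _ (hU r hr).1 q hq

theorem IsModel.smallTest {V : Type} {G : SimpleGraph V} {x y z c a₁ a₂ b₁ b₂ : V} {B : Set V}
    (h : IsModel G {x, y, z} B c a₁ a₂ b₁ b₂) (hxy : x = y ∨ G.Adj x y)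
    (hyz : y = z ∨ G.Adj y z) : SmallTest G x y z a₁ a₂ b₁ b₂ := by
  obtain ⟨hA, hB, hF⟩ := h
  have htouch : ∀ p, (∃ t ∈ ({x, y, z} : Set V), G.Adj p t) →
      G.Adj p x ∨ G.Adj p y ∨ G.Adj p z := by
    rintro p ⟨t, rfl | rfl | rfl, ht⟩
    exacts [Or.inl ht, Or.inr (Or.inl ht), Or.inr (Or.inr ht)]
  have hfree : ∀ q ∈ insert b₁ (insert b₂ B), IsFree G x y z a₁ a₂ q := by
    intro q hq
    have h1 := hF.symm q hq x (by simp)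
    have h2 := hF.symm q hq y (by simp)
    have h3 := hF.symm q hq z (by simp)
    have h4 := hF.symm q hq a₁ (by simp)
    have h5 := hF.symm q hq a₂ (by simp)
    exact ⟨⟨h1.1, h2.1, h3.1, h4.1, h5.1⟩, h1.2, h2.2, h3.2, h4.2, h5.2⟩
  have hrest : ∀ q ∈ B, SmallRest G x y z a₁ a₂ b₁ b₂ q := fun q hq =>
    ⟨hfree q (Or.inr (Or.inr hq)), fun h => hB.notMem₁ (h ▸ hq), fun h => hB.notMem₂ (h ▸ hq)⟩
  have hn₁ := hA.notMem₁
  have hn₂ := hA.notMem₂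
  simp only [Set.mem_insert_iff, Set.mem_singleton_iff, not_or] at hn₁ hn₂
  obtain ⟨u, hu, hcu⟩ := hB.touch
  obtain ⟨p₁, hp₁, hb₁⟩ := hB.touch₁
  obtain ⟨p₂, hp₂, hb₂⟩ := hB.touch₂
  exact ⟨⟨hxy, hyz⟩, ⟨htouch _ hA.touch₁, htouch _ hA.touch₂⟩, ⟨hn₁, hn₂⟩,
    ⟨⟨hA.ne₁₂, hA.nadj₁₂⟩, hB.ne₁₂, hB.nadj₁₂⟩,
    ⟨hfree _ (Or.inl rfl), hfree _ (Or.inr (Or.inl rfl))⟩, c, u, htouch _ hA.touch,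
    ⟨hA.nadj₁, hA.nadj₂, hB.nadj₁, hB.nadj₂⟩, hcu, hrest u hu,
    ⟨p₁, hB.conn.linked hrest hu hp₁, hb₁.symm⟩, p₂, hB.conn.linked hrest hu hp₂, hb₂.symm⟩

/-- The neighbours of `c` that have no neighbour among the leaves and are not adjacent to both
`v` and `w`. -/
def HubRest {V : Type} (G : SimpleGraph V) (c a₁ a₂ b₁ b₂ v w p : V) : Prop :=
  G.Adj c p ∧ (¬ G.Adj a₁ p ∧ ¬ G.Adj a₂ p ∧ ¬ G.Adj b₁ p ∧ ¬ G.Adj b₂ p) ∧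
    ¬ (G.Adj v p ∧ G.Adj w p)

/-- The vertices of `HubRest` together with `v` and `w`. -/
def HubZone {V : Type} (G : SimpleGraph V) (c a₁ a₂ b₁ b₂ v w p : V) : Prop :=
  p = v ∨ p = w ∨ HubRest G c a₁ a₂ b₁ b₂ v w p

/-- A candidate for the last vertex of the branch set that starts at `v`, relative to a
linkedness relation `κ`. -/
def HubLast {V : Type} (G : SimpleGraph V) (κ : V → V → Prop) (c a₂ b₁ b₂ v w p : V) : Prop :=
  (G.Adj c p ∧ G.Adj a₂ p ∧ ¬ G.Adj b₁ p ∧ ¬ G.Adj b₂ p) ∧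
    (∃ q, κ v q ∧ G.Adj p q) ∧ ¬ ∃ q, κ w q ∧ G.Adj p q

/-- There is a hub model at `c` with leaves `a₁`, `a₂`, `b₁`, `b₂` whose branch sets are the
components of `v` and `w` in `HubZone` with one further vertex each. -/
def HubTest {V : Type} (G : SimpleGraph V) (c a₁ a₂ b₁ b₂ v w : V) : Prop :=
  (G.Adj c v ∧ G.Adj a₁ v ∧ ¬ G.Adj a₂ v ∧ ¬ G.Adj b₁ v ∧ ¬ G.Adj b₂ v) ∧
  (G.Adj c w ∧ G.Adj b₁ w ∧ ¬ G.Adj b₂ w ∧ ¬ G.Adj a₁ w ∧ ¬ G.Adj a₂ w) ∧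
  (¬ G.Adj c a₁ ∧ ¬ G.Adj c a₂ ∧ ¬ G.Adj c b₁ ∧ ¬ G.Adj c b₂) ∧
  (¬ G.Adj a₁ a₂ ∧ ¬ G.Adj b₁ b₂) ∧
  (¬ G.Adj a₁ b₁ ∧ ¬ G.Adj a₁ b₂ ∧ ¬ G.Adj a₂ b₁ ∧ ¬ G.Adj a₂ b₂) ∧
  ¬ Linked G (HubZone G c a₁ a₂ b₁ b₂ v w) v w ∧
  ∃ v' w', HubLast G (Linked G (HubZone G c a₁ a₂ b₁ b₂ v w)) c a₂ b₁ b₂ v w v' ∧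
    HubLast G (Linked G (HubZone G c a₁ a₂ b₁ b₂ v w)) c b₂ a₁ a₂ w v w' ∧ ¬ G.Adj v' w'

/-- The branch sets are the components of `v` and `w`, extended by `v'` and `w'`. They are far apart
because the components differ and each last vertex misses the opposite component and the opposite
last vertex. Inequalities between vertices follow from their differing adjacencies. -/
theorem HubTest.exists_isModel {V : Type} {G : SimpleGraph V} {c a₁ a₂ b₁ b₂ v w : V}
    (h : HubTest G c a₁ a₂ b₁ b₂ v w) : ∃ A B, IsModel G A B c a₁ a₂ b₁ b₂ := by
  obtain ⟨⟨hcv, hav, hav₂, hbv₁, hbv₂⟩, ⟨hcw, hbw, hbw₂, haw₁, haw₂⟩, ⟨hca₁, hca₂, hcb₁, hcb₂⟩,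
    ⟨haa, hbb⟩, ⟨h11, h12, h21, h22⟩, hvw, v', w',
    ⟨⟨hcv', hav', hbv₁', hbv₂'⟩, ⟨p, hp, hvp⟩, hnp⟩, ⟨⟨hcw', hbw', haw₁', haw₂'⟩, ⟨q, hq, hwq⟩, hnq⟩,
    hvw'⟩ := h
  set U := HubZone G c a₁ a₂ b₁ b₂ v w with hU
  have hv : ∀ p, Linked G U v p →
      G.Adj c p ∧ ¬ G.Adj b₁ p ∧ ¬ G.Adj b₂ p := by
    intro p hp
    rcases hp.mem (Or.inl rfl) with rfl | rfl | ⟨h, h', -⟩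
    · exact ⟨hcv, hbv₁, hbv₂⟩
    · exact absurd hp hvw
    · exact ⟨h, h'.2.2.1, h'.2.2.2⟩
  have hw : ∀ p, Linked G U w p →
      G.Adj c p ∧ ¬ G.Adj a₁ p ∧ ¬ G.Adj a₂ p := by
    intro p hp
    rcases hp.mem (Or.inr (Or.inl rfl)) with rfl | rfl | ⟨h, h', -⟩
    · exact absurd (hp.symm _ _) hvw
    · exact ⟨hcw, haw₁, haw₂⟩
    · exact ⟨h, h'.1, h'.2.1⟩
  have hA : ∀ x ∈ insert v' {p | Linked G U v p},
      G.Adj c x ∧ ¬ G.Adj b₁ x ∧ ¬ G.Adj b₂ x := by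
    rintro x (rfl | hx)
    exacts [⟨hcv', hbv₁', hbv₂'⟩, hv x hx]
  have hB : ∀ x ∈ insert w' {p | Linked G U w p},
      G.Adj c x ∧ ¬ G.Adj a₁ x ∧ ¬ G.Adj a₂ x := by
    rintro x (rfl | hx)
    exacts [⟨hcw', haw₁', haw₂'⟩, hw x hx]
  have hne : ∀ {x y z : V}, G.Adj x z → ¬ G.Adj y z → x ≠ y := by
    rintro x y z hx hy rfl
    exact hy hx
  refine ⟨insert v' {p | Linked G U v p}, insert w' {p | Linked G U w p},
    ⟨(Linked.connSet G U v).insert_of_adj hp hvp, ⟨v, Or.inr (.refl v), hcv⟩,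
      ⟨v, Or.inr (.refl v), hav⟩, ⟨v', Or.inl rfl, hav'⟩, fun h => (hA _ h).1.ne rfl,
      fun h => hca₁ (hA _ h).1, fun h => hca₂ (hA _ h).1, hne hcw haw₁, hne hcw haw₂,
      hne hav hav₂, hca₁, hca₂, haa⟩,
    ⟨(Linked.connSet G U w).insert_of_adj hq hwq, ⟨w, Or.inr (.refl w), hcw⟩,
      ⟨w, Or.inr (.refl w), hbw⟩, ⟨w', Or.inl rfl, hbw'⟩, fun h => (hB _ h).1.ne rfl,
      fun h => hcb₁ (hB _ h).1, fun h => hcb₂ (hB _ h).1, hne hcv hbv₁, hne hcv hbv₂,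
      hne hbw hbw₂, hcb₁, hcb₂, hbb⟩, ?_⟩
  rintro x (rfl | rfl | hx) y (rfl | rfl | hy)
  · exact ⟨hne hav hbv₁, h11⟩
  · exact ⟨hne hav hbv₂, h12⟩
  · exact ⟨fun h => hca₁ (h ▸ (hB y hy).1), (hB y hy).2.1⟩
  · exact ⟨hne hav' hbv₁', h21⟩
  · exact ⟨hne hav' hbv₂', h22⟩
  · exact ⟨fun h => hca₂ (h ▸ (hB y hy).1), (hB y hy).2.2⟩
  · exact ⟨fun h => hcb₁ (h ▸ (hA x hx).1), fun h => (hA x hx).2.1 h.symm⟩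
  · exact ⟨fun h => hcb₂ (h ▸ (hA x hx).1), fun h => (hA x hx).2.2 h.symm⟩
  · rcases hx with rfl | hx
    · refine ⟨fun h => (hB y hy).2.2 (h ▸ hav'), ?_⟩
      rcases hy with rfl | hy
      · exact hvw'
      · exact fun h => hnp ⟨y, hy, h⟩
    · rcases hy with rfl | hy
      · exact ⟨fun h => (hv x hx).2.2 (h.symm ▸ hbw'), fun h => hnq ⟨x, hx, h.symm⟩⟩
      · have hx' : U x := hx.mem (Or.inl rfl)
        have hy' : U y := hy.mem (Or.inr (Or.inl rfl))
        constructor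
        · rintro rfl
          exact hvw (hx.trans _ _ _ (hy.symm _ _))
        · exact fun h => hvw ((hx.trans _ _ _ (.rel _ _ ⟨h, hx', hy'⟩)).trans _ _ _ (hy.symm _ _))

/-! ### Completeness of the second test -/

/-- Vertices of `HubRest` are nonadjacent to all leaves, so one that touches `A` from outside can
take over the role of `c` at this end. -/
theorem IsHubModel.hubRest_adj_left {V : Type} {G : SimpleGraph V} {A B : Set V}
    {c a₁ a₂ b₁ b₂ v w u : V} (h : IsHubModel G A B c a₁ a₂ b₁ b₂)
    (hu : HubRest G c a₁ a₂ b₁ b₂ v w u) (huA : u ∉ A) (ht : ∃ x ∈ A, G.Adj u x) :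
    IsEnd G A u a₁ a₂ := by
  have hA := h.left
  refine ⟨hA.conn, ht, hA.touch₁, hA.touch₂, huA, hA.notMem₁, hA.notMem₂, ?_, ?_, hA.ne₁₂,
    fun h => hu.2.1.1 h.symm, fun h => hu.2.1.2.1 h.symm, hA.nadj₁₂⟩
  · rintro rfl; exact hA.nadj₁ hu.1
  · rintro rfl; exact hA.nadj₂ hu.1

theorem HubRest.swap {V : Type} {G : SimpleGraph V} {c a₁ a₂ b₁ b₂ v w u : V}
    (h : HubRest G c a₁ a₂ b₁ b₂ v w u) : HubRest G c b₁ b₂ a₁ a₂ w v u :=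
  ⟨h.1, ⟨h.2.1.2.2.1, h.2.1.2.2.2, h.2.1.1, h.2.1.2.1⟩, fun h' => h.2.2 h'.symm⟩

/-- A minimal link meets `A` only through `s` and `B` only through `t`. Make `s` the middle vertex
and add the rest of `S` to `B`; shrinking the enlarged end into the neighbourhood of `s` leaves just
one vertex, a small model. -/
theorem IsHubModel.not_link_of_sole {V : Type} [Finite V] {G : SimpleGraph V}
    (hG : NoSmallModel G) {A B S : Set V} {c a₁ a₂ b₁ b₂ v w s t : V}
    (h : IsHubModel G A B c a₁ a₂ b₁ b₂)
    (hS : ∀ x ∈ S, HubRest G c a₁ a₂ b₁ b₂ v w x ∧ x ∉ A ∧ x ∉ B) (hconn : ConnSet G S)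
    (hs : s ∈ S) (ht : t ∈ S) (hst : s ≠ t) (hs' : ConnSet G (S \ {s}))
    (hsA : ∃ x ∈ A, G.Adj s x) (htB : ∃ x ∈ B, G.Adj t x)
    (hA : ∀ y ∈ S, (∃ x ∈ A, G.Adj y x) → y = s) (hB : ∀ y ∈ S, (∃ x ∈ B, G.Adj y x) → y = t)
    (hmin : ∀ z, s ≠ z → t ≠ z → z ∈ S → ¬ ConnSet G (S \ {z})) : False := by
  have hSne : S ≠ {s} := by
    rintro rfl
    exact hst (Set.mem_singleton_iff.1 ht).symm
  obtain ⟨r, hr, htr⟩ := htB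
  have hmodel : IsModel G A (B ∪ (S \ {s})) s a₁ a₂ b₁ b₂ := by
    have hsB := h.swap.hubRest_adj_left (hS t ht).1.swap (hS t ht).2.2 ⟨r, hr, htr⟩
    have hR := h.right
    have hsR := (hS s hs).1
    obtain ⟨y₁, hy₁, hb₁⟩ := hR.touch₁
    obtain ⟨y₂, hy₂, hb₂⟩ := hR.touch₂
    obtain ⟨y, hy, hsy⟩ := hconn.exists_adj_diff hs hSne
    refine ⟨h.hubRest_adj_left hsR (hS s hs).2.1 hsA,
      ⟨hR.conn.union hs' hr ⟨ht, hst.symm⟩ htr.symm, ⟨y, Or.inr hy, hsy⟩, ⟨y₁, Or.inl hy₁, hb₁⟩,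
        ⟨y₂, Or.inl hy₂, hb₂⟩, fun h => h.elim (hS s hs).2.2 fun h => h.2 rfl,
        fun h => h.elim hR.notMem₁ fun h => hR.nadj₁ (hS _ h.1).1.1,
        fun h => h.elim hR.notMem₂ fun h => hR.nadj₂ (hS _ h.1).1.1, ?_, ?_, hR.ne₁₂,
        fun h => hsR.2.1.2.2.1 h.symm, fun h => hsR.2.1.2.2.2 h.symm, hR.nadj₁₂⟩, ?_⟩
    · rintro rfl; exact hR.nadj₁ hsR.1
    · rintro rfl; exact hR.nadj₂ hsR.1
    · have hSfar : ∀ y ∈ S \ {s}, ∀ x ∈ insert a₁ (insert a₂ A), x ≠ y ∧ ¬ G.Adj x y := by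
        rintro y hy x (rfl | rfl | hx)
        · exact ⟨fun h' => h.left.nadj₁ (h' ▸ (hS y hy.1).1.1), (hS y hy.1).1.2.1.1⟩
        · exact ⟨fun h' => h.left.nadj₂ (h' ▸ (hS y hy.1).1.1), (hS y hy.1).1.2.1.2.1⟩
        · exact ⟨fun h' => (hS y hy.1).2.1 (h' ▸ hx), fun h' => hy.2 (hA y hy.1 ⟨x, hx, h'.symm⟩)⟩
      rintro x hx y (rfl | rfl | hy | hy)
      · exact h.far x hx _ (Or.inl rfl)
      · exact h.far x hx _ (Or.inr (Or.inl rfl))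
      · exact h.far x hx y (Or.inr (Or.inr hy))
      · exact hSfar y hy x hx
  obtain ⟨B', hB', b₁', b₂', hm, hn⟩ := hG.exists_subset_neighborSet hmodel.swap
  -- Only `t` touches `B`, so no neighbour of `s` lies in `B`.
  have hB'S : B' ⊆ S \ {s} := fun x hx => (hB' hx).resolve_left fun hxB =>
    hst (hB s hs ⟨x, hxB, hn hx⟩)
  have hsub : ∃ z, B' ⊆ {z} := by
    by_cases hSt : S \ {s} = {t}
    · exact ⟨t, hSt ▸ hB'S⟩
    -- A neighbour of `s` in `B'` other than `z` would keep `S \ {z}` connected, contradicting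
    -- minimality of the link.
    obtain ⟨z, hz, hzt, hz'⟩ := hs'.exists_noncut ⟨ht, hst.symm⟩ hSt
    refine ⟨z, fun y hy => ?_⟩
    by_contra hyz
    refine hmin z (fun he => hz.2 he.symm) hzt.symm hz.1 ?_
    have : S \ {z} = insert s ((S \ {s}) \ {z}) := by
      ext p
      by_cases hps : p = s
      · subst hps
        exact ⟨fun _ => Or.inl rfl, fun _ => ⟨hs, fun h => hz.2 h.symm⟩⟩
      · simp [hps]
    rw [this]
    exact hz'.insert_of_adj ⟨hB'S hy, hyz⟩ (hn hy)
  obtain ⟨z, hz⟩ := hsub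
  exact hG.singleton hm z (hm.left.conn.1.subset_singleton_iff.1 hz)

/-- Induction on `|S|` allows `S` to be taken minimal. Then a non-cut vertex of `S` is its only
contact with `A` or its only contact with `B`, and two such vertices must play different roles. -/
theorem IsLeastHub.not_link {V : Type} [Finite V] {G : SimpleGraph V}
    (hG : NoSmallModel G) {A B : Set V} {c a₁ a₂ b₁ b₂ v w : V} (hl : IsLeastHub G A B)
    (h : IsHubModel G A B c a₁ a₂ b₁ b₂) (hv : v ∈ A) (hw : w ∈ B) {S : Set V}
    (hS : ∀ x ∈ S, HubRest G c a₁ a₂ b₁ b₂ v w x ∧ x ∉ A ∧ x ∉ B) (hconn : ConnSet G S)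
    (hA : ∃ y ∈ S, ∃ x ∈ A, G.Adj y x) (hB : ∃ y ∈ S, ∃ x ∈ B, G.Adj y x) : False := by
  induction hk : S.ncard using Nat.strong_induction_on generalizing S with
  | _ k ih =>
  subst hk
  by_cases hsing : ∃ s, S = {s}
  · obtain ⟨s, rfl⟩ := hsing
    obtain ⟨_, rfl, hsA⟩ := hA
    obtain ⟨_, rfl, hsB⟩ := hB
    obtain ⟨hs, hs₁, hs₂⟩ := hS _ rfl
    have hm : IsModel G A B _ a₁ a₂ b₁ b₂ := ⟨h.hubRest_adj_left hs hs₁ hsA,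
      h.swap.hubRest_adj_left hs.swap hs₂ hsB, h.far⟩
    obtain ⟨A', hA', B', hB', x₁, x₂, y₁, y₂, hm'⟩ := hG.exists_isHubModel hm
    obtain ⟨rfl, rfl⟩ := hl.eq_of_subset hm' hA' hB'
    -- A one-vertex link can replace `c`; leastness then puts all of `A` and `B` in its
    -- neighbourhood. This is why `HubRest` excludes common neighbours of `v` and `w`.
    exact hs.2.2 ⟨(hm'.left_subset hv).symm, (hm'.right_subset hw).symm⟩
  push Not at hsing
  have hmin : ∀ z ∈ S, ConnSet G (S \ {z}) → (∃ y ∈ S \ {z}, ∃ x ∈ A, G.Adj y x) →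
      (∃ y ∈ S \ {z}, ∃ x ∈ B, G.Adj y x) → False := fun z hz hz' hzA hzB =>
    ih _ (Set.ncard_sdiff_singleton_lt_of_mem hz (Set.toFinite S))
      (fun x hx => hS x hx.1) hz' hzA hzB rfl
  have hsole : ∀ z ∈ S, ConnSet G (S \ {z}) → (∀ y ∈ S, (∃ x ∈ A, G.Adj y x) → y = z) ∨
      (∀ y ∈ S, (∃ x ∈ B, G.Adj y x) → y = z) := by
    intro z hz hz'
    by_contra! hcon
    obtain ⟨⟨y, hy, hyA, hyz⟩, y', hy', hyB, hyz'⟩ := hcon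
    exact hmin z hz hz' ⟨y, ⟨hy, hyz⟩, hyA⟩ ⟨y', ⟨hy', hyz'⟩, hyB⟩
  obtain ⟨s, hs, t, ht, hst, hs', ht'⟩ := hconn.exists_two_noncut hsing
  obtain ⟨y, hy, hyA⟩ := hA
  obtain ⟨y', hy', hyB⟩ := hB
  rcases hsole s hs hs' with h₁ | h₁ <;> rcases hsole t ht ht' with h₂ | h₂
  · exact hst ((h₁ y hy hyA).symm.trans (h₂ y hy hyA))
  · obtain rfl := h₁ y hy hyA
    obtain rfl := h₂ y' hy' hyB
    exact h.not_link_of_sole hG hS hconn hs ht hst hs' hyA hyB h₁ h₂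
      fun z hsz htz hz hz' => hmin z hz hz' ⟨y, ⟨hs, hsz⟩, hyA⟩ ⟨y', ⟨ht, htz⟩, hyB⟩
  · obtain rfl := h₁ y' hy' hyB
    obtain rfl := h₂ y hy hyA
    exact h.swap.not_link_of_sole hG (fun x hx => ⟨(hS x hx).1.swap, (hS x hx).2.2, (hS x hx).2.1⟩)
      hconn hs ht hst hs' hyB hyA h₁ h₂
      fun z hsz htz hz hz' => hmin z hz hz' ⟨y, ⟨ht, htz⟩, hyA⟩ ⟨y', ⟨hs, hsz⟩, hyB⟩
  · exact hst ((h₁ y' hy' hyB).symm.trans (h₂ y' hy' hyB))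

theorem HubZone.swap {V : Type} (G : SimpleGraph V) (c a₁ a₂ b₁ b₂ v w : V) :
    HubZone G c a₁ a₂ b₁ b₂ v w = HubZone G c b₁ b₂ a₁ a₂ w v := by
  ext p
  exact ⟨fun h => h.elim (fun h => Or.inr (Or.inl h)) fun h => h.imp_right fun h => Or.inr h.swap,
    fun h => h.elim (fun h => Or.inr (Or.inl h)) fun h => h.imp_right fun h => Or.inr h.swap⟩

/-- The component of `v` neither meets `B` nor is joined to it. -/
theorem IsLeastHub.linked_far {V : Type} [Finite V] {G : SimpleGraph V}
    (hG : NoSmallModel G) {A B : Set V} {c a₁ a₂ b₁ b₂ v w : V} (hl : IsLeastHub G A B)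
    (h : IsHubModel G A B c a₁ a₂ b₁ b₂) (hv : v ∈ A) (hw : w ∈ B) {p : V}
    (hp : Linked G (HubZone G c a₁ a₂ b₁ b₂ v w) v p) :
    ∀ y ∈ B, p ≠ y ∧ ¬ G.Adj p y := by
  -- The invariant along a path from `v`: the current vertex is in `A`, or in a connected set
  -- outside both branch sets that hangs on `A`.
  have hfar : ∀ x, (x ∈ A ∨ ∃ S, (∀ x ∈ S, HubRest G c a₁ a₂ b₁ b₂ v w x ∧ x ∉ A ∧ x ∉ B) ∧
      ConnSet G S ∧ x ∈ S ∧ ∃ y ∈ S, ∃ x ∈ A, G.Adj y x) → ∀ y ∈ B, x ≠ y ∧ ¬ G.Adj x y := by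
    rintro x (hx | ⟨S, hS, hconn, hx, hSA⟩) y hy
    · exact h.disjoint x hx y hy
    · exact ⟨fun h' => (hS x hx).2.2 (h' ▸ hy),
        fun h' => hl.not_link hG h hv hw hS hconn hSA ⟨x, hx, y, hy, h'⟩⟩
  refine hfar p ((hp.induction (P := fun x => x ∈ A ∨ ∃ S, (∀ x ∈ S,
    HubRest G c a₁ a₂ b₁ b₂ v w x ∧ x ∉ A ∧ x ∉ B) ∧ ConnSet G S ∧ x ∈ S ∧
      ∃ y ∈ S, ∃ x ∈ A, G.Adj y x) fun x y hx hxy hUx hUy => ?_).1 (Or.inl hv))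
  by_cases hyA : y ∈ A
  · exact Or.inl hyA
  have hyB : y ∉ B := fun hy => (hfar x hx y hy).2 hxy
  have hy : HubRest G c a₁ a₂ b₁ b₂ v w y ∧ y ∉ A ∧ y ∉ B := by
    rcases hUy with rfl | rfl | hy
    · exact absurd hv hyA
    · exact absurd hw hyB
    · exact ⟨hy, hyA, hyB⟩
  rcases hx with hx | ⟨S, hS, hconn, hx, q, hq, hqA⟩
  · refine Or.inr ⟨{y}, ?_, connSet_singleton G y, rfl, y, rfl, x, hx, hxy.symm⟩
    rintro z rfl
    exact hy
  · refine Or.inr ⟨insert y S, ?_, hconn.insert_of_adj hx hxy.symm, Or.inl rfl, q, Or.inr hq, hqA⟩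
    rintro z (rfl | hz)
    exacts [hy, hS z hz]

/-- A half of the second test succeeds. -/
theorem IsHubModel.hubLast {V : Type} {G : SimpleGraph V} (hG : NoSmallModel G) {A B : Set V}
    {c a₁ a₂ b₁ b₂ v v' w : V} (h : IsHubModel G A B c a₁ a₂ b₁ b₂) (hv : v ∈ A)
    (hv' : v' ∈ A) (hne : v ≠ v') (hw : w ∈ B) (ha₂ : G.Adj a₂ v') (hconn : ConnSet G (A \ {v'}))
    (h₁ : ∀ x ∈ A, G.Adj a₁ x → x = v) (h₂ : ∀ x ∈ A, G.Adj a₂ x → x = v')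
    (hfar : ∀ p, Linked G (HubZone G c a₁ a₂ b₁ b₂ v w) w p → ∀ y ∈ A, p ≠ y ∧ ¬ G.Adj p y) :
    HubLast G (Linked G (HubZone G c a₁ a₂ b₁ b₂ v w)) c a₂ b₁ b₂ v w v' := by
  have hF := h.toIsModel.left_far
  have hU : ∀ x ∈ A \ {v'}, HubZone G c a₁ a₂ b₁ b₂ v w x := by
    intro x hx
    by_cases hxv : x = v
    · exact Or.inl hxv
    · exact Or.inr (Or.inr ⟨h.left_subset hx.1, ⟨fun h' => hxv (h₁ x hx.1 h'),
        fun h' => hx.2 (h₂ x hx.1 h'), fun h' => (hF x hx.1 b₁ (Or.inl rfl)).2 h'.symm,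
        fun h' => (hF x hx.1 b₂ (Or.inr (Or.inl rfl))).2 h'.symm⟩,
        fun h' => (hF x hx.1 w (Or.inr (Or.inr hw))).2 h'.2.symm⟩)
  obtain ⟨q, hq, hvq⟩ := h.left.conn.exists_adj_diff hv' (hG.singleton h.toIsModel v')
  exact ⟨⟨h.left_subset hv', ha₂, fun h' => (hF v' hv' b₁ (Or.inl rfl)).2 h'.symm,
    fun h' => (hF v' hv' b₂ (Or.inr (Or.inl rfl))).2 h'.symm⟩,
    ⟨q, hconn.linked hU ⟨hv, hne⟩ hq, hvq⟩, fun ⟨p, hp, hvp⟩ => (hfar p hp v' hv').2 hvp.symm⟩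

/-- The components used by the test may be larger than `A \ {v'}` and `B \ {w'}`. This does no harm,
since each stays far from the opposite branch set by `IsLeastHub.linked_far`. -/
theorem NoSmallModel.exists_hubTest {V : Type} [Finite V] {G : SimpleGraph V}
    (hG : NoSmallModel G) {A B : Set V} {c a₁ a₂ b₁ b₂ : V}
    (h : IsModel G A B c a₁ a₂ b₁ b₂) :
    ∃ c a₁ a₂ b₁ b₂ v w, HubTest G c a₁ a₂ b₁ b₂ v w := by
  obtain ⟨A, B, c, x₁, x₂, y₁, y₂, h, hl⟩ := hG.exists_isLeastHub h
  obtain ⟨a₁, a₂, v, v', h, hv, hv', hvv, hav, hav', hconnA, hA₁, hA₂⟩ := hl.exists_ends hG h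
  obtain ⟨b₁, b₂, w, w', h, hw, hw', hww, hbw, hbw', hconnB, hB₁, hB₂⟩ :=
    hl.swap.exists_ends hG h.swap
  replace h := h.swap
  have hFA := h.left_far
  have hFB := h.swap.left_far
  have hfar := fun p hp => hl.linked_far hG h hv hw (p := p) hp
  have hfar' : ∀ p, Linked G (HubZone G c a₁ a₂ b₁ b₂ v w) w p →
      ∀ y ∈ A, p ≠ y ∧ ¬ G.Adj p y := by
    intro p hp
    rw [HubZone.swap] at hp
    exact hl.swap.linked_far hG h.swap hw hv hp
  have hlast := h.hubLast hG hv hv' hvv hw hav' hconnA hA₁ hA₂ hfar'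
  have hlast' := h.swap.hubLast hG hw hw' hww hv hbw' hconnB hB₁ hB₂ (by rwa [← HubZone.swap])
  rw [← HubZone.swap] at hlast'
  have f11 := h.far a₁ (Or.inl rfl) b₁ (Or.inl rfl)
  have f12 := h.far a₁ (Or.inl rfl) b₂ (Or.inr (Or.inl rfl))
  have f21 := h.far a₂ (Or.inr (Or.inl rfl)) b₁ (Or.inl rfl)
  have f22 := h.far a₂ (Or.inr (Or.inl rfl)) b₂ (Or.inr (Or.inl rfl))
  refine ⟨c, a₁, a₂, b₁, b₂, v, w,
    ⟨h.left_subset hv, hav, fun h' => hvv (hA₂ v hv h'), fun h' => (hFA v hv b₁ (Or.inl rfl)).2 h'.symm,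
      fun h' => (hFA v hv b₂ (Or.inr (Or.inl rfl))).2 h'.symm⟩,
    ⟨h.right_subset hw, hbw, fun h' => hww (hB₂ w hw h'),
      fun h' => (hFB w hw a₁ (Or.inl rfl)).2 h'.symm,
      fun h' => (hFB w hw a₂ (Or.inr (Or.inl rfl))).2 h'.symm⟩,
    ⟨h.left.nadj₁, h.left.nadj₂, h.right.nadj₁, h.right.nadj₂⟩,
    ⟨h.left.nadj₁₂, h.right.nadj₁₂⟩, ⟨f11.2, f12.2, f21.2, f22.2⟩,
    fun h' => (hfar w h' w hw).1 rfl, v', w', hlast, hlast', (h.disjoint v' hv' w' hw').2⟩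

theorem hasInducedMinor_graphH2_iff_tests {V : Type} [Finite V] {G : SimpleGraph V} :
    HasInducedMinor graphH2 G ↔ (∃ x y z a₁ a₂ b₁ b₂, SmallTest G x y z a₁ a₂ b₁ b₂) ∨
      ∃ c a₁ a₂ b₁ b₂ v w, HubTest G c a₁ a₂ b₁ b₂ v w := by
  rw [hasInducedMinor_graphH2_iff]
  constructor
  · rintro ⟨A, B, c, a₁, a₂, b₁, b₂, h⟩
    by_cases hG : NoSmallModel G
    · exact Or.inr (hG.exists_hubTest h)
    · unfold NoSmallModel at hG
      push Not at hG
      obtain ⟨x, y, z, B, c, a₁, a₂, b₁, b₂, hxy, hyz, h⟩ := hG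
      exact Or.inl ⟨x, y, z, a₁, a₂, b₁, b₂, h.smallTest hxy hyz⟩
  · rintro (⟨x, y, z, a₁, a₂, b₁, b₂, h⟩ | ⟨c, a₁, a₂, b₁, b₂, v, w, h⟩)
    · obtain ⟨A, B, c, h⟩ := h.exists_isModel
      exact ⟨A, B, c, a₁, a₂, b₁, b₂, h⟩
    · obtain ⟨A, B, h⟩ := h.exists_isModel
      exact ⟨A, B, c, a₁, a₂, b₁, b₂, h⟩

/-! ### Reasoning about programs -/

namespace WordRAM

/-- The program `p` halts from `s` within `T` steps in a state with property `Q`. -/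
def Halts (W : ℕ) (p : Program) (s : State) (T : ℕ) (Q : State → Prop) : Prop :=
  ∃ t s', Run W p s t s' ∧ t ≤ T ∧ Q s'

theorem Halts.mono {W : ℕ} {p : Program} {s : State} {T T' : ℕ} {Q Q' : State → Prop}
    (h : Halts W p s T Q) (hT : T ≤ T') (hQ : ∀ s', Q s' → Q' s') : Halts W p s T' Q' := by
  obtain ⟨t, s', hr, ht, hq⟩ := h
  exact ⟨t, s', hr, ht.trans hT, hQ s' hq⟩

theorem Halts.seq {W : ℕ} {p q : Program} {s : State} {T T' : ℕ} {Q : State → Prop}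
    (h : Halts W p s T fun s' => Halts W q s' T' Q) : Halts W (.seq p q) s (T + T') Q := by
  obtain ⟨t, s', hr, ht, t', s'', hr', ht', hq⟩ := h
  exact ⟨t + t', s'', .seq hr hr', by omega, hq⟩

theorem halts_skip {W : ℕ} {s : State} {Q : State → Prop} (h : Q s) : Halts W .skip s 1 Q :=
  ⟨1, s, .skip s, le_rfl, h⟩

theorem halts_const {W x k : ℕ} {s : State} {Q : State → Prop} (hk : k < W)
    (h : Q (s.setReg x k)) : Halts W (.const x k) s 1 Q :=
  ⟨1, _, .const s x k hk, le_rfl, h⟩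

theorem halts_add {W x y z : ℕ} {s : State} {Q : State → Prop} (hk : s.reg y + s.reg z < W)
    (h : Q (s.setReg x (s.reg y + s.reg z))) : Halts W (.add x y z) s 1 Q :=
  ⟨1, _, .add s x y z hk, le_rfl, h⟩

theorem halts_sub {W x y z : ℕ} {s : State} {Q : State → Prop} (hk : s.reg y - s.reg z < W)
    (h : Q (s.setReg x (s.reg y - s.reg z))) : Halts W (.sub x y z) s 1 Q :=
  ⟨1, _, .sub s x y z hk, le_rfl, h⟩

theorem halts_mul {W x y z : ℕ} {s : State} {Q : State → Prop} (hk : s.reg y * s.reg z < W)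
    (h : Q (s.setReg x (s.reg y * s.reg z))) : Halts W (.mul x y z) s 1 Q :=
  ⟨1, _, .mul s x y z hk, le_rfl, h⟩

theorem halts_load {W x y : ℕ} {s : State} {Q : State → Prop} (hk : s.mem (s.reg y) < W)
    (h : Q (s.setReg x (s.mem (s.reg y)))) : Halts W (.load x y) s 1 Q :=
  ⟨1, _, .load s x y hk, le_rfl, h⟩

theorem halts_store {W x y : ℕ} {s : State} {Q : State → Prop} (hk : s.reg y < W)
    (h : Q (s.setMem (s.reg x) (s.reg y))) : Halts W (.store x y) s 1 Q :=
  ⟨1, _, .store s x y hk, le_rfl, h⟩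

theorem halts_ifLess {W x y T : ℕ} {p q : Program} {s : State} {Q : State → Prop}
    (hp : s.reg x < s.reg y → Halts W p s T Q) (hq : ¬ s.reg x < s.reg y → Halts W q s T Q) :
    Halts W (.ifLess x y p q) s (T + 1) Q := by
  by_cases h : s.reg x < s.reg y
  · obtain ⟨t, s', hr, ht, hQ⟩ := hp h
    exact ⟨t + 1, s', .ifTrue x y h hr, by omega, hQ⟩
  · obtain ⟨t, s', hr, ht, hQ⟩ := hq h
    exact ⟨t + 1, s', .ifFalse x y h hr, by omega, hQ⟩

/-- The index of the invariant counts completed rounds and `m` bounds them. Exit is allowed at any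
index, which early termination of a search requires. -/
theorem halts_whileLess {W x y m T : ℕ} {p : Program} {I : ℕ → State → Prop} {Q : State → Prop}
    (hstep : ∀ i s, i < m → I i s → s.reg x < s.reg y → Halts W p s T (I (i + 1)))
    (hexit : ∀ i s, i ≤ m → I i s → ¬ s.reg x < s.reg y → Q s)
    (hend : ∀ s, I m s → ¬ s.reg x < s.reg y) {s : State} (h : I 0 s) :
    Halts W (.whileLess x y p) s (m * (T + 1) + 1) Q := by
  suffices ∀ k i s, i + k = m → I i s → Halts W (.whileLess x y p) s (k * (T + 1) + 1) Q from
    this m 0 s (by omega) h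
  intro k
  induction k with
  | zero =>
    intro i s hi hI
    obtain rfl : i = m := hi
    exact ⟨1, s, .whileFalse x y (hend s hI), by omega, hexit i s le_rfl hI (hend s hI)⟩
  | succ k ih =>
    intro i s hi hI
    by_cases hlt : s.reg x < s.reg y
    · obtain ⟨t, s', hr, ht, hI'⟩ := hstep i s (by omega) hI hlt
      obtain ⟨t', s'', hr', ht', hQ⟩ := ih (i + 1) s' (by omega) hI'
      refine ⟨t + t' + 1, s'', .whileTrue x y hlt hr hr', ?_, hQ⟩
      rw [Nat.succ_mul]
      omega
    · exact ⟨1, s, .whileFalse x y hlt, by omega, hexit i s (by omega) hI hlt⟩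

/-! ### Register layout

Register `0` holds `n`, registers `1` and `2` hold the constants zero and one, register `3` receives
truth values, registers `4` to `9` are scratch, registers `10` to `13` hold the base addresses of
four tables with `n` entries each, and register `20 + i` holds the variable number `i`. -/

/-- The state is set up for graphs with `n` vertices. -/
structure Good (W n : ℕ) (s : State) : Prop where
  size : s.reg 0 = n
  zero : s.reg 1 = 0
  one : s.reg 2 = 1
  base : ∀ k < 4, s.reg (10 + k) = n * n + k * n
  mem_lt : ∀ a, s.mem a < W

theorem Good.setReg {W n x a : ℕ} {s : State} (h : Good W n s)
    (hx : (3 ≤ x ∧ x < 10) ∨ 20 ≤ x) : Good W n (s.setReg x a) := by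
  obtain ⟨h0, h1, h2, h3, h4⟩ := h
  have hne : ∀ y, y ≠ x → (s.setReg x a).reg y = s.reg y := fun y hy =>
    Function.update_of_ne hy _ _
  refine ⟨?_, ?_, ?_, fun k hk => ?_, h4⟩
  · rw [hne _ (by omega), h0]
  · rw [hne _ (by omega), h1]
  · rw [hne _ (by omega), h2]
  · rw [hne _ (by omega), h3 k hk]

theorem Good.setMem {W n x a : ℕ} {s : State} (h : Good W n s) (ha : a < W) :
    Good W n (s.setMem x a) := by
  refine ⟨h.size, h.zero, h.one, h.base, fun y => ?_⟩
  change Function.update s.mem x a y < W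
  by_cases hy : y = x
  · rw [hy, Function.update_self]
    exact ha
  · rw [Function.update_of_ne hy]
    exact h.mem_lt y

/-- The first `d` variables have the values given by `ρ`. -/
def Env (n d : ℕ) (ρ : ℕ → ℕ) (s : State) : Prop :=
  ∀ i < d, s.reg (20 + i) = ρ i ∧ ρ i < n

theorem Env.setReg {n d x a : ℕ} {ρ : ℕ → ℕ} {s : State} (h : Env n d ρ s)
    (hx : x < 20 ∨ 20 + d ≤ x) : Env n d ρ (s.setReg x a) := by
  intro i hi
  refine ⟨?_, (h i hi).2⟩
  rw [← (h i hi).1]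
  exact Function.update_of_ne (by omega) _ _

theorem Env.push {n d a : ℕ} {ρ : ℕ → ℕ} {s : State} (h : Env n d ρ s)
    (ha : s.reg (20 + d) = a) (han : a < n) : Env n (d + 1) (Function.update ρ d a) s := by
  intro i hi
  by_cases hid : i = d
  · subst hid
    rw [Function.update_self]
    exact ⟨ha, han⟩
  · rw [Function.update_of_ne hid]
    exact h i (by omega)

theorem Env.pop {n d a : ℕ} {ρ : ℕ → ℕ} {s : State}
    (h : Env n (d + 1) (Function.update ρ d a) s) : Env n d ρ s ∧ s.reg (20 + d) = a := by
  refine ⟨fun i hi => ?_, ?_⟩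
  · have := h i (by omega)
    rwa [Function.update_of_ne (by omega)] at this
  · have := (h d (by omega)).1
    rwa [Function.update_self] at this

theorem reg_setReg_of_ne {x y a : ℕ} {s : State} (h : y ≠ x) : (s.setReg x a).reg y = s.reg y :=
  Function.update_of_ne h _ _

theorem reg_setReg_self {x a : ℕ} {s : State} : (s.setReg x a).reg x = a :=
  Function.update_self _ _ _

theorem mem_setReg {x a : ℕ} {s : State} : (s.setReg x a).mem = s.mem := rfl

theorem mem_setMem {x a : ℕ} {s : State} : (s.setMem x a).mem = Function.update s.mem x a := rfl

/-- Register `3` holds the truth value of `P`. -/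
def Answer (P : Prop) (s : State) : Prop :=
  s.reg 3 = 1 ∧ P ∨ s.reg 3 = 0 ∧ ¬ P

/-- The program `p` computes the truth value of `φ` on the first `d` variables within `T` steps and
preserves the property `J` of the memory. -/
def Decides (W n d : ℕ) (J : (ℕ → ℕ) → Prop) (p : Program) (T : ℕ) (φ : (ℕ → ℕ) → Prop) : Prop :=
  ∀ s ρ, Good W n s → J s.mem → Env n d ρ s →
    Halts W p s T fun s' => Good W n s' ∧ J s'.mem ∧ Env n d ρ s' ∧ Answer (φ ρ) s'

/-- Run `p` with the variable `d` ranging over all vertices until it yields the answer one. -/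
def exLoop (d : ℕ) (p : Program) : Program :=
  .seq (.const (20 + d) 0) (.seq (.const 3 0) (.whileLess (20 + d) 0
    (.seq p (.ifLess 1 3 (.add (20 + d) 0 1) (.add (20 + d) (20 + d) 2)))))

theorem Decides.exLoop {W n d T : ℕ} {J : (ℕ → ℕ) → Prop} {p : Program}
    {φ : (ℕ → ℕ) → Prop} (hW : n * n + 5 * n + 5 < W) (h : Decides W n (d + 1) J p T φ) :
    Decides W n d J (exLoop d p) (n * (T + 3) + 3)
      (fun ρ => ∃ x < n, φ (Function.update ρ d x)) := by
  intro s ρ hs hJ hE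
  refine Halts.mono (T := 1 + (1 + (n * (T + 3) + 1))) (.seq (halts_const (by omega)
    (.seq (halts_const (by omega) ?_)))) (by omega) fun _ h => h
  -- Either no witness has occurred below `i`, or one was found and the loop variable has jumped to
  -- `n`, so that the loop test fails next.
  refine halts_whileLess (m := n) (T := T + 2) (I := fun i s => Good W n s ∧ J s.mem ∧ Env n d ρ s ∧
    (s.reg (20 + d) = i ∧ s.reg 3 = 0 ∧ (∀ x < i, ¬ φ (Function.update ρ d x)) ∨
      s.reg (20 + d) = n ∧ s.reg 3 = 1 ∧ ∃ x < n, φ (Function.update ρ d x))) ?_ ?_ ?_ ?_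
  · rintro i s hi ⟨hs, hJ, hE, ⟨hd, -, hno⟩ | ⟨hd, -, -⟩⟩ hlt
    · refine .seq ((h s _ hs hJ (hE.push hd hi)).mono le_rfl ?_)
      rintro s' ⟨hs', hJ', hE', hans⟩
      obtain ⟨hE'', hd'⟩ := hE'.pop
      refine halts_ifLess (fun hl => halts_add ?_ ?_) (fun hl => halts_add ?_ ?_)
      · rw [hs'.size, hs'.zero]; omega
      · refine ⟨hs'.setReg (by omega), hJ', hE''.setReg (by omega), Or.inr ⟨?_, ?_, ?_⟩⟩
        · rw [hs'.size, hs'.zero]; exact Function.update_self _ _ _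
        · rcases hans with ⟨h3, -⟩ | ⟨h3, -⟩
          · rw [← h3]; exact Function.update_of_ne (by omega) _ _
          · rw [h3] at hl; omega
        · rcases hans with ⟨-, hφ⟩ | ⟨h3, -⟩
          · exact ⟨i, hi, hφ⟩
          · rw [h3] at hl; omega
      · rw [hd', hs'.one]; omega
      · refine ⟨hs'.setReg (by omega), hJ', hE''.setReg (by omega), Or.inl ⟨?_, ?_, ?_⟩⟩
        · rw [hd', hs'.one]; exact Function.update_self _ _ _
        · rcases hans with ⟨h3, -⟩ | ⟨h3, -⟩
          · rw [h3, hs'.zero] at hl; omega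
          · rw [← h3]; exact Function.update_of_ne (by omega) _ _
        · rcases hans with ⟨h3, -⟩ | ⟨-, hφ⟩
          · rw [h3, hs'.zero] at hl; omega
          · intro x hx
            rcases Nat.lt_succ_iff_lt_or_eq.1 hx with hx | rfl
            · exact hno x hx
            · exact hφ
    · rw [hd, hs.size] at hlt; omega
  · rintro i s hi ⟨hs, hJ, hE, ⟨hd, h3, hno⟩ | ⟨hd, h3, hyes⟩⟩ hlt
    · rw [hd, hs.size] at hlt
      refine ⟨hs, hJ, hE, Or.inr ⟨h3, ?_⟩⟩
      rintro ⟨x, hx, hφ⟩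
      exact hno x (by omega) hφ
    · exact ⟨hs, hJ, hE, Or.inl ⟨h3, hyes⟩⟩
  · rintro s ⟨hs, -, -, ⟨hd, -⟩ | ⟨hd, -⟩⟩ <;> rw [hd, hs.size] <;> omega
  · refine ⟨(hs.setReg (by omega)).setReg (by omega), hJ, (hE.setReg (by omega)).setReg (by omega),
      Or.inl ⟨?_, reg_setReg_self, by omega⟩⟩
    rw [reg_setReg_of_ne (by omega), reg_setReg_self]

theorem Decides.mono {W n d T T' : ℕ} {J : (ℕ → ℕ) → Prop} {p : Program}
    {φ : (ℕ → ℕ) → Prop} (h : Decides W n d J p T φ) (hT : T ≤ T') : Decides W n d J p T' φ :=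
  fun s ρ hs hJ hE => (h s ρ hs hJ hE).mono hT fun _ h => h

/-- Run `body` with the variable `d` ranging over the numbers below the content of register `b`. -/
def forLoop (d b : ℕ) (body : Program) : Program :=
  .seq (.const (20 + d) 0) (.whileLess (20 + d) b (.seq body (.add (20 + d) (20 + d) 2)))

theorem halts_forLoop {W n d b m T : ℕ} {body : Program} {ρ : ℕ → ℕ} {J : ℕ → (ℕ → ℕ) → Prop}
    (hW : n * n + 5 * n + 5 < W) (hb : b = 0 ∧ m = n ∨ ∃ j < d, b = 20 + j ∧ m = ρ j)
    (hstep : ∀ i < m, ∀ s, Good W n s → Env n (d + 1) (Function.update ρ d i) s → J i s.mem →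
      Halts W body s T fun s' =>
        Good W n s' ∧ Env n (d + 1) (Function.update ρ d i) s' ∧ J (i + 1) s'.mem)
    {s : State} (hs : Good W n s) (hE : Env n d ρ s) (hJ : J 0 s.mem) :
    Halts W (forLoop d b body) s (m * (T + 2) + 2) fun s' =>
      Good W n s' ∧ Env n d ρ s' ∧ J m s'.mem := by
  have hmn : m ≤ n := by
    rcases hb with ⟨-, h⟩ | ⟨j, hj, -, h⟩
    · exact h.le
    · rw [h]; exact (hE j hj).2.le
  have hbm : ∀ s, Good W n s → Env n d ρ s → s.reg b = m := by
    intro s hs hE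
    rcases hb with ⟨rfl, rfl⟩ | ⟨j, hj, rfl, rfl⟩
    · exact hs.size
    · exact (hE j hj).1
  refine Halts.mono (T := 1 + (m * (T + 2) + 1)) (.seq (halts_const (by omega) ?_))
    (by omega) fun _ h => h
  refine halts_whileLess (T := T + 1) (I := fun i s => (Good W n s ∧ Env n d ρ s ∧ J i s.mem) ∧
    s.reg (20 + d) = i) ?_ ?_ ?_ ?_
  · rintro i s hi ⟨⟨hs, hE, hJ⟩, hd⟩ -
    refine .seq ((hstep i hi s hs (hE.push hd (by omega)) hJ).mono le_rfl ?_)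
    rintro s' ⟨hs', hE', hJ'⟩
    obtain ⟨hE'', hd'⟩ := hE'.pop
    refine halts_add ?_ ⟨⟨hs'.setReg (by omega), hE''.setReg (by omega), hJ'⟩, ?_⟩
    · rw [hd', hs'.one]; omega
    · rw [hd', hs'.one]; exact Function.update_self _ _ _
  · rintro i s hi ⟨⟨hs, hE, hJ⟩, hd⟩ hlt
    rw [hd, hbm s hs hE] at hlt
    obtain rfl : i = m := by omega
    exact ⟨hs, hE, hJ⟩
  · rintro s ⟨⟨hs, hE, -⟩, hd⟩
    rw [hd, hbm s hs hE]
    omega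
  · exact ⟨⟨hs.setReg (by omega), hE.setReg (by omega), hJ⟩, Function.update_self _ _ _⟩

/-! ### First-order queries -/

/-- First-order formulas over a graph with unary tables and one equivalence relation; the
quantifier at depth `d` binds the variable number `d`. -/
inductive Formula : Type
  | adj (i j : ℕ)
  | eq (i j : ℕ)
  | tab (k i : ℕ)
  | conn (i j : ℕ)
  | not (φ : Formula)
  | and (φ ψ : Formula)
  | ex (φ : Formula)

/-- Interpretation of the symbols of a formula. -/
structure Interp where
  adj : ℕ → ℕ → Prop
  tab : ℕ → ℕ → Prop
  conn : ℕ → ℕ → Prop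

namespace Formula

/-- The meaning of a formula at depth `d` on the vertices `0, …, n - 1`. -/
def eval (E : Interp) (n : ℕ) : ℕ → Formula → (ℕ → ℕ) → Prop
  | _, adj i j, ρ => E.adj (ρ i) (ρ j)
  | _, eq i j, ρ => ρ i = ρ j
  | _, tab k i, ρ => E.tab k (ρ i)
  | _, conn i j, ρ => E.conn (ρ i) (ρ j)
  | d, not φ, ρ => ¬ eval E n d φ ρ
  | d, and φ ψ, ρ => eval E n d φ ρ ∧ eval E n d ψ ρ
  | d, ex φ, ρ => ∃ x < n, eval E n (d + 1) φ (Function.update ρ d x)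

/-- The formula uses only variables below `d` and tables below `K`; table `0` stands for the
equivalence relation. -/
def WF (K : ℕ) : ℕ → Formula → Prop
  | d, adj i j => i < d ∧ j < d
  | d, eq i j => i < d ∧ j < d
  | d, tab k i => i < d ∧ 1 ≤ k ∧ k < K ∧ k < 3
  | d, conn i j => i < d ∧ j < d ∧ 1 ≤ K
  | d, not φ => WF K d φ
  | d, and φ ψ => WF K d φ ∧ WF K d ψ
  | d, ex φ => WF K (d + 1) φ

/-- A program that evaluates the formula. -/
def compile : ℕ → Formula → Program
  | _, adj i j => .seq (.mul 4 (20 + i) 0) (.seq (.add 4 4 (20 + j)) (.seq (.load 4 4)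
      (.ifLess 1 4 (.const 3 1) (.const 3 0))))
  | _, eq i j => .ifLess (20 + i) (20 + j) (.const 3 0)
      (.ifLess (20 + j) (20 + i) (.const 3 0) (.const 3 1))
  | _, tab k i => .seq (.add 4 (10 + k) (20 + i)) (.seq (.load 4 4)
      (.ifLess 1 4 (.const 3 1) (.const 3 0)))
  | _, conn i j => .seq (.add 4 10 (20 + i)) (.seq (.load 4 4) (.seq (.add 5 10 (20 + j))
      (.seq (.load 5 5) (.ifLess 4 5 (.const 3 0) (.ifLess 5 4 (.const 3 0) (.const 3 1))))))
  | d, not φ => .seq (compile d φ) (.sub 3 2 3)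
  | d, and φ ψ => .seq (compile d φ) (.ifLess 1 3 (compile d ψ) .skip)
  | d, ex φ => exLoop d (compile (d + 1) φ)

/-- A bound for the running time of the compiled formula. -/
def cost (n : ℕ) : Formula → ℕ
  | adj _ _ => 7
  | eq _ _ => 7
  | tab _ _ => 7
  | conn _ _ => 7
  | not φ => cost n φ + 1
  | and φ ψ => cost n φ + (cost n ψ + 2)
  | ex φ => n * (cost n φ + 3) + 3

/-- The number of nested quantifiers. -/
def depth : Formula → ℕ
  | adj _ _ => 0
  | eq _ _ => 0
  | tab _ _ => 0
  | conn _ _ => 0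
  | not φ => depth φ
  | and φ ψ => max (depth φ) (depth ψ)
  | ex φ => depth φ + 1

/-- Only quantifiers multiply the cost by `n`. Powers of `n + 1` are at least one even for `n = 0`,
so additive constants are absorbed. -/
theorem exists_cost_le (φ : Formula) (q : ℕ) (hq : φ.depth ≤ q) :
    ∃ C, ∀ n, φ.cost n ≤ C * (n + 1) ^ q := by
  induction φ generalizing q with
  | adj | eq | tab | conn =>
    exact ⟨7, fun n => Nat.le_mul_of_pos_right _ (Nat.pow_pos n.succ_pos)⟩
  | not φ ih =>
    obtain ⟨C, hC⟩ := ih q hq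
    refine ⟨C + 1, fun n => ?_⟩
    have h1 : 1 ≤ (n + 1) ^ q := Nat.pow_pos n.succ_pos
    have := hC n
    simp only [cost]
    rw [Nat.add_mul]
    omega
  | and φ ψ ih ih' =>
    obtain ⟨C, hC⟩ := ih q (le_trans (le_max_left _ _) hq)
    obtain ⟨C', hC'⟩ := ih' q (le_trans (le_max_right _ _) hq)
    refine ⟨C + C' + 2, fun n => ?_⟩
    have h1 : 1 ≤ (n + 1) ^ q := Nat.pow_pos n.succ_pos
    have := hC n
    have := hC' n
    simp only [cost]
    rw [Nat.add_mul, Nat.add_mul]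
    omega
  | ex φ ih =>
    obtain ⟨q, rfl⟩ : ∃ q', q = q' + 1 := ⟨q - 1, by simp only [depth] at hq; omega⟩
    obtain ⟨C, hC⟩ := ih q (by simp only [depth] at hq; omega)
    refine ⟨C + 3, fun n => ?_⟩
    have h1 : 1 ≤ (n + 1) ^ q := Nat.pow_pos n.succ_pos
    have := hC n
    simp only [cost]
    calc n * (cost n φ + 3) + 3 ≤ (n + 1) * (cost n φ + 3) := by rw [Nat.succ_mul]; omega
      _ ≤ (n + 1) * ((C + 3) * (n + 1) ^ q) := by
          refine Nat.mul_le_mul_left _ ?_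
          rw [Nat.add_mul]
          omega
      _ = (C + 3) * (n + 1) ^ (q + 1) := by ring

end Formula

/-- The memory holds the adjacency relation `A` row by row. -/
def AdjRep (n : ℕ) (A : ℕ → ℕ → Prop) (m : ℕ → ℕ) : Prop :=
  ∀ x < n, ∀ y < n, (A x y ↔ 0 < m (x * n + y))

/-- The memory represents the adjacency relation and the tables below `K`. -/
structure Rep (n K : ℕ) (E : Interp) (m : ℕ → ℕ) : Prop where
  adj : AdjRep n E.adj m
  tab : ∀ k, 1 ≤ k → k < K → ∀ x < n, (E.tab k x ↔ 0 < m (n * n + k * n + x))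
  conn : 1 ≤ K → ∀ x < n, ∀ y < n, (E.conn x y ↔ m (n * n + x) = m (n * n + y))

theorem mul_add_lt_mul {n x y : ℕ} (hx : x < n) (hy : y < n) : x * n + y < n * n := by
  have : (x + 1) * n ≤ n * n := Nat.mul_le_mul_right n hx
  rw [Nat.succ_mul] at this
  omega

/-- Evaluation writes no memory, so the preserved property can be equality with a fixed memory `m`.
The bound on `W` leaves room for all table addresses and loop counters. -/
theorem Formula.decides_compile {W n K : ℕ} {E : Interp} {m : ℕ → ℕ}
    (hW : n * n + 5 * n + 5 < W) (hm : Rep n K E m) (φ : Formula) :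
    ∀ d, φ.WF K d → Decides W n d (· = m) (φ.compile d) (φ.cost n) (φ.eval E n d) := by
  have htest : ∀ {s : State} {d : ℕ} {ρ : ℕ → ℕ} {P : Prop}, Good W n s → s.mem = m →
      Env n d ρ s → (P ↔ 0 < s.reg 4) → Halts W (.ifLess 1 4 (.const 3 1) (.const 3 0)) s 2
        fun s' => Good W n s' ∧ s'.mem = m ∧ Env n d ρ s' ∧ Answer P s' := by
    intro s d ρ P hs hJ hE hP
    refine halts_ifLess (fun h => halts_const (by omega) ?_) (fun h => halts_const (by omega) ?_)
    · rw [hs.zero] at h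
      exact ⟨hs.setReg (by omega), hJ, hE.setReg (by omega), Or.inl ⟨reg_setReg_self, hP.2 h⟩⟩
    · rw [hs.zero] at h
      exact ⟨hs.setReg (by omega), hJ, hE.setReg (by omega),
        Or.inr ⟨reg_setReg_self, fun h' => h (hP.1 h')⟩⟩
  have hcmp : ∀ {s : State} {d : ℕ} {ρ : ℕ → ℕ} {P : Prop} {x y : ℕ}, Good W n s → s.mem = m →
      Env n d ρ s → (P ↔ s.reg x = s.reg y) →
      Halts W (.ifLess x y (.const 3 0) (.ifLess y x (.const 3 0) (.const 3 1))) s 3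
        fun s' => Good W n s' ∧ s'.mem = m ∧ Env n d ρ s' ∧ Answer P s' := by
    intro s d ρ P x y hs hJ hE hP
    have h0 : ¬ s.reg x = s.reg y → Halts W (.const 3 0) s 1
        fun s' => Good W n s' ∧ s'.mem = m ∧ Env n d ρ s' ∧ Answer P s' := fun h =>
      halts_const (by omega) ⟨hs.setReg (by omega), hJ, hE.setReg (by omega),
        Or.inr ⟨reg_setReg_self, fun h' => h (hP.1 h')⟩⟩
    refine halts_ifLess (fun h => (h0 h.ne).mono (by omega) fun _ h => h) fun h =>
      halts_ifLess (fun h' => h0 h'.ne') fun h' => halts_const (by omega) ?_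
    exact ⟨hs.setReg (by omega), hJ, hE.setReg (by omega),
      Or.inl ⟨reg_setReg_self, hP.2 (by omega)⟩⟩
  induction φ with
  | adj i j =>
    rintro d ⟨hi, hj⟩ s ρ hs hJ hE
    have hlt := mul_add_lt_mul (hE i hi).2 (hE j hj).2
    refine Halts.mono (T := 1 + (1 + (1 + 2))) (.seq (halts_mul ?_ (.seq (halts_add ?_
      (.seq (halts_load ?_ (htest ?_ hJ ?_ ?_))))))) (by simp [cost]) fun _ h => h
    · rw [(hE i hi).1, hs.size]; omega
    · rw [reg_setReg_self, reg_setReg_of_ne (by omega), (hE i hi).1, hs.size, (hE j hj).1]; omega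
    · exact hs.mem_lt _
    · exact ((hs.setReg (by omega)).setReg (by omega)).setReg (by omega)
    · exact ((hE.setReg (by omega)).setReg (by omega)).setReg (by omega)
    · rw [reg_setReg_self, reg_setReg_self, reg_setReg_self, reg_setReg_of_ne (by omega),
        (hE i hi).1, hs.size, (hE j hj).1]
      change _ ↔ 0 < s.mem _
      rw [hJ]
      exact hm.adj _ (hE i hi).2 _ (hE j hj).2
  | eq i j =>
    rintro d ⟨hi, hj⟩ s ρ hs hJ hE
    refine (hcmp hs hJ hE ?_).mono (by simp [cost]) fun _ h => h
    rw [(hE i hi).1, (hE j hj).1]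
    rfl
  | tab k i =>
    rintro d ⟨hi, hk, hkK, hk3⟩ s ρ hs hJ hE
    have hin := (hE i hi).2
    refine Halts.mono (T := 1 + (1 + 2)) (.seq (halts_add ?_
      (.seq (halts_load ?_ (htest ?_ hJ ?_ ?_))))) (by simp [cost]) fun _ h => h
    · rw [(hE i hi).1, hs.base k (by omega)]
      have : k * n ≤ 3 * n := Nat.mul_le_mul_right n (by omega)
      omega
    · exact hs.mem_lt _
    · exact (hs.setReg (by omega)).setReg (by omega)
    · exact (hE.setReg (by omega)).setReg (by omega)
    · rw [reg_setReg_self, reg_setReg_self, (hE i hi).1, hs.base k (by omega)]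
      change _ ↔ 0 < s.mem _
      rw [hJ]
      exact hm.tab k hk hkK _ hin
  | conn i j =>
    rintro d ⟨hi, hj, hK⟩ s ρ hs hJ hE
    have hin := (hE i hi).2
    have hjn := (hE j hj).2
    have hb : s.reg 10 = n * n := by simpa using hs.base 0 (by omega)
    refine Halts.mono (T := 1 + (1 + (1 + (1 + 3)))) (.seq (halts_add ?_ (.seq (halts_load ?_
      (.seq (halts_add ?_ (.seq (halts_load ?_ (hcmp ?_ hJ ?_ ?_)))))))))
      (by simp [cost]) fun _ h => h
    · rw [(hE i hi).1, hb]; omega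
    · exact hs.mem_lt _
    · rw [reg_setReg_of_ne (by omega), reg_setReg_of_ne (by omega), reg_setReg_of_ne (by omega),
        reg_setReg_of_ne (by omega), (hE j hj).1, hb]; omega
    · exact hs.mem_lt _
    · exact (((hs.setReg (by omega)).setReg (by omega)).setReg (by omega)).setReg (by omega)
    · exact (((hE.setReg (by omega)).setReg (by omega)).setReg (by omega)).setReg (by omega)
    · rw [reg_setReg_self, reg_setReg_of_ne (by omega), reg_setReg_of_ne (by omega),
        reg_setReg_self, reg_setReg_self, reg_setReg_self]
      simp only [mem_setReg]
      rw [reg_setReg_of_ne (by omega), reg_setReg_of_ne (by omega), reg_setReg_of_ne (by omega),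
        reg_setReg_of_ne (by omega), (hE i hi).1, (hE j hj).1, hb, hJ]
      exact hm.conn hK _ hin _ hjn
  | not φ ih =>
    intro d hwf s ρ hs hJ hE
    refine .seq ((ih d hwf s ρ hs hJ hE).mono le_rfl ?_)
    rintro s' ⟨hs', hJ', hE', hans⟩
    have h2 := hs'.one
    refine halts_sub (by omega) ⟨hs'.setReg (by omega), hJ', hE'.setReg (by omega), ?_⟩
    rcases hans with ⟨h3, h⟩ | ⟨h3, h⟩
    · exact Or.inr ⟨by rw [reg_setReg_self, h2, h3], fun h' => h' h⟩
    · exact Or.inl ⟨by rw [reg_setReg_self, h2, h3], h⟩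
  | and φ ψ ih ih' =>
    rintro d ⟨hwf, hwf'⟩ s ρ hs hJ hE
    refine .seq ((ih d hwf s ρ hs hJ hE).mono le_rfl ?_)
    rintro s' ⟨hs', hJ', hE', hans⟩
    refine halts_ifLess (T := cost n ψ + 1)
      (fun h => (ih' d hwf' s' ρ hs' hJ' hE').mono (by omega) ?_)
      (fun h => (halts_skip ?_).mono (by omega) fun _ h => h)
    · rintro s'' ⟨hs'', hJ'', hE'', hans'⟩
      refine ⟨hs'', hJ'', hE'', ?_⟩
      rcases hans with ⟨-, hφ⟩ | ⟨h3, -⟩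
      · exact hans'.imp (fun h => ⟨h.1, hφ, h.2⟩) (fun h => ⟨h.1, fun h' => h.2 h'.2⟩)
      · rw [h3] at h; omega
    · refine ⟨hs', hJ', hE', ?_⟩
      rcases hans with ⟨h3, -⟩ | ⟨h3, hφ⟩
      · rw [h3, hs'.zero] at h; omega
      · exact Or.inr ⟨h3, fun h' => hφ h'.1⟩
  | ex φ ih =>
    intro d hwf
    exact (ih (d + 1) hwf).exLoop hW

end WordRAM

namespace WordRAM

/-! ### Tables -/

/-- The memories agree outside the table `k`. -/
def SameOff (n k : ℕ) (m m₀ : ℕ → ℕ) : Prop :=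
  ∀ a, (∀ x < n, a ≠ n * n + k * n + x) → m a = m₀ a

theorem SameOff.trans {n k : ℕ} {m m₁ m₂ : ℕ → ℕ} (h : SameOff n k m m₁)
    (h' : SameOff n k m₁ m₂) : SameOff n k m m₂ := fun a ha => (h a ha).trans (h' a ha)

theorem SameOff.update {n k x v : ℕ} {m : ℕ → ℕ} (hx : x < n) :
    SameOff n k (Function.update m (n * n + k * n + x) v) m :=
  fun _ ha => Function.update_of_ne (ha x hx) _ _

/-- Tables are consecutive blocks of length `n`, so division by `n` recovers the table number from
an address. -/
theorem SameOff.tab {n k k' x : ℕ} {m m₀ : ℕ → ℕ} (h : SameOff n k m m₀) (hk : k' ≠ k)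
    (hx : x < n) : m (n * n + k' * n + x) = m₀ (n * n + k' * n + x) := by
  refine h _ fun y hy he => hk ?_
  have h1 : (k' * n + x) / n = (k * n + y) / n := by
    congr 1
    omega
  rwa [Nat.mul_comm, Nat.mul_comm k, Nat.mul_add_div (by omega), Nat.mul_add_div (by omega),
    Nat.div_eq_of_lt hx, Nat.div_eq_of_lt hy, Nat.add_zero, Nat.add_zero] at h1

theorem SameOff.adjRep {n k : ℕ} {A : ℕ → ℕ → Prop} {m m₀ : ℕ → ℕ} (h : SameOff n k m m₀)
    (hm : AdjRep n A m₀) : AdjRep n A m := by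
  intro x hx y hy
  rw [h _ fun z hz he => ?_]
  · exact hm x hx y hy
  · have := mul_add_lt_mul hx hy
    omega

theorem SameOff.rep {n k K : ℕ} {E : Interp} {m m₀ : ℕ → ℕ} (h : SameOff n k m m₀)
    (hK : K ≤ k) (hm : Rep n K E m₀) : Rep n K E m := by
  refine ⟨h.adjRep hm.adj, fun k' hk' hkK x hx => ?_, fun hK' x hx y hy => ?_⟩
  · rw [h.tab (by omega) hx]
    exact hm.tab k' hk' hkK x hx
  · have h1 := h.tab (k' := 0) (by omega) hx
    have h2 := h.tab (k' := 0) (by omega) hy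
    simp only [Nat.zero_mul, Nat.add_zero] at h1 h2
    rw [h1, h2]
    exact hm.conn hK' x hx y hy

/-- Store the truth value of `φ` at each vertex in the table `k`. -/
def tabulate (k d : ℕ) (φ : Formula) : Program :=
  forLoop d 0 (.seq (φ.compile (d + 1)) (.seq (.add 4 (10 + k) (20 + d)) (.store 4 3)))

theorem Good.base_add_lt {W n k x : ℕ} (hW : n * n + 5 * n + 5 < W) (hk : k < 4) (hx : x < n) :
    n * n + k * n + x < W := by
  have : k * n ≤ 3 * n := Nat.mul_le_mul_right n (by omega)
  omega

/-- Since `φ` reads only tables below `K ≤ k`, filling table `k` never disturbs its later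
evaluations. -/
theorem halts_tabulate {W n k K d : ℕ} {φ : Formula} {E : Interp} {ρ : ℕ → ℕ}
    (hW : n * n + 5 * n + 5 < W) (hk : k < 4) (hK : K ≤ k) (hwf : φ.WF K (d + 1)) {s : State}
    (hs : Good W n s) (hE : Env n d ρ s) (hm : Rep n K E s.mem) :
    Halts W (tabulate k d φ) s (n * (φ.cost n + 4) + 2) fun s' =>
      Good W n s' ∧ Env n d ρ s' ∧ SameOff n k s'.mem s.mem ∧
        ∀ x < n, (0 < s'.mem (n * n + k * n + x) ↔
          φ.eval E n (d + 1) (Function.update ρ d x)) := by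
  refine halts_forLoop (T := φ.cost n + 2) (J := fun i m => SameOff n k m s.mem ∧
    ∀ x < i, (0 < m (n * n + k * n + x) ↔ φ.eval E n (d + 1) (Function.update ρ d x)))
    hW (Or.inl ⟨rfl, rfl⟩) ?_ hs hE ⟨fun _ _ => rfl, fun x hx => by omega⟩
  rintro i hi r hr hEr ⟨hJ, hJ'⟩
  refine .seq ((φ.decides_compile hW (hJ.rep hK hm) (d + 1) hwf r _ hr rfl hEr).mono le_rfl ?_)
  rintro t ⟨ht, hmem, hEt, hans⟩
  have hd := hEt.pop.2
  have hlt := Good.base_add_lt hW hk hi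
  refine Halts.seq (T := 1) (T' := 1) (halts_add ?_ (halts_store ?_ ⟨?_, ?_, ?_⟩))
  · rw [ht.base k hk, hd]; exact hlt
  · rw [reg_setReg_of_ne (by omega)]
    rcases hans with ⟨h, -⟩ | ⟨h, -⟩ <;> omega
  · refine (ht.setReg (by omega)).setMem ?_
    rw [reg_setReg_of_ne (by omega)]
    rcases hans with ⟨h, -⟩ | ⟨h, -⟩ <;> omega
  · exact hEt.setReg (by omega)
  · rw [mem_setMem, reg_setReg_self, reg_setReg_of_ne (by omega), mem_setReg, hmem, ht.base k hk, hd]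
    refine ⟨(SameOff.update hi).trans hJ, fun x hx => ?_⟩
    by_cases hxi : x = i
    · subst hxi
      rw [Function.update_self]
      rcases hans with ⟨h, hφ⟩ | ⟨h, hφ⟩
      · rw [h]; exact ⟨fun _ => hφ, fun _ => one_pos⟩
      · rw [h]; exact ⟨fun h => absurd h (lt_irrefl 0), fun h => absurd h hφ⟩
    · rw [Function.update_of_ne (by omega)]
      exact hJ' x (by omega)

/-! ### Connected components -/

/-- The equivalence relation generated by `R` on the numbers below `x`. -/
def Closure (R : ℕ → ℕ → Prop) (x : ℕ) : ℕ → ℕ → Prop :=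
  Relation.EqvGen fun a b => a < x ∧ b < x ∧ R a b

theorem Closure.mono {R : ℕ → ℕ → Prop} {x x' a b : ℕ} (hx : x ≤ x') (h : Closure R x a b) :
    Closure R x' a b :=
  Relation.EqvGen.mono (fun _ _ h => ⟨h.1.trans_le hx, h.2.1.trans_le hx, h.2.2⟩) a b h

theorem Closure.eq_or_lt {R : ℕ → ℕ → Prop} {x a b : ℕ} (h : Closure R x a b) :
    a = b ∨ a < x ∧ b < x := by
  induction h with
  | rel a b h => exact Or.inr ⟨h.1, h.2.1⟩
  | refl a => exact Or.inl rfl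
  | symm a b _ ih => omega
  | trans a b c _ _ ih ih' => omega

/-- Adding the vertex `x` merges exactly the classes of its earlier neighbours with `{x}` and leaves
the other classes alone. -/
theorem closure_succ_iff {R : ℕ → ℕ → Prop} {x : ℕ}
    (hR : ∀ a < x + 1, ∀ b < x + 1, R a b → R b a) {a b : ℕ} :
    Closure R (x + 1) a b ↔ Closure R x a b ∨
      (∃ w, (w = x ∨ w < x ∧ R x w) ∧ Closure R x w a) ∧
        ∃ w, (w = x ∨ w < x ∧ R x w) ∧ Closure R x w b := by
  constructor
  · intro h
    have hx : ∃ w, (w = x ∨ w < x ∧ R x w) ∧ Closure R x w x := ⟨x, Or.inl rfl, .refl x⟩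
    have hn : ∀ b, b < x + 1 → R x b → ∃ w, (w = x ∨ w < x ∧ R x w) ∧ Closure R x w b := by
      intro b hb hxb
      exact ⟨b, (Nat.lt_succ_iff_lt_or_eq.1 hb).symm.imp_right fun h => ⟨h, hxb⟩, .refl b⟩
    induction h with
    | rel a b h =>
      obtain ⟨ha, hb, hab⟩ := h
      rcases Nat.lt_succ_iff_lt_or_eq.1 ha with ha' | rfl
      · rcases Nat.lt_succ_iff_lt_or_eq.1 hb with hb' | rfl
        · exact Or.inl (.rel _ _ ⟨ha', hb', hab⟩)
        · exact Or.inr ⟨hn a ha (hR a ha b hb hab), hx⟩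
      · exact Or.inr ⟨hx, hn b hb hab⟩
    | refl a => exact Or.inl (.refl a)
    | symm a b _ ih => exact ih.imp (fun h => h.symm _ _) And.symm
    | trans a b c _ _ ih ih' =>
      rcases ih with ih | ⟨ih₁, ih₂⟩ <;> rcases ih' with ih' | ⟨ih₁', ih₂'⟩
      · exact Or.inl (ih.trans _ _ _ ih')
      · obtain ⟨w, hw, hwb⟩ := ih₁'
        exact Or.inr ⟨⟨w, hw, hwb.trans _ _ _ (ih.symm _ _)⟩, ih₂'⟩
      · obtain ⟨w, hw, hwb⟩ := ih₂
        exact Or.inr ⟨ih₁, ⟨w, hw, hwb.trans _ _ _ ih'⟩⟩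
      · exact Or.inr ⟨ih₁, ih₂'⟩
  · have hN : ∀ a, (∃ w, (w = x ∨ w < x ∧ R x w) ∧ Closure R x w a) →
        Closure R (x + 1) x a := by
      rintro a ⟨w, rfl | ⟨hw, hxw⟩, hwa⟩
      · exact hwa.mono (Nat.le_succ _)
      · exact .trans _ _ _ (.rel _ _ ⟨Nat.lt_succ_self x, by omega, hxw⟩) (hwa.mono (Nat.le_succ _))
    rintro (h | ⟨ha, hb⟩)
    · exact h.mono (Nat.le_succ _)
    · exact ((hN a ha).symm _ _).trans _ _ _ (hN b hb)

/-- The labels below `x` describe the components of the graph on the vertices below `x`. -/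
def Labels (R : ℕ → ℕ → Prop) (x : ℕ) (L : ℕ → ℕ) : Prop :=
  (∀ y < x, L y < x) ∧ ∀ y < x, ∀ z < x, (L y = L z ↔ Closure R x y z)

-- Older labels are below `x`, so `x` is a fresh name for the merged class and cannot collide with a
-- label that is kept.
open Classical in
theorem Labels.succ {R : ℕ → ℕ → Prop} {x : ℕ} {L L' : ℕ → ℕ} (h : Labels R x L)
    (hR : ∀ a < x + 1, ∀ b < x + 1, R a b → R b a) (hx : L' x = x)
    (hL : ∀ y < x, L' y = if ∃ w < x, R x w ∧ L w = L y then x else L y) :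
    Labels R (x + 1) L' := by
  obtain ⟨hlt, hcl⟩ := h
  set N : ℕ → Prop := fun y => ∃ w, (w = x ∨ w < x ∧ R x w) ∧ Closure R x w y with hN
  have hxN : N x := ⟨x, Or.inl rfl, .refl x⟩
  have hNC : ∀ {y z}, Closure R x y z → N y → N z := by
    rintro y z hyz ⟨w, hw, hwy⟩
    exact ⟨w, hw, hwy.trans _ _ _ hyz⟩
  have hval : ∀ y < x + 1, (N y ∧ L' y = x) ∨ (¬ N y ∧ y < x ∧ L' y = L y) := by
    intro y hy
    rcases Nat.lt_succ_iff_lt_or_eq.1 hy with hy' | rfl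
    · by_cases hw : ∃ w < x, R x w ∧ L w = L y
      · rw [hL y hy', if_pos hw]
        obtain ⟨w, hwx, hxw, hwy⟩ := hw
        exact Or.inl ⟨⟨w, Or.inr ⟨hwx, hxw⟩, (hcl w hwx y hy').1 hwy⟩, rfl⟩
      · rw [hL y hy', if_neg hw]
        refine Or.inr ⟨?_, hy', rfl⟩
        rintro ⟨w, rfl | ⟨hwx, hxw⟩, hwy⟩
        · have := hwy.eq_or_lt
          omega
        · exact hw ⟨w, hwx, hxw, (hcl w hwx y hy').2 hwy⟩
    · exact Or.inl ⟨hxN, hx⟩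
  refine ⟨fun y hy => ?_, fun y hy z hz => ?_⟩
  · rcases hval y hy with ⟨-, h⟩ | ⟨-, hy', h⟩
    · omega
    · have := hlt y hy'
      omega
  · rw [closure_succ_iff hR]
    change _ ↔ _ ∨ N y ∧ N z
    rcases hval y hy with ⟨h, he⟩ | ⟨h, hy', he⟩ <;>
      rcases hval z hz with ⟨h', he'⟩ | ⟨h', hz', he'⟩
    · exact ⟨fun _ => Or.inr ⟨h, h'⟩, fun _ => he.trans he'.symm⟩
    · constructor
      · intro hh
        have := hlt z hz'
        omega
      · rintro (hh | hh)
        · exact absurd (hNC hh h) h'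
        · exact absurd hh.2 h'
    · constructor
      · intro hh
        have := hlt y hy'
        omega
      · rintro (hh | hh)
        · exact absurd (hNC (hh.symm _ _) h') h
        · exact absurd hh.1 h
    · rw [he, he', hcl y hy' z hz']
      exact ⟨Or.inl, fun hh => hh.resolve_right fun hh => h hh.1⟩

/-- Label the vertices by the components of the graph defined by `φ` on the variables `d` and
`d + 1`: the vertices are added one by one, and all components joined to a new vertex are
relabelled. The labels are stored in table `0`, and table `3` marks the labels to be replaced. -/
def components (d : ℕ) (φ : Formula) : Program :=
  forLoop d 0 (.seq (forLoop (d + 1) 0 (.seq (.add 4 13 (20 + (d + 1))) (.store 4 1)))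
    (.seq (forLoop (d + 1) (20 + d) (.seq (φ.compile (d + 1 + 1)) (.ifLess 1 3
        (.seq (.add 4 10 (20 + (d + 1))) (.seq (.load 4 4) (.seq (.add 4 13 4) (.store 4 2))))
        .skip)))
    (.seq (.seq (.add 4 10 (20 + d)) (.store 4 (20 + d)))
      (forLoop (d + 1) (20 + d) (.seq (.add 4 10 (20 + (d + 1))) (.seq (.load 5 4)
        (.seq (.add 5 13 5) (.seq (.load 5 5) (.ifLess 1 5 (.store 4 (20 + d)) .skip)))))))))

theorem halts_clearMarks {W n d : ℕ} {ρ : ℕ → ℕ} (hW : n * n + 5 * n + 5 < W) {s : State}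
    (hs : Good W n s) (hE : Env n d ρ s) :
    Halts W (forLoop d 0 (.seq (.add 4 13 (20 + d)) (.store 4 1))) s (n * 4 + 2) fun s' =>
      Good W n s' ∧ Env n d ρ s' ∧ SameOff n 3 s'.mem s.mem ∧
        ∀ l < n, s'.mem (n * n + 3 * n + l) = 0 := by
  refine halts_forLoop (T := 2) (J := fun i m => SameOff n 3 m s.mem ∧
    ∀ l < i, m (n * n + 3 * n + l) = 0) hW (Or.inl ⟨rfl, rfl⟩) ?_ hs hE
    ⟨fun _ _ => rfl, fun x hx => by omega⟩
  rintro i hi r hr hEr ⟨hJ, hJ'⟩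
  have hd := hEr.pop.2
  have hb : r.reg 13 = n * n + 3 * n := hr.base 3 (by omega)
  refine Halts.seq (T := 1) (T' := 1) (halts_add (by omega) (halts_store ?_ ⟨?_, ?_, ?_⟩))
  · rw [reg_setReg_of_ne (by omega), hr.zero]; omega
  · refine (hr.setReg (by omega)).setMem ?_
    rw [reg_setReg_of_ne (by omega), hr.zero]; omega
  · exact hEr.setReg (by omega)
  · rw [mem_setMem, reg_setReg_self, reg_setReg_of_ne (by omega), mem_setReg, hb, hd, hr.zero]
    refine ⟨(SameOff.update hi).trans hJ, fun x hx => ?_⟩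
    by_cases hxi : x = i
    · rw [hxi, Function.update_self]
    · rw [Function.update_of_ne (by omega)]
      exact hJ' x (by omega)

/-- Marking labels rather than vertices lets one pass over the neighbours and one over all earlier
vertices suffice, so a round is linear in `n` for quantifier-free `φ`. -/
theorem halts_setMarks {W n d x : ℕ} {φ : Formula} {E : Interp} {ρ : ℕ → ℕ}
    (hW : n * n + 5 * n + 5 < W) (hwf : φ.WF 0 (d + 1)) {s : State} (hs : Good W n s)
    (hE : Env n d ρ s) {j : ℕ} (hj : j < d) (hx : ρ j = x) (hm : AdjRep n E.adj s.mem)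
    (hlab : ∀ y < x, s.mem (n * n + y) < x)
    (hclear : ∀ l < n, s.mem (n * n + 3 * n + l) = 0) :
    Halts W (forLoop d (20 + j) (.seq (φ.compile (d + 1)) (.ifLess 1 3
        (.seq (.add 4 10 (20 + d)) (.seq (.load 4 4) (.seq (.add 4 13 4) (.store 4 2))))
        .skip))) s (x * (φ.cost n + 7) + 2) fun s' =>
      Good W n s' ∧ Env n d ρ s' ∧ SameOff n 3 s'.mem s.mem ∧
        ∀ l < n, (0 < s'.mem (n * n + 3 * n + l) ↔
          ∃ w < x, φ.eval E n (d + 1) (Function.update ρ d w) ∧ s.mem (n * n + w) = l) := by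
  have hxn : x < n := hx ▸ (hE j hj).2
  refine halts_forLoop (T := φ.cost n + 5) (J := fun i m => SameOff n 3 m s.mem ∧
    ∀ l < n, (0 < m (n * n + 3 * n + l) ↔
      ∃ w < i, φ.eval E n (d + 1) (Function.update ρ d w) ∧ s.mem (n * n + w) = l))
    hW (Or.inr ⟨j, hj, rfl, hx.symm⟩) ?_ hs hE
    ⟨fun _ _ => rfl, fun l hl => by simp [hclear l hl]⟩
  rintro i hi r hr hEr ⟨hJ, hJ'⟩
  have hrep : Rep n 0 E r.mem := ⟨hJ.adjRep hm, fun k hk hk' => by omega, fun h => by omega⟩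
  refine .seq ((φ.decides_compile hW hrep (d + 1) hwf r _ hr rfl hEr).mono le_rfl ?_)
  rintro t ⟨ht, hmem, hEt, hans⟩
  have hd := hEt.pop.2
  have hb : t.reg 13 = n * n + 3 * n := ht.base 3 (by omega)
  have hb0 : t.reg 10 = n * n := by simpa using ht.base 0 (by omega)
  have hl : t.mem (n * n + i) = s.mem (n * n + i) := by
    rw [hmem]
    simpa using hJ.tab (k' := 0) (x := i) (by omega) (by omega)
  have hli := hlab i hi
  refine halts_ifLess (T := 4) (fun h => ?_) (fun h => (halts_skip ?_).mono (by omega) fun _ h => h)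
  · have hφ : φ.eval E n (d + 1) (Function.update ρ d i) := by
      rcases hans with ⟨-, hφ⟩ | ⟨h3, -⟩
      · exact hφ
      · rw [h3] at h; omega
    refine Halts.seq (T := 1) (T' := 3) (halts_add (by omega) (Halts.seq (T := 1) (T' := 2)
      (halts_load (ht.mem_lt _) (Halts.seq (T := 1) (T' := 1) (halts_add ?_ (halts_store ?_
        ⟨?_, ?_, ?_⟩))))))
    · rw [reg_setReg_self, reg_setReg_self, mem_setReg, reg_setReg_of_ne (by omega),
        reg_setReg_of_ne (by omega), hb, hb0, hd, hl]
      omega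
    · rw [reg_setReg_of_ne (by omega), reg_setReg_of_ne (by omega), reg_setReg_of_ne (by omega),
        ht.one]
      omega
    · refine (((ht.setReg (by omega)).setReg (by omega)).setReg (by omega)).setMem ?_
      rw [reg_setReg_of_ne (by omega), reg_setReg_of_ne (by omega), reg_setReg_of_ne (by omega),
        ht.one]
      omega
    · exact ((hEt.setReg (by omega)).setReg (by omega)).setReg (by omega)
    · rw [mem_setMem, reg_setReg_self, reg_setReg_self, reg_setReg_self,
        reg_setReg_of_ne (by omega), reg_setReg_of_ne (by omega), reg_setReg_of_ne (by omega),
        reg_setReg_of_ne (by omega), reg_setReg_of_ne (by omega), mem_setReg, mem_setReg,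
        mem_setReg, hb, hb0, hd, hl, ht.one, hmem]
      refine ⟨(SameOff.update (by omega)).trans hJ, fun l hl => ?_⟩
      by_cases hll : l = s.mem (n * n + i)
      · rw [hll, Function.update_self]
        exact ⟨fun _ => ⟨i, by omega, hφ, rfl⟩, fun _ => one_pos⟩
      · rw [Function.update_of_ne (by omega), hJ' l hl]
        constructor
        · rintro ⟨w, hw, h⟩
          exact ⟨w, by omega, h⟩
        · rintro ⟨w, hw, hw', h⟩
          rcases Nat.lt_succ_iff_lt_or_eq.1 hw with hw | rfl
          · exact ⟨w, hw, hw', h⟩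
          · exact absurd h.symm hll
  · have hφ : ¬ φ.eval E n (d + 1) (Function.update ρ d i) := by
      rcases hans with ⟨h3, -⟩ | ⟨-, hφ⟩
      · rw [h3, ht.zero] at h; omega
      · exact hφ
    refine ⟨ht, hEt, ?_⟩
    rw [hmem]
    refine ⟨hJ, fun l hl => ?_⟩
    rw [hJ' l hl]
    constructor
    · rintro ⟨w, hw, h⟩
      exact ⟨w, by omega, h⟩
    · rintro ⟨w, hw, hw', h⟩
      rcases Nat.lt_succ_iff_lt_or_eq.1 hw with hw | rfl
      · exact ⟨w, hw, hw', h⟩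
      · exact absurd hw' hφ

theorem halts_relabel {W n d x : ℕ} {ρ : ℕ → ℕ} (hW : n * n + 5 * n + 5 < W) {s : State}
    (hs : Good W n s) (hE : Env n d ρ s) {j : ℕ} (hj : j < d) (hx : ρ j = x)
    (hlab : ∀ y < x, s.mem (n * n + y) < x) :
    Halts W (forLoop d (20 + j) (.seq (.add 4 10 (20 + d)) (.seq (.load 5 4)
        (.seq (.add 5 13 5) (.seq (.load 5 5) (.ifLess 1 5 (.store 4 (20 + j)) .skip)))))) s
      (x * 8 + 2) fun s' =>
      Good W n s' ∧ Env n d ρ s' ∧ SameOff n 0 s'.mem s.mem ∧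
        s'.mem (n * n + x) = s.mem (n * n + x) ∧
        ∀ y < x, s'.mem (n * n + y) =
          if 0 < s.mem (n * n + 3 * n + s.mem (n * n + y)) then x else s.mem (n * n + y) := by
  have hxn : x < n := hx ▸ (hE j hj).2
  have hmono : ∀ {s'}, (Good W n s' ∧ Env n d ρ s' ∧ SameOff n 0 s'.mem s.mem ∧
      (∀ y < x, s'.mem (n * n + y) =
        if 0 < s.mem (n * n + 3 * n + s.mem (n * n + y)) then x else s.mem (n * n + y)) ∧
      ∀ y, x ≤ y → y < n → s'.mem (n * n + y) = s.mem (n * n + y)) →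
      Good W n s' ∧ Env n d ρ s' ∧ SameOff n 0 s'.mem s.mem ∧
        s'.mem (n * n + x) = s.mem (n * n + x) ∧
        ∀ y < x, s'.mem (n * n + y) =
          if 0 < s.mem (n * n + 3 * n + s.mem (n * n + y)) then x else s.mem (n * n + y) :=
    fun h => ⟨h.1, h.2.1, h.2.2.1, h.2.2.2.2 x le_rfl hxn, h.2.2.2.1⟩
  -- Labels from position `i` on are still the original ones, so each round reads an old label; the
  -- marks lie in another table and stay fixed.
  refine Halts.mono (halts_forLoop (T := 6) (J := fun i m => SameOff n 0 m s.mem ∧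
    (∀ y < i, m (n * n + y) =
      if 0 < s.mem (n * n + 3 * n + s.mem (n * n + y)) then x else s.mem (n * n + y)) ∧
    ∀ y, i ≤ y → y < n → m (n * n + y) = s.mem (n * n + y))
    hW (Or.inr ⟨j, hj, rfl, hx.symm⟩) ?_ hs hE
    ⟨fun _ _ => rfl, fun y hy => by omega, fun _ _ _ => rfl⟩) le_rfl (fun _ h => hmono h)
  rintro i hi t ht hEt ⟨hJ, hJ', hJ''⟩
  have hd := hEt.pop.2
  have hjx : t.reg (20 + j) = x := by rw [← hx]; exact (hEt.pop.1 j hj).1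
  have hb : t.reg 13 = n * n + 3 * n := ht.base 3 (by omega)
  have hb0 : t.reg 10 = n * n := by simpa using ht.base 0 (by omega)
  have hl : t.mem (n * n + i) = s.mem (n * n + i) := hJ'' i le_rfl (by omega)
  have hli := hlab i hi
  have hmark : t.mem (n * n + 3 * n + s.mem (n * n + i)) =
      s.mem (n * n + 3 * n + s.mem (n * n + i)) := hJ.tab (by omega) (by omega)
  set r := (((t.setReg 4 (n * n + i)).setReg 5 (s.mem (n * n + i))).setReg 5
    (n * n + 3 * n + s.mem (n * n + i))).setReg 5
      (s.mem (n * n + 3 * n + s.mem (n * n + i))) with hr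
  suffices hmain : Halts W (.ifLess 1 5 (.store 4 (20 + j)) .skip) r 2 fun s' => Good W n s' ∧
      Env n (d + 1) (Function.update ρ d i) s' ∧ SameOff n 0 s'.mem s.mem ∧
      (∀ y < i + 1, s'.mem (n * n + y) =
        if 0 < s.mem (n * n + 3 * n + s.mem (n * n + y)) then x else s.mem (n * n + y)) ∧
      ∀ y, i + 1 ≤ y → y < n → s'.mem (n * n + y) = s.mem (n * n + y) by
    refine Halts.seq (T := 1) (T' := 5) (halts_add (by omega) (Halts.seq (T := 1) (T' := 4)
      (halts_load (ht.mem_lt _) (Halts.seq (T := 1) (T' := 3) (halts_add ?_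
        (Halts.seq (T := 1) (T' := 2) (halts_load (ht.mem_lt _) ?_)))))))
    · rw [reg_setReg_self, reg_setReg_self, mem_setReg, reg_setReg_of_ne (by omega),
        reg_setReg_of_ne (by omega), hb, hb0, hd, hl]
      omega
    · rw [reg_setReg_self, reg_setReg_self, reg_setReg_self, mem_setReg, mem_setReg, mem_setReg,
        reg_setReg_of_ne (by omega), reg_setReg_of_ne (by omega), hb, hb0, hd, hl, mem_setReg, hmark]
      exact hmain
  have hrG : Good W n r :=
    (((ht.setReg (by omega)).setReg (by omega)).setReg (by omega)).setReg (by omega)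
  have hrE : Env n (d + 1) (Function.update ρ d i) r :=
    (((hEt.setReg (by omega)).setReg (by omega)).setReg (by omega)).setReg (by omega)
  have hr5 : r.reg 5 = s.mem (n * n + 3 * n + s.mem (n * n + i)) := reg_setReg_self
  have hr4 : r.reg 4 = n * n + i := by
    rw [hr, reg_setReg_of_ne (by omega), reg_setReg_of_ne (by omega), reg_setReg_of_ne (by omega),
      reg_setReg_self]
  have hrj : r.reg (20 + j) = x := by
    rw [hr, reg_setReg_of_ne (by omega), reg_setReg_of_ne (by omega), reg_setReg_of_ne (by omega),
      reg_setReg_of_ne (by omega), hjx]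
  have hrm : r.mem = t.mem := rfl
  refine halts_ifLess (T := 1) (fun h => halts_store (by omega) ⟨hrG.setMem (by omega), hrE, ?_⟩)
    (fun h => halts_skip ⟨hrG, hrE, ?_⟩)
  · rw [hrG.zero, hr5] at h
    rw [mem_setMem, hr4, hrj, hrm]
    have hup : SameOff n 0 (Function.update t.mem (n * n + i) x) t.mem := by
      simpa using SameOff.update (n := n) (k := 0) (x := i) (v := x) (m := t.mem) (by omega)
    refine ⟨hup.trans hJ, fun y hy => ?_, fun y hy hyn => ?_⟩
    · by_cases hyi : y = i
      · subst hyi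
        rw [Function.update_self, if_pos h]
      · rw [Function.update_of_ne (by omega)]
        exact hJ' y (by omega)
    · rw [Function.update_of_ne (by omega)]
      exact hJ'' y (by omega) hyn
  · rw [hrG.zero, hr5] at h
    rw [hrm]
    refine ⟨hJ, fun y hy => ?_, fun y hy hyn => hJ'' y (by omega) hyn⟩
    rcases Nat.lt_succ_iff_lt_or_eq.1 hy with hy | rfl
    · exact hJ' y hy
    · rw [if_neg h, hl]

/-- The label invariant is vacuous for zero vertices, so whatever an earlier run left in the label
and mark tables is harmless. -/
theorem halts_components {W n d : ℕ} {φ : Formula} {E : Interp} {ρ : ℕ → ℕ}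
    {R : ℕ → ℕ → Prop} (hW : n * n + 5 * n + 5 < W) (hwf : φ.WF 0 (d + 1 + 1))
    (hφ : ∀ x y, R x y ↔
      φ.eval E n (d + 1 + 1) (Function.update (Function.update ρ d x) (d + 1) y))
    (hR : ∀ x y, R x y → R y x) {s : State}
    (hs : Good W n s) (hE : Env n d ρ s) (hm : AdjRep n E.adj s.mem) :
    Halts W (components d φ) s (n * (n * 4 + n * (φ.cost n + 7) + n * 8 + 10) + 2) fun s' =>
      Good W n s' ∧ Env n d ρ s' ∧ AdjRep n E.adj s'.mem ∧
        ∀ y < n, ∀ z < n, (s'.mem (n * n + y) = s'.mem (n * n + z) ↔ Closure R n y z) := by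
  classical
  refine Halts.mono (halts_forLoop (T := n * 4 + n * (φ.cost n + 7) + n * 8 + 8)
    (J := fun x m => AdjRep n E.adj m ∧ Labels R x fun y => m (n * n + y))
    hW (Or.inl ⟨rfl, rfl⟩) ?_ hs hE
    ⟨hm, fun y hy => by omega, fun y hy => by omega⟩) le_rfl
    fun s' h => ⟨h.1, h.2.1, h.2.2.1, h.2.2.2.2⟩
  rintro x hx r hr hEr ⟨hmr, hlab⟩
  have hlt : ∀ y < x, r.mem (n * n + y) < x := hlab.1
  have hmul : ∀ c, x * c ≤ n * c := fun c => Nat.mul_le_mul_right c hx.le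
  have h1 := hmul (φ.cost n + 7)
  refine Halts.mono (T := (n * 4 + 2) + ((x * (φ.cost n + 7) + 2) + (2 + (x * 8 + 2))))
    (.seq ((halts_clearMarks hW hr hEr).mono le_rfl ?_)) (by omega) fun _ h => h
  rintro r₁ ⟨hr₁, hE₁, hoff₁, hclear⟩
  have hsame : ∀ {m m' : ℕ → ℕ}, SameOff n 3 m m' → ∀ y < n, m (n * n + y) = m' (n * n + y) := by
    intro m m' h y hy
    simpa using h.tab (k' := 0) (x := y) (by omega) hy
  have hl₁ := hsame hoff₁
  refine .seq ((halts_setMarks (E := E) hW hwf hr₁ hE₁ (j := d) (by omega) (x := x)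
    (Function.update_self _ _ _) (hoff₁.adjRep hmr)
    (fun y hy => by rw [hl₁ y (by omega)]; exact hlt y hy) hclear).mono le_rfl ?_)
  rintro r₂ ⟨hr₂, hE₂, hoff₂, hmark⟩
  have hl₂ : ∀ y < n, r₂.mem (n * n + y) = r.mem (n * n + y) := fun y hy =>
    (hsame hoff₂ y hy).trans (hl₁ y hy)
  have hd : r₂.reg (20 + d) = x := hE₂.pop.2
  have hb0 : r₂.reg 10 = n * n := by simpa using hr₂.base 0 (by omega)
  set r₃ := (r₂.setReg 4 (n * n + x)).setMem (n * n + x) x with hr₃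
  have hmem₃ : r₃.mem = Function.update r₂.mem (n * n + x) x := rfl
  have hoff₃ : SameOff n 0 r₃.mem r₂.mem := by
    rw [hmem₃]
    simpa using SameOff.update (n := n) (k := 0) (x := x) (v := x) (m := r₂.mem) hx
  have hl₃ : ∀ y < x, r₃.mem (n * n + y) = r.mem (n * n + y) := by
    intro y hy
    rw [hmem₃, Function.update_of_ne (by omega), hl₂ y (by omega)]
  have hG₃ : Good W n r₃ := (hr₂.setReg (by omega)).setMem (by omega)
  have hE₃ : Env n (d + 1) (Function.update ρ d x) r₃ := hE₂.setReg (by omega)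
  refine .seq (Halts.seq (T := 1) (T' := 1) (halts_add (by omega) (halts_store ?_ ?_)))
  · rw [reg_setReg_of_ne (by omega)]; omega
  rw [reg_setReg_self, reg_setReg_of_ne (by omega), hb0, hd]
  refine (halts_relabel hW hG₃ hE₃ (j := d) (by omega) (x := x) (Function.update_self _ _ _)
    fun y hy => by rw [hl₃ y hy]; exact hlt y hy).mono le_rfl ?_
  rintro r₄ ⟨hr₄, hE₄, hoff₄, hx₄, hl₄⟩
  refine ⟨hr₄, hE₄, hoff₄.adjRep (hoff₃.adjRep (hoff₂.adjRep (hoff₁.adjRep hmr))),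
    hlab.succ (fun a _ b _ => hR a b) ?_ fun y hy => ?_⟩
  · rw [hx₄, hmem₃, Function.update_self]
  · have hly := hlt y hy
    change r₄.mem (n * n + y) = _
    rw [hl₄ y hy, hl₃ y hy, hoff₃.tab (by omega) (by omega)]
    congr 1
    rw [hmark _ (by omega)]
    refine propext (exists_congr fun w => and_congr_right fun hw => ?_)
    rw [hl₁ w (by omega), hφ x w]

end WordRAM

namespace WordRAM

/-! ### The search program -/

/-- The symbols available after the components and both tables have been computed. -/
def blockConn (A : ℕ → ℕ → Prop) (n : ℕ) (φ₀ : Formula) (ρ : ℕ → ℕ) : ℕ → ℕ → Prop :=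
  Closure (fun x y => φ₀.eval ⟨A, fun _ _ => False, fun _ _ => False⟩ n 9
    (Function.update (Function.update ρ 7 x) 8 y)) n

/-- The interpretation in which the tables are evaluated. -/
def tableInterp (A : ℕ → ℕ → Prop) (n : ℕ) (φ₀ : Formula) (ρ : ℕ → ℕ) : Interp :=
  ⟨A, fun _ _ => False, blockConn A n φ₀ ρ⟩

/-- The interpretation in which the final query is evaluated. -/
def blockInterp (A : ℕ → ℕ → Prop) (n : ℕ) (φ₀ φ₁ φ₂ : Formula) (ρ : ℕ → ℕ) : Interp :=
  ⟨A, fun k x => if k = 1 then φ₁.eval (tableInterp A n φ₀ ρ) n 8 (Function.update ρ 7 x)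
    else φ₂.eval (tableInterp A n φ₀ ρ) n 8 (Function.update ρ 7 x), blockConn A n φ₀ ρ⟩

/-- Compute the components of the graph defined by `φ₀`, the tables defined by `φ₁` and `φ₂`, and
then the truth value of `ψ`. -/
def block (φ₀ φ₁ φ₂ ψ : Formula) : Program :=
  .seq (components 7 φ₀) (.seq (tabulate 1 7 φ₁) (.seq (tabulate 2 7 φ₂) (ψ.compile 7)))

/-- A bound for the running time of a block. -/
def blockCost (n : ℕ) (φ₀ φ₁ φ₂ ψ : Formula) : ℕ :=
  (n * (n * 4 + n * (φ₀.cost n + 7) + n * 8 + 10) + 2) +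
    ((n * (φ₁.cost n + 4) + 2) + ((n * (φ₂.cost n + 4) + 2) + ψ.cost n))

/-- Only the adjacency matrix has to survive from one guess to the next; components and tables are
recomputed for each guess, and each stage reads only what is already in place. -/
theorem decides_block {W n : ℕ} {φ₀ φ₁ φ₂ ψ : Formula} {A : ℕ → ℕ → Prop}
    (hW : n * n + 5 * n + 5 < W) (h₀ : φ₀.WF 0 9) (h₁ : φ₁.WF 1 8) (h₂ : φ₂.WF 1 8)
    (hψ : ψ.WF 3 7)
    (hsymm : ∀ (ρ : ℕ → ℕ) x y, φ₀.eval ⟨A, fun _ _ => False, fun _ _ => False⟩ n 9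
      (Function.update (Function.update ρ 7 x) 8 y) →
        φ₀.eval ⟨A, fun _ _ => False, fun _ _ => False⟩ n 9
          (Function.update (Function.update ρ 7 y) 8 x)) :
    Decides W n 7 (AdjRep n A) (block φ₀ φ₁ φ₂ ψ) (blockCost n φ₀ φ₁ φ₂ ψ)
      (fun ρ => ψ.eval (blockInterp A n φ₀ φ₁ φ₂ ρ) n 7 ρ) := by
  intro s ρ hs hJ hE
  refine .seq ((halts_components (E := ⟨A, fun _ _ => False, fun _ _ => False⟩) hW h₀
    (fun x y => Iff.rfl) (hsymm ρ) hs hE hJ).mono le_rfl ?_)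
  rintro s₁ ⟨hs₁, hE₁, hA₁, hconn₁⟩
  have hrep₁ : Rep n 1 (tableInterp A n φ₀ ρ) s₁.mem :=
    ⟨hA₁, fun k hk hk' => by omega, fun _ x hx y hy => (hconn₁ x hx y hy).symm⟩
  refine .seq ((halts_tabulate hW (by omega) le_rfl h₁ hs₁ hE₁ hrep₁).mono le_rfl ?_)
  rintro s₂ ⟨hs₂, hE₂, hoff₂, htab₂⟩
  have hrep₂ := hoff₂.rep le_rfl hrep₁
  refine .seq ((halts_tabulate hW (by omega) (by omega) h₂ hs₂ hE₂ hrep₂).mono le_rfl ?_)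
  rintro s₃ ⟨hs₃, hE₃, hoff₃, htab₃⟩
  have hrep₃ := hoff₃.rep (by omega) hrep₂
  have hrep : Rep n 3 (blockInterp A n φ₀ φ₁ φ₂ ρ) s₃.mem := by
    refine ⟨hrep₃.adj, fun k hk hk' x hx => ?_, fun _ => hrep₃.conn le_rfl⟩
    obtain rfl | rfl : k = 1 ∨ k = 2 := by omega
    · rw [hoff₃.tab (by omega) hx]
      exact (htab₂ x hx).symm
    · exact (htab₃ x hx).symm
  refine (ψ.decides_compile hW hrep 7 hψ s₃ ρ hs₃ rfl hE₃).mono le_rfl ?_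
  rintro s₄ ⟨hs₄, hmem, hE₄, hans⟩
  exact ⟨hs₄, hmem ▸ hrep.adj, hE₄, hans⟩

/-- Tabulating the inner searches over components is what keeps the final query at two quantifiers;
nested inside it they would cost a third factor `n`. -/
theorem exists_blockCost_le (φ₀ φ₁ φ₂ ψ : Formula) (h₀ : φ₀.depth ≤ 0) (h₁ : φ₁.depth ≤ 1)
    (h₂ : φ₂.depth ≤ 1) (hψ : ψ.depth ≤ 2) :
    ∃ C, ∀ n, blockCost n φ₀ φ₁ φ₂ ψ ≤ C * (n + 1) ^ 2 := by
  obtain ⟨C₀, hC₀⟩ := φ₀.exists_cost_le 0 h₀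
  obtain ⟨C₁, hC₁⟩ := φ₁.exists_cost_le 1 h₁
  obtain ⟨C₂, hC₂⟩ := φ₂.exists_cost_le 1 h₂
  obtain ⟨C, hC⟩ := ψ.exists_cost_le 2 hψ
  refine ⟨C₀ + 37 + (C₁ + 6) + (C₂ + 6) + C, fun n => ?_⟩
  have hn : n ≤ n + 1 := Nat.le_succ n
  have hsq : (n + 1) ^ 2 = (n + 1) * (n + 1) := sq _
  have hc₀ : φ₀.cost n ≤ C₀ := by simpa using hC₀ n
  have hc₁ : φ₁.cost n ≤ C₁ * (n + 1) := by simpa using hC₁ n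
  have hc₂ : φ₂.cost n ≤ C₂ * (n + 1) := by simpa using hC₂ n
  have hone : 1 ≤ (n + 1) * (n + 1) := Nat.mul_pos n.succ_pos n.succ_pos
  have htab : ∀ c C, c ≤ C * (n + 1) → n * (c + 4) + 2 ≤ (C + 6) * (n + 1) ^ 2 := by
    intro c C hc
    rw [hsq]
    calc n * (c + 4) + 2 ≤ (n + 1) * (C * (n + 1) + 4 * (n + 1)) + 2 * ((n + 1) * (n + 1)) :=
          Nat.add_le_add (Nat.mul_le_mul hn (by omega)) (by omega)
      _ = (C + 6) * ((n + 1) * (n + 1)) := by ring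
  have hcomp : n * (n * 4 + n * (φ₀.cost n + 7) + n * 8 + 10) + 2 ≤
      (C₀ + 37) * (n + 1) ^ 2 := by
    have h1 : n * (φ₀.cost n + 7) ≤ (n + 1) * (C₀ + 7) := Nat.mul_le_mul hn (by omega)
    rw [hsq]
    calc n * (n * 4 + n * (φ₀.cost n + 7) + n * 8 + 10) + 2 ≤
          (n + 1) * ((n + 1) * 4 + (n + 1) * (C₀ + 7) + (n + 1) * 8 + 10 * (n + 1)) +
            2 * ((n + 1) * (n + 1)) :=
          Nat.add_le_add (Nat.mul_le_mul hn (by omega)) (by omega)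
      _ = (C₀ + 31) * ((n + 1) * (n + 1)) := by ring
      _ ≤ (C₀ + 37) * ((n + 1) * (n + 1)) := Nat.mul_le_mul_right _ (by omega)
  have h1 := htab _ _ hc₁
  have h2 := htab _ _ hc₂
  have h3 := hC n
  simp only [blockCost]
  rw [Nat.add_mul, Nat.add_mul, Nat.add_mul]
  omega

/-- The program `p` inside loops over the variables `0, …, d - 1`. -/
def exLoops : ℕ → Program → Program
  | 0, p => p
  | d + 1, p => exLoops d (exLoop d p)

/-- The property decided by `exLoops`. -/
def Exists (n : ℕ) : ℕ → ((ℕ → ℕ) → Prop) → (ℕ → ℕ) → Prop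
  | 0, φ => φ
  | d + 1, φ => Exists n d fun ρ => ∃ x < n, φ (Function.update ρ d x)

/-- The constant is chosen before `n`, `W` and the property, so it is uniform over all inputs; each
loop raises the exponent by one. -/
theorem exists_decides_exLoops {p : Program} {T : ℕ → ℕ} {C q : ℕ} (d : ℕ)
    (hT : ∀ n, T n ≤ C * (n + 1) ^ q) :
    ∃ C', ∀ W n J φ, n * n + 5 * n + 5 < W → Decides W n d J p (T n) φ →
      Decides W n 0 J (exLoops d p) (C' * (n + 1) ^ (q + d)) (Exists n d φ) := by
  induction d generalizing p T C q with
  | zero => exact ⟨C, fun W n J φ _ h => h.mono (hT n)⟩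
  | succ d ih =>
    obtain ⟨C', hC'⟩ := ih (p := exLoop d p) (T := fun n => n * (T n + 3) + 3) (C := C + 3)
      (q := q + 1) (fun n => by
        have h1 : 1 ≤ (n + 1) ^ q := Nat.pow_pos n.succ_pos
        calc n * (T n + 3) + 3 ≤ (n + 1) * (T n + 3) := by rw [Nat.succ_mul]; omega
          _ ≤ (n + 1) * ((C + 3) * (n + 1) ^ q) := by
              refine Nat.mul_le_mul_left _ ?_
              have := hT n
              rw [Nat.add_mul]
              omega
          _ = (C + 3) * (n + 1) ^ (q + 1) := by ring)
    refine ⟨C', fun W n J φ hW h => ?_⟩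
    have := hC' W n J _ hW (h.exLoop hW)
    rwa [show q + 1 + d = q + (d + 1) by omega] at this

theorem exists_lt_iff_fin {n : ℕ} {P : ℕ → Prop} : (∃ x < n, P x) ↔ ∃ x : Fin n, P x :=
  ⟨fun ⟨x, hx, h⟩ => ⟨⟨x, hx⟩, h⟩, fun ⟨x, h⟩ => ⟨x, x.2, h⟩⟩

/-! ### The queries for the two tests -/

/-- The adjacency relation of `G` on natural numbers. -/
def natAdj {n : ℕ} (G : SimpleGraph (Fin n)) (x y : ℕ) : Prop :=
  ∃ (hx : x < n) (hy : y < n), G.Adj ⟨x, hx⟩ ⟨y, hy⟩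

theorem natAdj_coe {n : ℕ} (G : SimpleGraph (Fin n)) (x y : Fin n) :
    natAdj G x y ↔ G.Adj x y :=
  ⟨fun ⟨_, _, h⟩ => h, fun h => ⟨x.2, y.2, h⟩⟩

theorem natAdj_symm {n : ℕ} {G : SimpleGraph (Fin n)} {x y : ℕ} (h : natAdj G x y) :
    natAdj G y x := by
  obtain ⟨hx, hy, h⟩ := h
  exact ⟨hy, hx, h.symm⟩

/-- A chain between numbers below `n` stays below `n` by `Closure.eq_or_lt`, so it lifts to `Fin n`.
-/
theorem closure_iff_linked {n : ℕ} {G : SimpleGraph (Fin n)} {U : Fin n → Prop}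
    {R : ℕ → ℕ → Prop} (hR : ∀ x y : Fin n, R x y ↔ G.Adj x y ∧ U x ∧ U y) (x y : Fin n) :
    Closure R n x y ↔ Linked G U x y := by
  constructor
  · suffices ∀ a b : ℕ, Closure R n a b → ∀ (ha : a < n) (hb : b < n),
        Linked G U ⟨a, ha⟩ ⟨b, hb⟩ from fun h => this x y h x.2 y.2
    intro a b h
    induction h with
    | rel a b h => exact fun ha hb => .rel _ _ ((hR ⟨a, ha⟩ ⟨b, hb⟩).1 h.2.2)
    | refl a => exact fun ha hb => .refl _
    | symm a b _ ih => exact fun ha hb => (ih hb ha).symm _ _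
    | trans a b c h h' ih ih' =>
      intro ha hc
      rcases Closure.eq_or_lt h with rfl | hb
      · exact ih' ha hc
      · exact (ih ha hb.2).trans _ _ _ (ih' hb.2 hc)
  · intro h
    induction h with
    | rel x y h => exact .rel _ _ ⟨x.2, y.2, (hR x y).2 h⟩
    | refl x => exact .refl _
    | symm x y _ ih => exact ih.symm _ _
    | trans x y z _ _ ih ih' => exact ih.trans _ _ _ ih'

namespace Formula

/-- Disjunction. -/
def or (φ ψ : Formula) : Formula := not (and (not φ) (not ψ))

theorem eval_or {E : Interp} {n d : ℕ} {φ ψ : Formula} {ρ : ℕ → ℕ} :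
    (or φ ψ).eval E n d ρ ↔ φ.eval E n d ρ ∨ ψ.eval E n d ρ := by
  simp only [or, eval]
  tauto

/-- The relation `IsFree` for the variables `x, y, z, a₁, a₂ = 0, …, 4`. -/
def free (i : ℕ) : Formula :=
  and (and (not (eq i 0)) (and (not (eq i 1)) (and (not (eq i 2)) (and (not (eq i 3))
    (not (eq i 4))))))
    (and (not (adj i 0)) (and (not (adj i 1)) (and (not (adj i 2)) (and (not (adj i 3))
      (not (adj i 4))))))

/-- The relation `SmallRest` for the variables `x, y, z, a₁, a₂, b₁, b₂ = 0, …, 6`. -/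
def smallRest (i : ℕ) : Formula :=
  and (free i) (and (not (eq i 5)) (not (eq i 6)))

/-- Adjacency to one of the variables `0`, `1`, `2`. -/
def touch (i : ℕ) : Formula := or (adj i 0) (or (adj i 1) (adj i 2))

/-- The graph on the vertices satisfying `smallRest`. -/
def smallGraph : Formula := and (adj 7 8) (and (smallRest 7) (smallRest 8))

/-- The component of the variable `7` contains a neighbour of the variable `b`. -/
def smallTable (b : ℕ) : Formula := ex (and (conn 7 8) (adj 8 b))

/-- The query deciding `SmallTest`. -/
def smallQuery : Formula :=
  and (and (or (eq 0 1) (adj 0 1)) (or (eq 1 2) (adj 1 2)))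
  (and (and (touch 3) (touch 4))
  (and (and (and (not (eq 3 0)) (and (not (eq 3 1)) (not (eq 3 2))))
    (and (not (eq 4 0)) (and (not (eq 4 1)) (not (eq 4 2)))))
  (and (and (and (not (eq 3 4)) (not (adj 3 4))) (and (not (eq 5 6)) (not (adj 5 6))))
  (and (and (free 5) (free 6))
  (ex (ex (and (touch 7)
    (and (and (not (adj 7 3)) (and (not (adj 7 4)) (and (not (adj 7 5)) (not (adj 7 6)))))
    (and (adj 7 8) (and (smallRest 8) (and (tab 1 8) (tab 2 8))))))))))))

/-- The relation `HubZone` for the variables `c, a₁, a₂, b₁, b₂, v, w = 0, …, 6`. -/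
def hubZone (i : ℕ) : Formula :=
  or (eq i 5) (or (eq i 6) (and (adj 0 i)
    (and (and (not (adj 1 i)) (and (not (adj 2 i)) (and (not (adj 3 i)) (not (adj 4 i)))))
      (not (and (adj 5 i) (adj 6 i))))))

/-- The graph on the vertices satisfying `hubZone`. -/
def hubGraph : Formula := and (adj 7 8) (and (hubZone 7) (hubZone 8))

/-- The relation `HubLast` for the variable `7`. -/
def hubTable (a b₁ b₂ v w : ℕ) : Formula :=
  and (and (adj 0 7) (and (adj a 7) (and (not (adj b₁ 7)) (not (adj b₂ 7)))))
    (and (ex (and (conn v 8) (adj 7 8))) (not (ex (and (conn w 8) (adj 7 8)))))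

/-- The query deciding `HubTest`. -/
def hubQuery : Formula :=
  and (and (adj 0 5) (and (adj 1 5) (and (not (adj 2 5)) (and (not (adj 3 5)) (not (adj 4 5))))))
  (and (and (adj 0 6) (and (adj 3 6) (and (not (adj 4 6)) (and (not (adj 1 6)) (not (adj 2 6))))))
  (and (and (not (adj 0 1)) (and (not (adj 0 2)) (and (not (adj 0 3)) (not (adj 0 4)))))
  (and (and (not (adj 1 2)) (not (adj 3 4)))
  (and (and (not (adj 1 3)) (and (not (adj 1 4)) (and (not (adj 2 3)) (not (adj 2 4)))))
  (and (not (conn 5 6))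
  (ex (ex (and (tab 1 7) (and (tab 2 8) (not (adj 7 8)))))))))))

end Formula

open Formula

theorem eval_smallQuery {n : ℕ} (G : SimpleGraph (Fin n)) {ρ : ℕ → ℕ}
    {x y z a₁ a₂ b₁ b₂ : Fin n} (h0 : ρ 0 = x) (h1 : ρ 1 = y) (h2 : ρ 2 = z) (h3 : ρ 3 = a₁)
    (h4 : ρ 4 = a₂) (h5 : ρ 5 = b₁) (h6 : ρ 6 = b₂) :
    smallQuery.eval (blockInterp (natAdj G) n smallGraph (smallTable 5) (smallTable 6) ρ) n 7 ρ ↔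
      SmallTest G x y z a₁ a₂ b₁ b₂ := by
  have hconn : ∀ p q : Fin n, blockConn (natAdj G) n smallGraph ρ p q ↔
      Linked G (SmallRest G x y z a₁ a₂ b₁ b₂) p q := by
    refine closure_iff_linked fun p q => ?_
    simp [smallGraph, smallRest, free, eval, SmallRest, IsFree, natAdj_coe, h0, h1, h2, h3, h4, h5,
      h6, Fin.val_inj]
  simp [smallQuery, smallRest, free, touch, smallTable, eval, eval_or, blockInterp, tableInterp,
    exists_lt_iff_fin, hconn, natAdj_coe, h0, h1, h2, h3, h4, h5, h6, Fin.val_inj,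
    SmallTest, SmallRest, IsFree]

theorem eval_hubQuery {n : ℕ} (G : SimpleGraph (Fin n)) {ρ : ℕ → ℕ}
    {c a₁ a₂ b₁ b₂ v w : Fin n} (h0 : ρ 0 = c) (h1 : ρ 1 = a₁) (h2 : ρ 2 = a₂) (h3 : ρ 3 = b₁)
    (h4 : ρ 4 = b₂) (h5 : ρ 5 = v) (h6 : ρ 6 = w) :
    hubQuery.eval (blockInterp (natAdj G) n hubGraph (hubTable 2 3 4 5 6) (hubTable 4 1 2 6 5) ρ)
      n 7 ρ ↔ HubTest G c a₁ a₂ b₁ b₂ v w := by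
  have hconn : ∀ p q : Fin n, blockConn (natAdj G) n hubGraph ρ p q ↔
      Linked G (HubZone G c a₁ a₂ b₁ b₂ v w) p q := by
    refine closure_iff_linked fun p q => ?_
    simp [hubGraph, hubZone, eval, eval_or, HubZone, HubRest, natAdj_coe, h0, h1, h2, h3, h4, h5,
      h6, Fin.val_inj]
  simp [hubQuery, hubTable, eval, blockInterp, tableInterp,
    exists_lt_iff_fin, hconn, natAdj_coe, h0, h1, h2, h3, h4, h5, h6,
    HubTest, HubLast]

end WordRAM

/-! ### The complete decision program, its correctness and its running time -/

namespace WordRAM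

open Formula

/-- The program deciding whether the input graph has `graphH2` as an induced minor. -/
def h2Program : Program :=
  .seq (.seq (.const 2 1) (.seq (.mul 10 0 0) (.seq (.add 11 10 0) (.seq (.add 12 11 0)
    (.add 13 12 0)))))
  (.seq (exLoops 7 (block smallGraph (smallTable 5) (smallTable 6) smallQuery))
  (.seq (.ifLess 1 3 .skip (exLoops 7 (block hubGraph (hubTable 2 3 4 5 6) (hubTable 4 1 2 6 5)
    hubQuery))) (.add 0 3 1)))

theorem adjRep_initialState {n : ℕ} (G : SimpleGraph (Fin n)) :
    AdjRep n (natAdj G) (initialState G).mem := by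
  intro x hx y hy
  have hiff : natAdj G x y ↔ ∃ i j : Fin n, x * n + y = (i : ℕ) * n + (j : ℕ) ∧ G.Adj i j := by
    constructor
    · rintro ⟨hx, hy, h⟩
      exact ⟨⟨x, hx⟩, ⟨y, hy⟩, rfl, h⟩
    · rintro ⟨i, j, he, h⟩
      -- Row-major addresses decode uniquely: the remainder modulo `n` is the column.
      have hy' : y = j := by
        have := congrArg (· % n) he
        simpa [Nat.add_mod, Nat.mod_eq_of_lt hy, Nat.mod_eq_of_lt j.2] using this
      have hx' : x = i := by
        rw [hy', Nat.add_right_cancel_iff] at he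
        exact Nat.eq_of_mul_eq_mul_right (by omega) he
      subst hx'
      subst hy'
      exact ⟨i.2, j.2, h⟩
  rw [hiff]
  simp only [initialState]
  split_ifs with h
  · exact ⟨fun _ => one_pos, fun _ => h⟩
  · exact ⟨fun h' => absurd h' h, fun h' => absurd h' (lt_irrefl 0)⟩

theorem halts_prologue {W n : ℕ} (hW : n * n + 5 * n + 5 < W) (G : SimpleGraph (Fin n)) :
    Halts W (.seq (.const 2 1) (.seq (.mul 10 0 0) (.seq (.add 11 10 0) (.seq (.add 12 11 0)
      (.add 13 12 0))))) (initialState G) 5 fun s =>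
        Good W n s ∧ s.mem = (initialState G).mem := by
  have h0 : (initialState G).reg 0 = n := rfl
  refine Halts.seq (T := 1) (T' := 4) (halts_const (by omega) (Halts.seq (T := 1) (T' := 3)
    (halts_mul ?_ (Halts.seq (T := 1) (T' := 2) (halts_add ?_ (Halts.seq (T := 1) (T' := 1)
      (halts_add ?_ (halts_add ?_ ⟨⟨?_, ?_, ?_, fun k hk => ?_, fun a => ?_⟩, rfl⟩))))))))
  · rw [reg_setReg_of_ne (by omega), h0]; omega
  · simp [State.setReg, h0]; omega
  · simp [State.setReg, h0]; omega
  · simp [State.setReg, h0]; omega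
  · simp [State.setReg, h0]
  · simp [State.setReg, initialState]
  · simp [State.setReg]
  · interval_cases k <;> simp [State.setReg, h0] <;> omega
  · simp only [State.setReg, initialState]
    split_ifs <;> omega

theorem exists_iff_smallTest {n : ℕ} (G : SimpleGraph (Fin n)) (ρ : ℕ → ℕ) :
    Exists n 7 (fun ρ => smallQuery.eval
      (blockInterp (natAdj G) n smallGraph (smallTable 5) (smallTable 6) ρ) n 7 ρ) ρ ↔
      ∃ x y z a₁ a₂ b₁ b₂, SmallTest G x y z a₁ a₂ b₁ b₂ := by
  simp only [Exists, exists_lt_iff_fin]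
  refine exists_congr fun x => exists_congr fun y => exists_congr fun z => exists_congr fun a₁ =>
    exists_congr fun a₂ => exists_congr fun b₁ => exists_congr fun b₂ => ?_
  apply eval_smallQuery <;> simp

theorem exists_iff_hubTest {n : ℕ} (G : SimpleGraph (Fin n)) (ρ : ℕ → ℕ) :
    Exists n 7 (fun ρ => hubQuery.eval (blockInterp (natAdj G) n hubGraph (hubTable 2 3 4 5 6)
      (hubTable 4 1 2 6 5) ρ) n 7 ρ) ρ ↔
      ∃ c a₁ a₂ b₁ b₂ v w, HubTest G c a₁ a₂ b₁ b₂ v w := by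
  simp only [Exists, exists_lt_iff_fin]
  refine exists_congr fun c => exists_congr fun a₁ => exists_congr fun a₂ => exists_congr fun b₁ =>
    exists_congr fun b₂ => exists_congr fun v => exists_congr fun w => ?_
  apply eval_hubQuery <;> simp

theorem exists_decides_small : ∃ C, ∀ (n W : ℕ) (G : SimpleGraph (Fin n)),
    n * n + 5 * n + 5 < W → Decides W n 0 (AdjRep n (natAdj G))
      (exLoops 7 (block smallGraph (smallTable 5) (smallTable 6) smallQuery)) (C * (n + 1) ^ 9)
      fun _ => ∃ x y z a₁ a₂ b₁ b₂, SmallTest G x y z a₁ a₂ b₁ b₂ := by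
  obtain ⟨C, hC⟩ := exists_blockCost_le smallGraph (smallTable 5) (smallTable 6) smallQuery
    (by decide) (by decide) (by decide) (by decide)
  obtain ⟨C', hC'⟩ := exists_decides_exLoops
    (p := block smallGraph (smallTable 5) (smallTable 6) smallQuery) 7 hC
  refine ⟨C', fun n W G hW => ?_⟩
  have hdec := hC' W n _ _ hW (decides_block (φ₀ := smallGraph) (φ₁ := smallTable 5)
    (φ₂ := smallTable 6) (ψ := smallQuery) (A := natAdj G) hW
    (by simp [smallGraph, smallRest, free, WF])
    (by simp [smallTable, WF]) (by simp [smallTable, WF])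
    (by simp [smallQuery, smallRest, free, touch, Formula.or, WF]) ?_)
  · rwa [funext fun ρ => propext (exists_iff_smallTest G ρ)] at hdec
  · intro ρ x y
    simp only [smallGraph, smallRest, free, eval]
    have hs := @natAdj_symm n G x y
    simp
    tauto

theorem exists_decides_hub : ∃ C, ∀ (n W : ℕ) (G : SimpleGraph (Fin n)),
    n * n + 5 * n + 5 < W → Decides W n 0 (AdjRep n (natAdj G))
      (exLoops 7 (block hubGraph (hubTable 2 3 4 5 6) (hubTable 4 1 2 6 5) hubQuery))
      (C * (n + 1) ^ 9) fun _ => ∃ c a₁ a₂ b₁ b₂ v w, HubTest G c a₁ a₂ b₁ b₂ v w := by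
  obtain ⟨C, hC⟩ := exists_blockCost_le hubGraph (hubTable 2 3 4 5 6) (hubTable 4 1 2 6 5) hubQuery
    (by decide) (by decide) (by decide) (by decide)
  obtain ⟨C', hC'⟩ := exists_decides_exLoops
    (p := block hubGraph (hubTable 2 3 4 5 6) (hubTable 4 1 2 6 5) hubQuery) 7 hC
  refine ⟨C', fun n W G hW => ?_⟩
  have hdec := hC' W n _ _ hW (decides_block (φ₀ := hubGraph) (φ₁ := hubTable 2 3 4 5 6)
    (φ₂ := hubTable 4 1 2 6 5) (ψ := hubQuery) (A := natAdj G) hW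
    (by simp [hubGraph, hubZone, Formula.or, WF])
    (by simp [hubTable, WF]) (by simp [hubTable, WF]) (by simp [hubQuery, WF]) ?_)
  · rwa [funext fun ρ => propext (exists_iff_hubTest G ρ)] at hdec
  · intro ρ x y
    simp only [hubGraph, hubZone, eval, eval_or]
    have hs := @natAdj_symm n G x y
    simp
    tauto

end WordRAM

open WordRAM in
theorem exists_h2Program_spec : ∃ C, ∀ (n : ℕ) (G : SimpleGraph (Fin n)),
    Halts ((n + 2) ^ 4) h2Program (initialState G) (C * (n + 1) ^ 9) fun s =>
      (HasInducedMinor graphH2 G → s.reg 0 = 1) ∧ (¬ HasInducedMinor graphH2 G → s.reg 0 = 0) := by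
  obtain ⟨C₁, hC₁⟩ := exists_decides_small
  obtain ⟨C₂, hC₂⟩ := exists_decides_hub
  refine ⟨C₁ + C₂ + 8, fun n G => ?_⟩
  -- The square of `n + 2` is just too small for this bound; the fourth power leaves ample room.
  have hW : n * n + 5 * n + 5 < (n + 2) ^ 4 := by
    have : (n + 2) ^ 4 = n * n + 5 * n + 5 + (n ^ 4 + 8 * n ^ 3 + 23 * n ^ 2 + 27 * n + 11) := by
      ring
    omega
  have hpow : 1 ≤ (n + 1) ^ 9 := Nat.pow_pos n.succ_pos
  refine Halts.mono (T := 5 + (C₁ * (n + 1) ^ 9 + ((C₂ * (n + 1) ^ 9 + 1 + 1) + 1)))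
    (.seq ((halts_prologue hW G).mono le_rfl ?_)) ?_ fun _ h => h
  · rintro s ⟨hs, hmem⟩
    refine .seq ((hC₁ n _ G hW s (fun _ => 0) hs (hmem ▸ adjRep_initialState G)
      (fun i hi => by omega)).mono le_rfl ?_)
    rintro s₁ ⟨hs₁, hJ₁, hE₁, hans₁⟩
    rw [hasInducedMinor_graphH2_iff_tests]
    refine .seq (Halts.mono (Q := fun s₂ => Good ((n + 2) ^ 4) n s₂ ∧
      Answer ((∃ x y z a₁ a₂ b₁ b₂, SmallTest G x y z a₁ a₂ b₁ b₂) ∨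
        ∃ c a₁ a₂ b₁ b₂ v w, HubTest G c a₁ a₂ b₁ b₂ v w) s₂)
      (halts_ifLess (T := C₂ * (n + 1) ^ 9 + 1)
        (fun h => (halts_skip ?_).mono (by omega) fun _ h => h)
        (fun h => (hC₂ n _ G hW s₁ (fun _ => 0) hs₁ hJ₁ hE₁).mono (by omega) ?_)) le_rfl ?_)
    · refine ⟨hs₁, ?_⟩
      rcases hans₁ with ⟨h3, hP⟩ | ⟨h3, -⟩
      · exact Or.inl ⟨h3, Or.inl hP⟩
      · rw [h3] at h; omega
    · rintro s₂ ⟨hs₂, -, -, hans₂⟩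
      refine ⟨hs₂, ?_⟩
      rcases hans₁ with ⟨h3, -⟩ | ⟨-, hP⟩
      · rw [h3, hs₁.zero] at h; omega
      · exact hans₂.imp (fun h => ⟨h.1, Or.inr h.2⟩) fun h => ⟨h.1, fun h' => h'.elim hP h.2⟩
    · rintro s₂ ⟨hs₂, hans⟩
      have h1 := hs₂.zero
      rcases hans with ⟨h3, hP⟩ | ⟨h3, hP⟩
      · refine halts_add (by omega) ⟨fun _ => ?_, fun h => absurd hP h⟩
        rw [reg_setReg_self, h3, h1]
      · refine halts_add (by omega) ⟨fun h => absurd h hP, fun _ => ?_⟩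
        rw [reg_setReg_self, h3, h1]
  · rw [Nat.add_mul, Nat.add_mul]
    omega

theorem mainTheorem1 :
    ∃ T : ℕ → ℕ,
      (fun n : ℕ => (T n : ℝ)) =O[Filter.atTop] (fun n : ℕ => (n : ℝ) ^ 9) ∧
      WordRAM.SolvableInTime
        (fun (n : ℕ) (G : SimpleGraph (Fin n)) => HasInducedMinor graphH2 G) T := by
  obtain ⟨C, hC⟩ := exists_h2Program_spec
  refine ⟨fun n => C * (n + 1) ^ 9, ?_, WordRAM.h2Program, 4, fun n G => ?_⟩
  -- The factor `2 ^ 9` comes from `n + 1 ≤ 2 * n` for `n ≥ 1`.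
  · refine Asymptotics.IsBigO.of_bound (C * 2 ^ 9) ?_
    filter_upwards [Filter.eventually_ge_atTop 1] with n hn
    have hn' : (1 : ℝ) ≤ n := by exact_mod_cast hn
    push_cast
    rw [Real.norm_of_nonneg (by positivity), Real.norm_of_nonneg (by positivity), mul_assoc,
      ← mul_pow]
    gcongr
    linarith
  · obtain ⟨t, s, hrun, ht, h⟩ := hC n G
    exact ⟨t, s, hrun, ht, h⟩
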